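/- A school matching instance consists of a finite set $A$ of students and a finite set $B$ of schools, a strict linear order $\succ_a$ on $B^+=B\cup\{\emptyset\}$ for every $a\in A$, a strict linear order $\succ_b$ on $A^+=A\cup\{\emptyset\}$ for every $b\in B$ (where $\emptyset$ is the outside option), and a quota $q_b\in\{0,1,\dots,|A|\}$ for every $b\in B$. A matching $M$ assigns to each student $a$ an element $M(a)\in B^+$ such that at most $q_b$ students are assigned to each school $b$; $M(b)\subseteq A^+$ denotes the set of students assigned to $b$, together with $\emptyset$ if these are fewer than $q_b$. The matching $M$ is stable if (i) there are no $a\in A$, $b\in B$ with $b\succ_a M(a)$ and $a\succ_b x$ for some $x\in M(b)$; (ii) no student $a$ has $\emptyset\succ_a M(a)$; and (iii) no school $b$ has $\emptyset\succ_b a$ for some student $a\in M(b)$. A sibling instance is a school matching instance together with a finite set $\mathcal C\subseteq A\times A$ of pairs of distinct students. A pair $(a,\bar a)\in\mathcal C$ is matched to the same school by $M$ if $M(a)=M(\bar a)=b$ for some school $b\in B$. Theorem. The following two problems, whose input is a sibling instance (given by the quotas, the preference lists and the list of sibling pairs), can be solved in polynomial time, i.e. by a random access machine whose number of steps is bounded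 by a polynomial in the length of the input. (1) (MSSS) Find a stable matching that matches every sibling pair in $\mathcal C$ to the same school, or report that no such stable matching exists. (In particular, one can decide in polynomial time whether such a stable matching exists.) (2) Find a stable matching that maximizes, among all stable matchings, the number of pairs in $\mathcal C$ that are matched to the same school. -/

import Mathlib

/-! ### School matching instances, matchings and stability -/

/-- A school matching instance with `n` students and `m` schools.  `Option (Fin m)` is the set of
schools together with the outside option `none`; `Option (Fin n)` is the set of students together
with the outside option `none`.  A strict linear order over one of these finite sets is given as a
preference list: `studentPref a i` is the alternative that student `a` ranks in position `i`
(position `0` is the most preferred), and similarly for schools. -/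
structure SchoolInstance (n m : ℕ) where
  studentPref : Fin n → Fin (m + 1) ≃ Option (Fin m)
  schoolPref : Fin m → Fin (n + 1) ≃ Option (Fin n)
  quota : Fin m → ℕ
  quota_le : ∀ b, quota b ≤ n

namespace SchoolInstance

variable {n m : ℕ} (I : SchoolInstance n m)

/-- Student `a` strictly prefers `x` to `y`. -/
def StudentPrefers (a : Fin n) (x y : Option (Fin m)) : Prop :=
  (I.studentPref a).symm x < (I.studentPref a).symm y

/-- School `b` strictly prefers `x` to `y`. -/
def SchoolPrefers (b : Fin m) (x y : Option (Fin n)) : Prop :=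
  (I.schoolPref b).symm x < (I.schoolPref b).symm y

/-- An assignment of every student to a school or to the outside option is a matching if no school
exceeds its quota. -/
def IsMatching (M : Fin n → Option (Fin m)) : Prop :=
  ∀ b, (Finset.univ.filter fun a => M a = some b).card ≤ I.quota b

/-- `x` is a partner of the school `b` in `M`: the students assigned to `b` and, if fewer than
`quota b` students are assigned to `b`, also the outside option. -/
def IsPartner (M : Fin n → Option (Fin m)) (b : Fin m) : Option (Fin n) → Prop
  | some a => M a = some b
  | none => (Finset.univ.filter fun a => M a = some b).card < I.quota b

/-- A matching is stable if there are no blocking pairs, no blocking students and no blocking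
schools. -/
structure IsStable (M : Fin n → Option (Fin m)) : Prop where
  isMatching : I.IsMatching M
  no_blocking_pair : ∀ a b, ¬ (I.StudentPrefers a (some b) (M a) ∧
    ∃ x, I.IsPartner M b x ∧ I.SchoolPrefers b (some a) x)
  no_blocking_student : ∀ a, ¬ I.StudentPrefers a none (M a)
  no_blocking_school : ∀ b, ¬ ∃ a, M a = some b ∧ I.SchoolPrefers b none (some a)

end SchoolInstance

/-- A sibling instance: a school matching instance together with a finite set of pairs of distinct
students, given as a list without repetitions. -/
structure SiblingInstance where
  n : ℕ
  m : ℕ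
  inst : SchoolInstance n m
  siblings : List (Fin n × Fin n)
  siblings_nodup : siblings.Nodup
  siblings_ne : ∀ p ∈ siblings, p.1 ≠ p.2

namespace SiblingInstance

variable (X : SiblingInstance)

/-- The two students of the pair `p` are assigned by `M` to the same school (the outside option is
not a school). -/
def SameSchool (M : Fin X.n → Option (Fin X.m)) (p : Fin X.n × Fin X.n) : Prop :=
  ∃ b, M p.1 = some b ∧ M p.2 = some b

open Classical in
/-- The number of sibling pairs that `M` assigns to the same school. -/
noncomputable def numTogether (M : Fin X.n → Option (Fin X.m)) : ℕ :=
  (X.siblings.filter fun p => X.SameSchool M p).length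

/-- A correct answer to (MSSS): a stable matching that assigns every sibling pair to the same
school, or `none` if there is no such matching. -/
def IsSameSchoolAnswer : Option (Fin X.n → Option (Fin X.m)) → Prop
  | some M => X.inst.IsStable M ∧ ∀ p ∈ X.siblings, X.SameSchool M p
  | none => ¬ ∃ M, X.inst.IsStable M ∧ ∀ p ∈ X.siblings, X.SameSchool M p

/-- `M` is a stable matching that assigns as many sibling pairs as possible to the same school. -/
def IsMaxTogether (M : Fin X.n → Option (Fin X.m)) : Prop :=
  X.inst.IsStable M ∧ ∀ M', X.inst.IsStable M' → X.numTogether M' ≤ X.numTogether M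

/-! ### Encodings by lists of natural numbers -/

/-- The number that encodes an agent or the outside option. -/
def code {k : ℕ} : Option (Fin k) → ℕ
  | none => 0
  | some i => i.val + 1

/-- The input: the numbers of students, of schools and of sibling pairs, the quotas, the preference
lists of the students, the preference lists of the schools, and the sibling pairs. -/
def encode : List ℕ :=
  [X.n, X.m, X.siblings.length]
    ++ List.ofFn X.inst.quota
    ++ (List.ofFn fun a => List.ofFn fun i => code (X.inst.studentPref a i)).flatten
    ++ (List.ofFn fun b => List.ofFn fun i => code (X.inst.schoolPref b i)).flatten
    ++ (X.siblings.map fun p => [code (some p.1), code (some p.2)]).flatten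

/-- A matching is written down as the list of the partners of the students. -/
def encodeMatching (M : Fin X.n → Option (Fin X.m)) : List ℕ :=
  List.ofFn fun a => code (M a)

/-- An optional matching: `0` for "there is none", or `1` followed by the matching. -/
def encodeAnswer : Option (Fin X.n → Option (Fin X.m)) → List ℕ
  | none => [0]
  | some M => 1 :: X.encodeMatching M

end SiblingInstance

/-! ### Random access machine programs with a step count

Programs of a random access machine with addition, truncated subtraction, indirect addressing
(arrays), conditionals and loops.  Every elementary operation costs one unit of time.  There is no
multiplication, so the lengths of the numbers in use grow by at most one bit per time unit; hence
polynomial time on this machine is the usual polynomial time. -/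

namespace RAM

/-- A memory: the values of the scalar variables and of the cells of the arrays. -/
structure State where
  var : ℕ → ℕ
  arr : ℕ → ℕ → ℕ

/-- Expressions: constants, variables, array cells `k[e]`, sums, and truncated differences. -/
inductive Expr where
  | const (c : ℕ)
  | var (x : ℕ)
  | read (k : ℕ) (e : Expr)
  | add (e₁ e₂ : Expr)
  | sub (e₁ e₂ : Expr)

namespace Expr

def eval (s : State) : Expr → ℕ
  | const c => c
  | var x => s.var x
  | read k e => s.arr k (e.eval s)
  | add e₁ e₂ => e₁.eval s + e₂.eval s
  | sub e₁ e₂ => e₁.eval s - e₂.eval s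

/-- The number of elementary operations in the evaluation of an expression. -/
def cost : Expr → ℕ
  | const _ => 1
  | var _ => 1
  | read _ e => e.cost + 1
  | add e₁ e₂ => e₁.cost + e₂.cost + 1
  | sub e₁ e₂ => e₁.cost + e₂.cost + 1

end Expr

/-- Programs.  In tests, a nonzero value counts as true. -/
inductive Prog where
  | skip
  | assign (x : ℕ) (e : Expr)
  | write (k : ℕ) (i e : Expr)
  | seq (c₁ c₂ : Prog)
  | ite (e : Expr) (c₁ c₂ : Prog)
  | loop (e : Expr) (c : Prog)

/-- `x := v`. -/
def State.setVar (s : State) (x v : ℕ) : State :=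
  { s with var := Function.update s.var x v }

/-- `k[i] := v`. -/
def State.setArr (s : State) (k i v : ℕ) : State :=
  { s with arr := Function.update s.arr k (Function.update (s.arr k) i v) }

/-- `Exec c s s' t`: started in the memory `s`, the program `c` halts in the memory `s'` after
exactly `t` steps. -/
inductive Exec : Prog → State → State → ℕ → Prop where
  | skip (s : State) : Exec Prog.skip s s 1
  | assign (s : State) (x : ℕ) (e : Expr) :
      Exec (Prog.assign x e) s (s.setVar x (e.eval s)) (e.cost + 1)
  | write (s : State) (k : ℕ) (i e : Expr) :
      Exec (Prog.write k i e) s (s.setArr k (i.eval s) (e.eval s)) (i.cost + e.cost + 1)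
  | seq {c₁ c₂ : Prog} {s₁ s₂ s₃ : State} {t₁ t₂ : ℕ} :
      Exec c₁ s₁ s₂ t₁ → Exec c₂ s₂ s₃ t₂ → Exec (Prog.seq c₁ c₂) s₁ s₃ (t₁ + t₂)
  | ite_true {e : Expr} {c₁ c₂ : Prog} {s s' : State} {t : ℕ} :
      e.eval s ≠ 0 → Exec c₁ s s' t → Exec (Prog.ite e c₁ c₂) s s' (e.cost + 1 + t)
  | ite_false {e : Expr} {c₁ c₂ : Prog} {s s' : State} {t : ℕ} :
      e.eval s = 0 → Exec c₂ s s' t → Exec (Prog.ite e c₁ c₂) s s' (e.cost + 1 + t)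
  | loop_true {e : Expr} {c : Prog} {s₁ s₂ s₃ : State} {t₁ t₂ : ℕ} :
      e.eval s₁ ≠ 0 → Exec c s₁ s₂ t₁ → Exec (Prog.loop e c) s₂ s₃ t₂ →
      Exec (Prog.loop e c) s₁ s₃ (e.cost + 1 + t₁ + t₂)
  | loop_false {e : Expr} {c : Prog} {s : State} :
      e.eval s = 0 → Exec (Prog.loop e c) s s (e.cost + 1)

/-- The initial memory on input `l`: array `0` holds the input, variable `0` holds its number of
entries, and everything else is `0`. -/
def init (l : List ℕ) : State where
  var := fun x => if x = 0 then l.length else 0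
  arr := fun k i => if k = 0 then l.getD i 0 else 0

/-- The output in a final memory: the first entries of array `1`, as many as variable `1` says. -/
def output (s : State) : List ℕ :=
  (List.range (s.var 1)).map (s.arr 1)

/-- The size of an input: the total binary length of its entries, plus one separator each. -/
def inputSize (l : List ℕ) : ℕ :=
  (l.map fun v => Nat.size v + 1).sum

/-- The computational problem that asks, for the input `enc x`, for some output list `y` with
`R x y`, is solvable in polynomial time: one program, with running time bounded by one polynomial in
the size of the input, halts with a correct output on every input. -/
def SolvableInPolyTime {α : Type} (enc : α → List ℕ) (R : α → List ℕ → Prop) : Prop :=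
  ∃ (c : Prog) (p : Polynomial ℕ), ∀ x : α, ∃ (s : State) (t : ℕ),
    Exec c (init (enc x)) s t ∧ t ≤ p.eval (inputSize (enc x)) ∧ R x (output s)

end RAM

/-! A matching is recorded by how far down its list each student has moved. A vector of positions is
stable exactly when it is settled (nobody stands at a rejecting school) and justified (every school
passed has rejected the student). Rejection counts everyone who has ever reached a school, so it is
monotone in the vector, and a comparison of how many students schools hold with how many stand at
them gives `IsStablePos.of_ge` and `IsStablePos.of_le`: above a stable vector justified implies
stable, below one settled implies stable. Hence stable vectors are closed under suprema. Repeatedly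
moving rejected students down from a bound `l` yields the least stable vector above `l`, provided
that some stable vector lies above `l`.

An event is a sibling pair at a school, feasible if some stable matching realizes it. By
`IsStablePos.pos_le_of_pos_lt`, for a feasible event every stable vector satisfies at least one of
two conditions: both students have reached the school (a lower bound), or the worse student has not
passed it (an upper bound). Both hold exactly when the pair is together there
(`Event.Feasible.together_add_one`). Up to the constant number of events, the objective therefore
counts satisfied lower and upper bounds.

A family of such bounds can be satisfied simultaneously as soon as each lower bound is compatible
with each upper bound. Indeed, the supremum over the lower bounds of witnesses for one fixed upper
bound still respects it, and the least stable vector above all the lower bounds lies below each such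
supremum. Maximizing pairs together thus becomes finding a maximum independent set in a bipartite
conflict graph. This is done by an auction with unit price steps: once no bidder waits, any positive
value below the price cap that is not a price separates cheap from expensive objects and gives a
maximum independent set (`IsAuction.card_add_card_le`). The argument is assembled in
`optimize_spec`. (MSSS) follows by checking whether an optimal matching keeps all pairs together.

Polynomial time is obtained from programs whose loops run up to variables that are not modified
inside; `Cmd.exists_exec` bounds their running time, and the `_spec` lemmas establish correctness by
loop invariants. -/

/-! ### Stable matchings as vectors of positions -/

/-- Among the elements of a finite set, exactly `min k #S` have fewer than `k` elements below them. -/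
theorem Finset.card_filter_card_lt {α : Type*} [DecidableEq α] (S : Finset α) (r : α → ℕ)
    (hr : Set.InjOn r S) (k : ℕ) :
    (S.filter fun a => (S.filter fun a' => r a' < r a).card < k).card = min k S.card := by
  set φ : α → ℕ := fun a => (S.filter fun a' => r a' < r a).card with hφ
  have hlt : ∀ a ∈ S, ∀ b ∈ S, r a < r b → φ a < φ b := by
    intro a ha b hb hab
    refine Finset.card_lt_card ⟨?_, ?_⟩
    · intro x hx
      simp only [Finset.mem_filter] at hx ⊢
      exact ⟨hx.1, hx.2.trans hab⟩
    · intro h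
      have := h (Finset.mem_filter.2 ⟨ha, hab⟩)
      simp at this
  have hinj : Set.InjOn φ S := by
    intro a ha b hb hab
    rcases lt_trichotomy (r a) (r b) with h | h | h
    · exact absurd hab (hlt a ha b hb h).ne
    · exact hr ha hb h
    · exact absurd hab (hlt b hb a ha h).ne'
  -- Counting smaller elements numbers `S` bijectively by `0, …, #S - 1`.
  have himg : S.image φ = Finset.range S.card := by
    refine Finset.eq_of_subset_of_card_le ?_ ?_
    · intro x hx
      obtain ⟨a, ha, rfl⟩ := Finset.mem_image.1 hx
      refine Finset.mem_range.2 (Finset.card_lt_card ⟨Finset.filter_subset _ _, fun h => ?_⟩)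
      have := h ha
      simp at this
    · rw [Finset.card_image_of_injOn hinj, Finset.card_range]
  have h1 : ((S.filter fun a => φ a < k).image φ) = (Finset.range S.card).filter (· < k) := by
    rw [← himg, Finset.filter_image]
  have h2 : ((Finset.range S.card).filter (· < k)) = Finset.range (min k S.card) := by
    ext x; simp; omega
  rw [← Finset.card_range (min k S.card), ← h2, ← h1,
    Finset.card_image_of_injOn (hinj.mono (Finset.coe_subset.2 (Finset.filter_subset _ _)))]

/-- Join the witnesses one at a time. Nonemptiness covers the empty index set, since no bottom
element is assumed to lie in `S`. -/
theorem SupClosed.exists_forall_le {α ι : Type*} [SemilatticeSup α] {S : Set α} (hS : SupClosed S)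
    (hne : S.Nonempty) (s : Finset ι) (l : ι → α) (h : ∀ i ∈ s, ∃ p ∈ S, l i ≤ p) :
    ∃ p ∈ S, ∀ i ∈ s, l i ≤ p := by
  classical
  induction s using Finset.induction_on with
  | empty => obtain ⟨p, hp⟩ := hne; exact ⟨p, hp, by simp⟩
  | insert i s _ ih =>
    obtain ⟨p, hp, hps⟩ := ih fun j hj => h j (Finset.mem_insert_of_mem hj)
    obtain ⟨p', hp', hpi⟩ := h i (Finset.mem_insert_self i s)
    refine ⟨p ⊔ p', hS hp hp', fun j hj => ?_⟩
    rcases Finset.mem_insert.1 hj with rfl | hj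
    · exact hpi.trans le_sup_right
    · exact (hps j hj).trans le_sup_left

namespace SchoolInstance

variable {n m : ℕ} (I : SchoolInstance n m)

/-- The position of the alternative `x` in the preference list of student `a`. -/
def pos (a : Fin n) (x : Option (Fin m)) : ℕ := (I.studentPref a).symm x

/-- The position of the alternative `x` in the preference list of school `b`. -/
def rank (b : Fin m) (x : Option (Fin n)) : ℕ := (I.schoolPref b).symm x

theorem pos_injective (a : Fin n) : Function.Injective (I.pos a) := fun _ _ h =>
  (I.studentPref a).symm.injective (Fin.ext h)

theorem rank_injective (b : Fin m) : Function.Injective (I.rank b) := fun _ _ h =>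
  (I.schoolPref b).symm.injective (Fin.ext h)

theorem pos_le (a : Fin n) (x : Option (Fin m)) : I.pos a x ≤ m :=
  Nat.lt_succ_iff.1 ((I.studentPref a).symm x).isLt

theorem studentPref_eq_iff (a : Fin n) (i : Fin (m + 1)) (x : Option (Fin m)) :
    I.studentPref a i = x ↔ (i : ℕ) = I.pos a x := by
  rw [← Equiv.eq_symm_apply, Fin.ext_iff]; rfl

/-- The students that have reached the school `b` in the position vector `q` and that `b` prefers to
the student `a`. -/
def rivals (q : Fin n → ℕ) (b : Fin m) (a : Fin n) : Finset (Fin n) :=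
  Finset.univ.filter fun a' => I.pos a' (some b) ≤ q a' ∧ I.rank b (some a') < I.rank b (some a)

/-- School `b` rejects student `a` if `a` is not acceptable or if sufficiently many better students
have reached `b`. -/
def Rejects (q : Fin n → ℕ) (b : Fin m) (a : Fin n) : Prop :=
  I.rank b none < I.rank b (some a) ∨ I.quota b ≤ (I.rivals q b a).card

/-- No student is rejected by the current school. -/
def IsSettled (q : Fin n → ℕ) : Prop :=
  ∀ a b, I.pos a (some b) = q a → q a < I.pos a none → ¬ I.Rejects q b a

/-- Every student is rejected by all schools before the current position. -/
def IsJustified (q : Fin n → ℕ) : Prop :=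
  ∀ a, q a ≤ I.pos a none ∧ ∀ b, I.pos a (some b) < q a → I.Rejects q b a

/-- The position vectors of stable matchings. -/
structure IsStablePos (q : Fin n → ℕ) : Prop where
  isSettled : I.IsSettled q
  isJustified : I.IsJustified q

variable {I}

/-- Rivals are all students who have reached the school, including those who have moved on, so
moving down only adds rivals. -/
theorem Rejects.mono {q q' : Fin n → ℕ} (h : q ≤ q') {b : Fin m} {a : Fin n}
    (hr : I.Rejects q b a) : I.Rejects q' b a := by
  refine hr.imp id fun hr => hr.trans (Finset.card_le_card ?_)
  intro x hx
  simp only [rivals, Finset.mem_filter] at hx ⊢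
  exact ⟨hx.1, hx.2.1.trans (h x), hx.2.2⟩

theorem Rejects.of_rank_le {q : Fin n → ℕ} {b : Fin m} {a a' : Fin n} (hr : I.Rejects q b a)
    (h : I.rank b (some a) ≤ I.rank b (some a')) : I.Rejects q b a' := by
  refine hr.imp (fun h' => h'.trans_le h) fun hr => hr.trans (Finset.card_le_card ?_)
  intro x hx
  simp only [rivals, Finset.mem_filter] at hx ⊢
  exact ⟨hx.1, hx.2.1, hx.2.2.trans_le h⟩

variable (I)

/-! ### Held students versus located students -/

open Classical in
/-- The students that have reached the school `b` and are not rejected by it. -/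
noncomputable def held (q : Fin n → ℕ) (b : Fin m) : Finset (Fin n) :=
  Finset.univ.filter fun a => I.pos a (some b) ≤ q a ∧ ¬ I.Rejects q b a

/-- The acceptable students that have reached the school `b`. -/
def applicants (q : Fin n → ℕ) (b : Fin m) : Finset (Fin n) :=
  Finset.univ.filter fun a => I.pos a (some b) ≤ q a ∧ I.rank b (some a) < I.rank b none

/-- The students whose current position is the school `b`. -/
def located (q : Fin n → ℕ) (b : Fin m) : Finset (Fin n) :=
  Finset.univ.filter fun a => I.pos a (some b) = q a ∧ q a < I.pos a none

/-- For an acceptable applicant the rivals are exactly the better-ranked applicants, so a school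
holds its best `quota b` applicants, or all of them if there are fewer. This makes the number held
monotone in `q`, although the set held is not. -/
theorem card_held (q : Fin n → ℕ) (b : Fin m) :
    (I.held q b).card = min (I.quota b) (I.applicants q b).card := by
  classical
  rw [← Finset.card_filter_card_lt (I.applicants q b) (fun a => I.rank b (some a))
    (fun a _ a' _ h => Option.some_injective _ (I.rank_injective b h)) (I.quota b)]
  congr 1
  ext a
  simp only [held, applicants, Finset.mem_filter, Finset.mem_univ, true_and, Finset.filter_filter]
  have hne : I.rank b none ≠ I.rank b (some a) := fun h => by
    have := I.rank_injective b h; simp at this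
  by_cases hacc : I.rank b (some a) < I.rank b none
  · have : (Finset.univ.filter fun a' => (I.pos a' (some b) ≤ q a' ∧
        I.rank b (some a') < I.rank b none) ∧ I.rank b (some a') < I.rank b (some a)) =
        I.rivals q b a := by
      ext x; simp only [rivals, Finset.mem_filter, Finset.mem_univ, true_and]
      constructor
      · rintro ⟨⟨h1, _⟩, h2⟩; exact ⟨h1, h2⟩
      · rintro ⟨h1, h2⟩; exact ⟨⟨h1, h2.trans hacc⟩, h2⟩
    rw [this]
    simp only [Rejects, not_or, not_lt, not_le]
    constructor
    · rintro ⟨h1, h2, h3⟩; exact ⟨⟨h1, hacc⟩, h3⟩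
    · rintro ⟨⟨h1, h2⟩, h3⟩; exact ⟨h1, hacc.le, h3⟩
  · constructor
    · rintro ⟨_, h⟩
      exact absurd (Or.inl (lt_of_le_of_ne (not_lt.1 hacc) hne)) h
    · rintro ⟨⟨_, h⟩, _⟩; exact absurd h hacc

variable {I}

theorem card_held_le_quota (q : Fin n → ℕ) (b : Fin m) : (I.held q b).card ≤ I.quota b := by
  rw [card_held]; exact min_le_left _ _

theorem card_held_mono {q q' : Fin n → ℕ} (h : q ≤ q') (b : Fin m) :
    (I.held q b).card ≤ (I.held q' b).card := by
  rw [card_held, card_held]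
  refine min_le_min le_rfl (Finset.card_le_card fun x hx => ?_)
  simp only [applicants, Finset.mem_filter] at hx ⊢
  exact ⟨hx.1, hx.2.1.trans (h x), hx.2.2⟩

/-- An acceptable student is rejected only through `quota b` rivals, all of whom are then acceptable
applicants. -/
theorem card_held_eq_quota {q : Fin n → ℕ} {b : Fin m} {a : Fin n}
    (hacc : I.rank b (some a) < I.rank b none) (hr : I.Rejects q b a) :
    (I.held q b).card = I.quota b := by
  rw [card_held]
  refine min_eq_left (?_ : I.quota b ≤ _)
  rcases hr with hr | hr
  · exact absurd hr hacc.not_gt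
  · refine hr.trans (Finset.card_le_card fun x hx => ?_)
    simp only [rivals, applicants, Finset.mem_filter] at hx ⊢
    exact ⟨hx.1, hx.2.1, hx.2.2.trans hacc⟩

theorem mem_held {q : Fin n → ℕ} {b : Fin m} {a : Fin n} :
    a ∈ I.held q b ↔ I.pos a (some b) ≤ q a ∧ ¬ I.Rejects q b a := by
  simp [held]

theorem mem_located {q : Fin n → ℕ} {b : Fin m} {a : Fin n} :
    a ∈ I.located q b ↔ I.pos a (some b) = q a ∧ q a < I.pos a none := by
  simp [located]

theorem IsSettled.located_subset_held {q : Fin n → ℕ} (h : I.IsSettled q) (b : Fin m) :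
    I.located q b ⊆ I.held q b := by
  intro a ha
  rw [mem_located] at ha
  exact mem_held.2 ⟨ha.1.le, h a b ha.1 ha.2⟩

/-- A held student cannot have passed the school, since passing would require rejection. Together
with the opposite inclusion for settled vectors this lets cardinalities decide stability. -/
theorem IsJustified.held_subset_located {q : Fin n → ℕ} (h : I.IsJustified q) (b : Fin m) :
    I.held q b ⊆ I.located q b := by
  intro a ha
  rw [mem_held] at ha
  have h1 : I.pos a (some b) = q a :=
    ha.1.antisymm (not_lt.1 fun hlt => ha.2 ((h a).2 b hlt))
  refine mem_located.2 ⟨h1, lt_of_le_of_ne (h a).1 fun h2 => ?_⟩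
  have := I.pos_injective a (h1.trans h2)
  simp at this

theorem IsStablePos.held_eq_located {q : Fin n → ℕ} (h : I.IsStablePos q) (b : Fin m) :
    I.held q b = I.located q b :=
  (h.isJustified.held_subset_located b).antisymm (h.isSettled.located_subset_held b)

theorem sum_card_located {q : Fin n → ℕ} :
    ∑ b, (I.located q b).card = (Finset.univ.filter fun a => q a < I.pos a none).card := by
  rw [← Finset.card_biUnion]
  · congr 1
    ext a
    simp only [Finset.mem_biUnion, Finset.mem_univ, true_and, mem_located, Finset.mem_filter]
    constructor
    · rintro ⟨b, _, h⟩; exact h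
    · intro h
      have hlt : q a < m + 1 := h.trans_le ((I.pos_le a none).trans (Nat.le_succ m))
      rcases hx : I.studentPref a ⟨q a, hlt⟩ with _ | b
      · rw [studentPref_eq_iff] at hx
        exact absurd hx h.ne
      · rw [studentPref_eq_iff] at hx
        exact ⟨b, hx.symm, h⟩
  · intro b _ b' _ hbb'
    refine Finset.disjoint_left.2 fun a ha ha' => hbb' ?_
    rw [mem_located] at ha ha'
    exact Option.some_injective _ (I.pos_injective a (ha.1.trans ha'.1.symm))

/-- Moving down can only push students to the outside option or beyond, while the number held can
only grow; these opposite monotonicities drive the next two theorems. -/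
theorem sum_card_located_anti {q q' : Fin n → ℕ} (h : q ≤ q') :
    ∑ b, (I.located q' b).card ≤ ∑ b, (I.located q b).card := by
  rw [sum_card_located, sum_card_located]
  refine Finset.card_le_card fun a ha => ?_
  simp only [Finset.mem_filter] at ha ⊢
  exact ⟨ha.1, (h a).trans_lt ha.2⟩

/-- A justified position vector above a stable one is stable. -/
theorem IsStablePos.of_ge {p q : Fin n → ℕ} (hp : I.IsStablePos p) (hpq : p ≤ q)
    (hq : I.IsJustified q) : I.IsStablePos q := by
  have hle : ∀ b ∈ Finset.univ, (I.held q b).card ≤ (I.located q b).card := fun b _ =>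
    Finset.card_le_card (hq.held_subset_located b)
  -- Totals satisfy located at `q` ≤ located at `p` = held at `p` ≤ held at `q`, while justification
  -- gives the reverse school by school; so equality holds at every school.
  have hsum : ∑ b, (I.located q b).card ≤ ∑ b, (I.held q b).card :=
    (sum_card_located_anti hpq).trans (Finset.sum_le_sum fun b _ => by
      rw [← hp.held_eq_located b]; exact card_held_mono hpq b)
  have heq := (Finset.sum_eq_sum_iff_of_le hle).1 (le_antisymm (Finset.sum_le_sum hle) hsum)
  refine ⟨fun a b h1 h2 => ?_, hq⟩
  have h3 := Finset.eq_of_subset_of_card_le (hq.held_subset_located b)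
    (heq b (Finset.mem_univ b)).ge
  exact (mem_held.1 (h3 ▸ mem_located.2 ⟨h1, h2⟩ : a ∈ I.held q b)).2

/-- A settled position vector below a stable one is stable, and every school holds as many
students in it as in the given one. -/
theorem IsStablePos.of_le {p q : Fin n → ℕ} (hp : I.IsStablePos p) (hqp : q ≤ p)
    (hq : I.IsSettled q) :
    I.IsStablePos q ∧ ∀ b, (I.held q b).card = (I.held p b).card := by
  have hle : ∀ b ∈ Finset.univ, (I.located q b).card ≤ (I.held q b).card := fun b _ =>
    Finset.card_le_card (hq.located_subset_held b)
  have hle2 : ∀ b ∈ Finset.univ, (I.held q b).card ≤ (I.held p b).card := fun b _ =>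
    card_held_mono hqp b
  -- This closes the cycle located at `q` ≤ held at `q` ≤ held at `p` ≤ located at `q` of totals, so
  -- both termwise inequalities are equalities.
  have h12 : ∑ b, (I.held p b).card ≤ ∑ b, (I.located q b).card := by
    simp only [hp.held_eq_located]
    exact sum_card_located_anti hqp
  have s1 := Finset.sum_le_sum hle
  have s2 := Finset.sum_le_sum hle2
  have heq := (Finset.sum_eq_sum_iff_of_le hle).1 (by omega)
  have heq2 := (Finset.sum_eq_sum_iff_of_le hle2).1 (by omega)
  refine ⟨⟨hq, fun a => ⟨?_, fun b hb => ?_⟩⟩, fun b => heq2 b (Finset.mem_univ b)⟩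
  · exact (hqp a).trans (hp.isJustified a).1
  · by_contra hr
    have h3 := Finset.eq_of_subset_of_card_le (hq.located_subset_held b)
      (heq b (Finset.mem_univ b)).ge
    have : a ∈ I.located q b := h3 ▸ mem_held.2 ⟨hb.le, hr⟩
    exact hb.ne (mem_located.1 this).1

/-- A school passed in the supremum was passed in `p` or in `q`, and the rejection there persists
upward; `IsStablePos.of_ge` then supplies settledness. -/
theorem IsStablePos.sup {p q : Fin n → ℕ} (hp : I.IsStablePos p) (hq : I.IsStablePos q) :
    I.IsStablePos (p ⊔ q) := by
  refine hp.of_ge le_sup_left fun a => ⟨sup_le (hp.isJustified a).1 (hq.isJustified a).1, ?_⟩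
  intro b hb
  rcases lt_sup_iff.1 hb with hb | hb
  · exact ((hp.isJustified a).2 b hb).mono le_sup_left
  · exact ((hq.isJustified a).2 b hb).mono le_sup_right

/-- Each student stands where `p` or `q` puts it, and a rejection at the infimum would persist in
that vector. -/
theorem IsStablePos.isSettled_inf {p q : Fin n → ℕ} (hp : I.IsStablePos p)
    (hq : I.IsStablePos q) : I.IsSettled (p ⊓ q) := by
  intro a b h1 h2 hr
  simp only [Pi.inf_apply] at h1 h2
  rcases le_total (p a) (q a) with h | h
  · rw [inf_eq_left.2 h] at h1 h2
    exact hp.isSettled a b h1 h2 (hr.mono inf_le_left)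
  · rw [inf_eq_right.2 h] at h1 h2
    exact hq.isSettled a b h1 h2 (hr.mono inf_le_right)

/-- In a stable vector a student who reached a rejecting school cannot stand there, so must have
passed it. -/
theorem Rejects.pos_lt {q : Fin n → ℕ} (h : I.IsStablePos q) {a : Fin n} {b : Fin m}
    (hr : I.Rejects q b a) (ha : I.pos a (some b) ≤ q a) : I.pos a (some b) < q a := by
  refine lt_of_le_of_ne ha fun h1 => h.isSettled a b h1 ?_ hr
  refine lt_of_le_of_ne (h.isJustified a).1 fun h2 => ?_
  have := I.pos_injective a (h1.trans h2)
  simp at this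

variable (I)

/-- Deferred acceptance as an extremal argument: in a justified vector of maximal sum nobody is
rejected at the current school, since moving that student on would keep the vector justified. -/
theorem exists_isStablePos : ∃ q, I.IsStablePos q := by
  classical
  let S : Finset (Fin n → Fin (m + 1)) := Finset.univ.filter fun q => I.IsJustified fun a => q a
  have hS : S.Nonempty := ⟨fun _ => 0, by
    refine Finset.mem_filter.2 ⟨Finset.mem_univ _, fun a => ⟨by simp, fun b hb => ?_⟩⟩
    simp at hb⟩
  obtain ⟨q, hq, hmax⟩ := S.exists_max_image (fun q => ∑ a, (q a : ℕ)) hS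
  have hqJ : I.IsJustified fun a => q a := by simpa [S] using hq
  refine ⟨fun a => q a, ?_, hqJ⟩
  intro a b h1 h2 hr
  have hlt : (q a : ℕ) + 1 < m + 1 := by
    have := I.pos_le a none
    simp only at h2
    omega
  let q' : Fin n → Fin (m + 1) := Function.update q a ⟨q a + 1, hlt⟩
  have hle : (fun a => (q a : ℕ)) ≤ fun a => (q' a : ℕ) := by
    intro c
    by_cases hc : c = a
    · subst hc; simp [q']
    · simp [q', hc]
  have hq' : q' ∈ S := by
    simp only [S, Finset.mem_filter, Finset.mem_univ, true_and]
    intro c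
    by_cases hc : c = a
    · subst hc
      refine ⟨by simp [q']; omega, fun b' hb' => ?_⟩
      simp only [q', Function.update_self] at hb'
      -- The only newly passed school is `b`, which has just rejected the student.
      rcases (Nat.lt_succ_iff.1 hb').lt_or_eq with h | h
      · exact ((hqJ c).2 b' h).mono hle
      · have : b' = b := Option.some_injective _ (I.pos_injective c (h.trans h1.symm))
        exact this ▸ hr.mono hle
    · have hcq : q' c = q c := by simp [q', hc]
      simp only [hcq]
      exact ⟨(hqJ c).1, fun b' hb' => ((hqJ c).2 b' hb').mono hle⟩
  have := hmax q' hq'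
  have h3 : ∑ c, (q c : ℕ) < ∑ c, (q' c : ℕ) :=
    Finset.sum_lt_sum (fun c _ => hle c) ⟨a, Finset.mem_univ a, by simp [q']⟩
  omega

/-! ### Translation between stable matchings and stable position vectors -/

/-- The position vector of a matching. -/
def posOf (M : Fin n → Option (Fin m)) : Fin n → ℕ := fun a => I.pos a (M a)

/-- The matching of a position vector. -/
def matchingOf (q : Fin n → ℕ) : Fin n → Option (Fin m) := fun a =>
  if h : q a < m + 1 then I.studentPref a ⟨q a, h⟩ else none

variable {I}

theorem pos_matchingOf {q : Fin n → ℕ} (a : Fin n) (h : q a ≤ m) :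
    I.pos a (I.matchingOf q a) = q a := by
  have h' : q a < m + 1 := by omega
  rw [matchingOf, dif_pos h']
  exact ((I.studentPref_eq_iff a ⟨q a, h'⟩ _).1 rfl).symm

theorem matchingOf_posOf (M : Fin n → Option (Fin m)) : I.matchingOf (I.posOf M) = M := by
  funext a
  exact I.pos_injective a (pos_matchingOf a (I.pos_le a _))

theorem IsStablePos.le {q : Fin n → ℕ} (h : I.IsStablePos q) (a : Fin n) : q a ≤ m :=
  (h.isJustified a).1.trans (I.pos_le a none)

theorem IsStablePos.matchingOf_eq_some_iff {q : Fin n → ℕ} (h : I.IsStablePos q) (a : Fin n)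
    (b : Fin m) : I.matchingOf q a = some b ↔ a ∈ I.located q b := by
  rw [mem_located]
  have h0 := pos_matchingOf (I := I) a (h.le a)
  constructor
  · intro hM
    rw [hM] at h0
    refine ⟨h0, lt_of_le_of_ne (h.isJustified a).1 fun h2 => ?_⟩
    have := I.pos_injective a (h0.trans h2)
    simp at this
  · rintro ⟨h1, _⟩
    exact I.pos_injective a (h0.trans h1.symm)

/-- The students assigned to a school are exactly those it holds. If a student prefers `b`,
justification says that `b` rejects that student: then `b` has no free seat (or the student is
unacceptable), and nobody ranked lower is held. -/
theorem IsStablePos.isStable {q : Fin n → ℕ} (h : I.IsStablePos q) :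
    I.IsStable (I.matchingOf q) := by
  have hfil : ∀ b, (Finset.univ.filter fun a => I.matchingOf q a = some b) = I.held q b := by
    intro b
    ext a
    rw [h.held_eq_located, ← h.matchingOf_eq_some_iff]
    simp
  have hpos := fun a => pos_matchingOf (I := I) a (h.le a)
  refine ⟨fun b => ?_, ?_, ?_, ?_⟩
  · rw [hfil]; exact card_held_le_quota q b
  · rintro a b ⟨h1, x, h2, h3⟩
    have h1 : I.pos a (some b) < I.pos a (I.matchingOf q a) := h1
    have h3 : I.rank b (some a) < I.rank b x := h3
    rw [hpos] at h1
    have hr := (h.isJustified a).2 b h1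
    rcases x with _ | x
    · have h2 : (Finset.univ.filter fun a => I.matchingOf q a = some b).card < I.quota b := h2
      rw [hfil, card_held_eq_quota h3 hr] at h2
      exact lt_irrefl _ h2
    · have h2 : I.matchingOf q x = some b := h2
      rw [h.matchingOf_eq_some_iff, ← h.held_eq_located, mem_held] at h2
      exact h2.2 (hr.of_rank_le h3.le)
  · intro a h1
    have h1 : I.pos a none < I.pos a (I.matchingOf q a) := h1
    rw [hpos] at h1
    exact absurd (h.isJustified a).1 h1.not_ge
  · rintro b ⟨a, h1, h2⟩
    rw [h.matchingOf_eq_some_iff, ← h.held_eq_located, mem_held] at h1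
    exact h1.2 (Or.inl h2)

theorem IsStable.isStablePos {M : Fin n → Option (Fin m)} (h : I.IsStable M) :
    I.IsStablePos (I.posOf M) := by
  have heq : ∀ {a b}, I.pos a (some b) = I.posOf M a → M a = some b := fun {a b} h1 =>
    (I.pos_injective a h1).symm
  refine ⟨?_, fun a => ⟨not_lt.1 (h.no_blocking_student a), fun b hb => ?_⟩⟩
  · intro a b h1 _ hr
    have hM := heq h1
    rcases hr with hr | hr
    · exact h.no_blocking_school b ⟨a, hM, hr⟩
    -- If all rivals were at `b`, they and `a` would exceed the quota. A rival elsewhere has passed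
    -- `b` and blocks together with `b`, displacing `a`.
    · have : ∃ s ∈ I.rivals (I.posOf M) b a, M s ≠ some b := by
        by_contra! hall
        have h3 : insert a (I.rivals (I.posOf M) b a) ⊆
            Finset.univ.filter fun a => M a = some b := by
          intro x hx
          rcases Finset.mem_insert.1 hx with rfl | hx
          · simp [hM]
          · simp [hall x hx]
        have h4 := (Finset.card_le_card h3).trans (h.isMatching b)
        rw [Finset.card_insert_of_notMem (by simp [rivals])] at h4
        omega
      obtain ⟨s, hs, hsM⟩ := this
      simp only [rivals, Finset.mem_filter, Finset.mem_univ, true_and] at hs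
      refine h.no_blocking_pair s b ⟨lt_of_le_of_ne hs.1 fun h5 => hsM (heq (Fin.ext_iff.1 h5)), some a, hM, hs.2⟩
  · have hno : ∀ x, I.IsPartner M b x → ¬ I.rank b (some a) < I.rank b x := fun x hx hlt =>
      h.no_blocking_pair a b ⟨hb, x, hx, hlt⟩
    -- With a free seat, absence of blocking makes `a` unacceptable; without one, the students at
    -- `b` are all rivals of `a`.
    by_cases hq : (Finset.univ.filter fun a => M a = some b).card < I.quota b
    · refine Or.inl (lt_of_le_of_ne (not_lt.1 (hno none hq)) fun h1 => ?_)
      have := I.rank_injective b h1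
      simp at this
    · refine Or.inr ((not_lt.1 hq).trans (Finset.card_le_card fun x hx => ?_))
      have hx : M x = some b := by simpa using hx
      simp only [rivals, Finset.mem_filter, Finset.mem_univ, true_and]
      refine ⟨by simp [posOf, hx], lt_of_le_of_ne (not_lt.1 (hno (some x) hx)) fun h1 => ?_⟩
      obtain rfl := Option.some_injective _ (I.rank_injective b h1)
      simp [posOf, hx] at hb

/-! ### Least stable position vectors above a given vector -/

variable (I) in
/-- `q` is settled, lies above `l`, and lies below every stable position vector above `l`. -/
structure IsRaised (l q : Fin n → ℕ) : Prop where
  isSettled : I.IsSettled q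
  le : l ≤ q
  le_of_le : ∀ p, I.IsStablePos p → l ≤ p → q ≤ p

theorem IsRaised.isStablePos {l q p : Fin n → ℕ} (h : I.IsRaised l q) (hp : I.IsStablePos p)
    (hlp : l ≤ p) : I.IsStablePos q :=
  (hp.of_le (h.le_of_le p hp hlp) h.isSettled).1

theorem IsStablePos.supClosed (I : SchoolInstance n m) : SupClosed {p | I.IsStablePos p} :=
  fun _ hp _ hq => hp.sup hq

/-- If some stable matching assigns `v` and `w` to the school `b`, which prefers `v` to `w`, then
`w` never leaves `b` before `v` arrives. -/
theorem IsStablePos.pos_le_of_pos_lt {p r : Fin n → ℕ} (hp : I.IsStablePos p)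
    (hr : I.IsStablePos r) {v w : Fin n} {b : Fin m} (hv : I.pos v (some b) = r v)
    (hw : I.pos w (some b) = r w) (hpw : I.pos w (some b) < p w) : I.pos v (some b) ≤ p v := by
  by_contra! hpv
  -- The meet is stable and `b` holds equally many students in it as in `r`. It loses `v`, who has
  -- not reached `b` in `p`, so it must gain some `z`.
  obtain ⟨hs, hcard⟩ := hr.of_le inf_le_right (hp.isSettled_inf hr)
  have hnone : ∀ {a : Fin n} {q : Fin n → ℕ}, I.IsStablePos q → I.pos a (some b) = q a →
      a ∈ I.held q b := by
    intro a q hq h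
    refine mem_held.2 ⟨h.le, fun hr => (hr.pos_lt hq h.le).ne h⟩
  have hvr : v ∈ I.held r b := hnone hr hv
  have hvs : v ∉ I.held (p ⊓ r) b := by
    intro h
    have := (mem_held.1 h).1
    simp only [Pi.inf_apply, le_inf_iff] at this
    exact absurd this.1 hpv.not_ge
  obtain ⟨z, hz, hzr⟩ : ∃ z ∈ I.held (p ⊓ r) b, z ∉ I.held r b := by
    by_contra! hsub
    have := Finset.eq_of_subset_of_card_le hsub (hcard b).ge
    exact hvs (this ▸ hvr)
  have hz' := mem_located.1 (hs.isJustified.held_subset_located b hz)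
  simp only [Pi.inf_apply] at hz'
  have hzle : I.pos z (some b) ≤ r z := hz'.1.le.trans inf_le_right
  have hzr' : I.Rejects r b z := by
    by_contra h
    exact hzr (mem_held.2 ⟨hzle, h⟩)
  have hzlt := hzr'.pos_lt hr hzle
  -- In `r` the student `z` is rejected and has moved on, so its place at `b` in the meet comes from
  -- `p`.
  have hzp : I.pos z (some b) = p z := by
    rcases le_total (p z) (r z) with h | h
    · rw [inf_eq_left.2 h] at hz'; exact hz'.1
    · rw [inf_eq_right.2 h] at hz'; exact absurd hz'.1 hzlt.ne
  have hzn := (mem_held.1 (hnone hp hzp)).2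
  have hwn := (mem_held.1 (hnone hr hw)).2
  have hwp := (hp.isJustified w).2 b hpw
  -- At `p` the school rejects `w` but not `z`; at `r` it rejects `z` but not `w`. Either order of
  -- `w` and `z` contradicts one of these.
  rcases le_total (I.rank b (some w)) (I.rank b (some z)) with h | h
  · exact hzn (hwp.of_rank_le h)
  · exact hwn (hzr'.of_rank_le h)

end SchoolInstance

namespace SchoolInstance

variable {n m : ℕ} {I : SchoolInstance n m}

theorem IsStablePos.matchingOf_eq_some_iff_eq {q : Fin n → ℕ} (h : I.IsStablePos q) (a : Fin n)
    (b : Fin m) : I.matchingOf q a = some b ↔ q a = I.pos a (some b) := by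
  rw [h.matchingOf_eq_some_iff, mem_located]
  refine ⟨fun h1 => h1.1.symm, fun h1 => ⟨h1.symm, lt_of_le_of_ne (h.isJustified a).1 fun h2 => ?_⟩⟩
  have := I.pos_injective a (h1.symm.trans h2)
  simp at this

end SchoolInstance

/-! ### Events: a sibling pair is together at a school -/

/-- Two students and a school. -/
structure SiblingInstance.Event (X : SiblingInstance) where
  better : Fin X.n
  worse : Fin X.n
  school : Fin X.m

namespace SiblingInstance.Event

variable {X : SiblingInstance} (e : X.Event)

/-- The position of the school in the list of the better student. -/
def betterPos : ℕ := X.inst.pos e.better (some e.school)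

/-- The position of the school in the list of the worse student. -/
def worsePos : ℕ := X.inst.pos e.worse (some e.school)

/-- The least position vector in which both students have reached the school. -/
def floor : Fin X.n → ℕ :=
  Function.update (Function.update 0 e.worse e.worsePos) e.better e.betterPos

/-- Both students are at the school. -/
def Together (q : Fin X.n → ℕ) : Prop := q e.better = e.betterPos ∧ q e.worse = e.worsePos

instance (q : Fin X.n → ℕ) : Decidable (e.Together q) := inferInstanceAs (Decidable (_ ∧ _))

/-- The school prefers the better to the worse student, and some stable matching assigns both to the
school. -/
structure Feasible : Prop where
  rank_lt : X.inst.rank e.school (some e.better) < X.inst.rank e.school (some e.worse)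
  exists_together : ∃ q, X.inst.IsStablePos q ∧ e.Together q

variable {e}

theorem ne_of_rank_lt
    (h : X.inst.rank e.school (some e.better) < X.inst.rank e.school (some e.worse)) :
    e.worse ≠ e.better := fun h' => by simp [h'] at h

theorem floor_le_iff (h : e.worse ≠ e.better) (q : Fin X.n → ℕ) :
    e.floor ≤ q ↔ e.betterPos ≤ q e.better ∧ e.worsePos ≤ q e.worse := by
  constructor
  · intro hq
    have h1 := hq e.better
    have h2 := hq e.worse
    simp only [floor, Function.update_self, Function.update_of_ne h] at h1 h2
    exact ⟨h1, h2⟩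
  · rintro ⟨h1, h2⟩ a
    by_cases ha : a = e.better
    · subst ha; simpa [floor] using h1
    · by_cases ha' : a = e.worse
      · subst ha'; simpa [floor, Function.update_of_ne h] using h2
      · simp [floor, ha, ha']

theorem floor_le_m (a : Fin X.n) : e.floor a ≤ X.m := by
  simp only [floor, Function.update_apply]
  split_ifs
  · exact X.inst.pos_le _ _
  · exact X.inst.pos_le _ _
  · exact Nat.zero_le _

/-- The worse student is still at the school. Had the better one left, it would have been rejected,
and then so would the worse one. -/
theorem together_of_floor_le
    (h : X.inst.rank e.school (some e.better) < X.inst.rank e.school (some e.worse))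
    {q : Fin X.n → ℕ} (hq : X.inst.IsStablePos q) (h1 : e.floor ≤ q)
    (h2 : q e.worse ≤ e.worsePos) : e.Together q := by
  rw [floor_le_iff (ne_of_rank_lt h)] at h1
  have hw : q e.worse = e.worsePos := h2.antisymm h1.2
  refine ⟨(h1.1.antisymm (not_lt.1 fun hlt => ?_)).symm, hw⟩
  exact ((((hq.isJustified e.better).2 e.school hlt).of_rank_le h.le).pos_lt hq h1.2).ne hw.symm

/-- Feasibility supplies the stable matching required by `IsStablePos.pos_le_of_pos_lt`: once the
worse student has left, the better one has arrived. -/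
theorem Feasible.floor_le_or (h : e.Feasible) {q : Fin X.n → ℕ} (hq : X.inst.IsStablePos q) :
    e.floor ≤ q ∨ q e.worse ≤ e.worsePos := by
  obtain ⟨r, hr, hr1, hr2⟩ := h.exists_together
  refine or_iff_not_imp_right.2 fun hlt => ?_
  rw [not_le] at hlt
  rw [floor_le_iff (ne_of_rank_lt h.rank_lt)]
  exact ⟨hq.pos_le_of_pos_lt hr hr1.symm hr2.symm hlt, hlt.le⟩

theorem Together.floor_le (h : e.worse ≠ e.better) {q : Fin X.n → ℕ} (hq : e.Together q) :
    e.floor ≤ q :=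
  (floor_le_iff h q).2 ⟨hq.1.ge, hq.2.ge⟩

/-- The contribution of an event is the sum of the indicators of a lower and an upper bound. -/
theorem Feasible.together_add_one (h : e.Feasible) {q : Fin X.n → ℕ} (hq : X.inst.IsStablePos q)
    [Decidable (e.floor ≤ q)] :
    (if e.Together q then 1 else 0) + 1 =
      (if e.floor ≤ q then 1 else 0) + (if q e.worse ≤ e.worsePos then 1 else 0) := by
  by_cases h1 : e.floor ≤ q <;> by_cases h2 : q e.worse ≤ e.worsePos
  · simp [h1, h2, together_of_floor_le h.rank_lt hq h1 h2]
  · have : ¬ e.Together q := fun h3 => h2 h3.2.le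
    simp [h1, h2, this]
  · have : ¬ e.Together q := fun h3 => h1 (h3.floor_le (ne_of_rank_lt h.rank_lt))
    simp [h1, h2, this]
  · exact absurd (h.floor_le_or hq) (by tauto)

end SiblingInstance.Event

namespace SiblingInstance

variable (X : SiblingInstance)

/-- The event that the pair `p` is together at `b`. -/
def eventOf (p : Fin X.n × Fin X.n) (b : Fin X.m) : X.Event :=
  if X.inst.rank b (some p.1) < X.inst.rank b (some p.2) then ⟨p.1, p.2, b⟩ else ⟨p.2, p.1, b⟩

variable {X}

theorem rank_eventOf_lt {p : Fin X.n × Fin X.n} (hp : p.1 ≠ p.2) (b : Fin X.m) :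
    X.inst.rank (X.eventOf p b).school (some (X.eventOf p b).better) <
      X.inst.rank (X.eventOf p b).school (some (X.eventOf p b).worse) := by
  unfold eventOf
  split_ifs with h
  · exact h
  · refine lt_of_le_of_ne (not_lt.1 h) fun h1 => hp ?_
    exact (Option.some_injective _ (X.inst.rank_injective b h1)).symm

theorem together_eventOf_iff {p : Fin X.n × Fin X.n} {b : Fin X.m} {q : Fin X.n → ℕ} :
    (X.eventOf p b).Together q ↔
      q p.1 = X.inst.pos p.1 (some b) ∧ q p.2 = X.inst.pos p.2 (some b) := by
  unfold eventOf
  split_ifs with h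
  · exact Iff.rfl
  · exact and_comm

end SiblingInstance

/-! ### Maximum independent sets in bipartite graphs by auctions -/

/-- The invariants of an auction on the bipartite graph with `E` bidders, `E` objects and the edge
relation `r`.  The object `f` has the price `price f` and belongs to the bidder `e` if
`owner f = e + 1`.  The bidder `e` is waiting, is an owner, or has given up if `status (e + 1)` is
`0`, `1` or `2`. -/
structure IsAuction (E : ℕ) (r : ℕ → ℕ → Prop) (price owner status : ℕ → ℕ) : Prop where
  owner_le : ∀ f < E, owner f ≤ E
  owner_inj : ∀ f < E, ∀ f' < E, owner f = owner f' → owner f ≠ 0 → f = f'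
  status_owner : ∀ f < E, owner f ≠ 0 → status (owner f) = 1
  exists_owner : ∀ e < E, status (e + 1) = 1 → ∃ f < E, owner f = e + 1
  rel_owner : ∀ f < E, ∀ e, owner f = e + 1 → r e f
  slack : ∀ f < E, ∀ e, owner f = e + 1 → ∀ f' < E, r e f' → price f ≤ price f' + 1
  price_free : ∀ f < E, owner f = 0 → price f = 0
  price_dead : ∀ e < E, status (e + 1) = 2 → ∀ f < E, r e f → E + 2 ≤ price f
  price_le : ∀ f < E, price f ≤ E + 2
  status_le : ∀ e < E, status (e + 1) ≤ 2

namespace IsAuction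

variable {E : ℕ} {r : ℕ → ℕ → Prop} {price owner status : ℕ → ℕ}

theorem init (E : ℕ) (r : ℕ → ℕ → Prop) (h1 : price = 0) (h2 : owner = 0) (h3 : status = 0) :
    IsAuction E r price owner status := by
  subst h1 h2 h3
  constructor <;> simp

/-- Since `f` is a cheapest neighbour, raising its price by one costs the new owner exactly the
permitted slack. The previous owner waits again; if `f` was free, the reset hits the unused status
cell `0`. -/
theorem bid (h : IsAuction E r price owner status) {e f : ℕ} (he : e < E)
    (hst : status (e + 1) = 0) (hf : f < E) (hr : r e f) (hlt : price f < E + 2)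
    (hmin : ∀ f' < E, r e f' → price f ≤ price f') :
    IsAuction E r (Function.update price f (price f + 1)) (Function.update owner f (e + 1))
      (Function.update (Function.update status (owner f) 0) (e + 1) 1) := by
  have hle : ∀ f', price f' ≤ Function.update price f (price f + 1) f' := by
    intro f'
    by_cases h1 : f' = f
    · subst h1; simp
    · simp [h1]
  refine ⟨?_, ?_, ?_, ?_, ?_, ?_, ?_, ?_, ?_, ?_⟩
  · intro f' hf'
    by_cases h1 : f' = f
    · subst h1; simp; omega
    · simpa [h1] using h.owner_le f' hf'
  -- A waiting bidder owns nothing.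
  · have key : ∀ f' < E, f' ≠ f → owner f' ≠ e + 1 := by
      intro f' hf' _ h1
      have := h.status_owner f' hf' (by omega)
      rw [h1, hst] at this
      omega
    intro f₁ hf₁ f₂ hf₂
    by_cases h1 : f₁ = f <;> by_cases h2 : f₂ = f
    · intros; rw [h1, h2]
    · subst h1
      simp only [Function.update_self, Function.update_of_ne h2]
      intro h3; exact absurd h3.symm (key f₂ hf₂ h2)
    · subst h2
      simp only [Function.update_self, Function.update_of_ne h1]
      intro h3; exact absurd h3 (key f₁ hf₁ h1)
    · simpa only [Function.update_of_ne h1, Function.update_of_ne h2] using h.owner_inj f₁ hf₁ f₂ hf₂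
  · intro f' hf'
    by_cases h1 : f' = f
    · subst h1; simp
    · simp only [Function.update_of_ne h1]
      intro h2
      have h3 := h.status_owner f' hf' h2
      by_cases h4 : owner f' = e + 1
      · rw [h4]; simp
      · have h5 : owner f' ≠ owner f := fun h6 => h1 (h.owner_inj f' hf' f hf h6 h2)
        simp [h4, h5, h3]
  · intro e' he' h1
    by_cases h2 : e' = e
    · subst h2; exact ⟨f, hf, by simp⟩
    · have h3 : e' + 1 ≠ e + 1 := by omega
      rw [Function.update_of_ne h3] at h1
      by_cases h4 : e' + 1 = owner f
      · rw [h4, Function.update_self] at h1; omega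
      · rw [Function.update_of_ne h4] at h1
        obtain ⟨f', hf', h5⟩ := h.exists_owner e' he' h1
        have h6 : f' ≠ f := by rintro rfl; exact h4 h5.symm
        exact ⟨f', hf', by rw [Function.update_of_ne h6, h5]⟩
  · intro f' hf' e' h1
    by_cases h2 : f' = f
    · subst h2
      rw [Function.update_self] at h1
      obtain rfl : e = e' := by omega
      exact hr
    · rw [Function.update_of_ne h2] at h1; exact h.rel_owner f' hf' e' h1
  · intro f' hf' e' h1 f'' hf'' h3
    refine le_trans ?_ (Nat.add_le_add_right (hle f'') 1)
    by_cases h2 : f' = f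
    · subst h2
      rw [Function.update_self] at h1 ⊢
      obtain rfl : e = e' := by omega
      have := hmin f'' hf'' h3
      omega
    · rw [Function.update_of_ne h2] at h1 ⊢
      exact h.slack f' hf' e' h1 f'' hf'' h3
  · intro f' hf' h1
    by_cases h2 : f' = f
    · subst h2; simp at h1
    · rw [Function.update_of_ne h2] at h1 ⊢; exact h.price_free f' hf' h1
  · intro e' he' h1 f' hf' h3
    refine le_trans ?_ (hle f')
    by_cases h2 : e' = e
    · subst h2; simp at h1
    · have h4 : e' + 1 ≠ e + 1 := by omega
      rw [Function.update_of_ne h4] at h1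
      by_cases h5 : e' + 1 = owner f
      · rw [h5, Function.update_self] at h1; omega
      · rw [Function.update_of_ne h5] at h1
        exact h.price_dead e' he' h1 f' hf' h3
  · intro f' hf'
    by_cases h2 : f' = f
    · subst h2; rw [Function.update_self]; omega
    · rw [Function.update_of_ne h2]; exact h.price_le f' hf'
  · intro e' he'
    have := h.status_le e' he'
    simp only [Function.update_apply]
    split_ifs <;> omega

theorem giveUp (h : IsAuction E r price owner status) {e : ℕ} (hst : status (e + 1) = 0)
    (hdead : ∀ f < E, r e f → E + 2 ≤ price f) :
    IsAuction E r price owner (Function.update status (e + 1) 2) := by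
  refine ⟨h.owner_le, h.owner_inj, ?_, ?_, h.rel_owner, h.slack, h.price_free, ?_, h.price_le, ?_⟩
  · intro f hf h1
    have h2 := h.status_owner f hf h1
    have h3 : owner f ≠ e + 1 := fun h3 => by rw [h3, hst] at h2; omega
    rw [Function.update_of_ne h3, h2]
  · intro e' he' h1
    by_cases h2 : e' + 1 = e + 1
    · rw [h2, Function.update_self] at h1; omega
    · rw [Function.update_of_ne h2] at h1; exact h.exists_owner e' he' h1
  · intro e' he' h1
    by_cases h2 : e' = e
    · subst h2; exact hdead
    · rw [Function.update_of_ne (by omega)] at h1; exact h.price_dead e' he' h1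
  · intro e' he'
    have := h.status_le e' he'
    simp only [Function.update_apply]
    split_ifs <;> omega

/-- The sum of the prices and of the number of bidders that have given up. -/
def potential (E : ℕ) (price status : ℕ → ℕ) : ℕ :=
  ∑ f ∈ Finset.range E, price f + ((Finset.range E).filter fun e => status (e + 1) = 2).card

theorem potential_le (h : IsAuction E r price owner status) :
    potential E price status ≤ E * (E + 2) + E := by
  refine Nat.add_le_add ?_ ?_
  · simpa using Finset.sum_le_card_nsmul (Finset.range E) price (E + 2) fun f hf =>
      h.price_le f (Finset.mem_range.1 hf)
  · simpa using Finset.card_filter_le (Finset.range E) _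

/-- One price rises, and no bidder that has given up is revived: the displaced bidder was an owner.
-/
theorem potential_lt_bid (h : IsAuction E r price owner status) {e f : ℕ}
    (hst : status (e + 1) = 0) (hf : f < E) :
    potential E price status < potential E (Function.update price f (price f + 1))
      (Function.update (Function.update status (owner f) 0) (e + 1) 1) := by
  refine Nat.add_lt_add_of_lt_of_le (Finset.sum_lt_sum (fun f' _ => ?_)
    ⟨f, Finset.mem_range.2 hf, by simp⟩) (Finset.card_le_card fun e' he' => ?_)
  · by_cases h1 : f' = f
    · subst h1; simp
    · simp [h1]
  · simp only [Finset.mem_filter] at he' ⊢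
    refine ⟨he'.1, ?_⟩
    have h1 : e' + 1 ≠ e + 1 := fun h1 => by rw [h1, hst] at he'; omega
    have h2 : e' + 1 ≠ owner f := fun h2 => by
      have := h.status_owner f hf (by omega)
      rw [← h2, he'.2] at this
      omega
    rw [Function.update_of_ne h1, Function.update_of_ne h2, he'.2]

theorem potential_lt_giveUp {e : ℕ} (he : e < E) (hst : status (e + 1) = 0) :
    potential E price status < potential E price (Function.update status (e + 1) 2) := by
  refine Nat.add_lt_add_left (Finset.card_lt_card ⟨fun e' he' => ?_, fun hsub => ?_⟩) _
  · simp only [Finset.mem_filter] at he' ⊢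
    have h1 : e' + 1 ≠ e + 1 := fun h1 => by rw [h1, hst] at he'; omega
    rw [Function.update_of_ne h1]
    exact he'
  · have : e ∈ (Finset.range E).filter fun e => status (e + 1) = 2 :=
      hsub (by simp [he])
    simp [hst] at this

/-- Among the `E + 1` numbers `1, …, E + 1`, some number is not a price. -/
theorem exists_gap (E : ℕ) (price : ℕ → ℕ) : ∃ g, 1 ≤ g ∧ g < E + 2 ∧ ∀ f < E, price f ≠ g := by
  by_contra! hall
  have h1 : Finset.Icc 1 (E + 1) ⊆ (Finset.range E).image price := by
    intro g hg
    rw [Finset.mem_Icc] at hg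
    obtain ⟨f, hf, hfg⟩ := hall g hg.1 (by omega)
    exact Finset.mem_image.2 ⟨f, Finset.mem_range.2 hf, hfg⟩
  have h2 := (Finset.card_le_card h1).trans Finset.card_image_le
  simp at h2

open Classical in
/-- When no bidder is waiting, each gap between prices yields a maximum independent set. -/
theorem card_add_card_le (h : IsAuction E r price owner status)
    (hdone : ∀ e < E, status (e + 1) ≠ 0) {g : ℕ} (hg1 : 1 ≤ g) (hg2 : g < E + 2)
    (hgap : ∀ f < E, price f ≠ g) {A B : Finset ℕ} (hA : A ⊆ Finset.range E)
    (hB : B ⊆ Finset.range E) (hAB : ∀ e ∈ A, ∀ f ∈ B, ¬ r e f) :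
    A.card + B.card ≤
      ((Finset.range E).filter fun e => ∀ f < E, r e f → g < price f).card +
        ((Finset.range E).filter fun f => price f < g).card := by
  set X := (Finset.range E).filter fun e => ∀ f < E, r e f → g < price f
  set L := (Finset.range E).filter fun f => price f < g
  set O := (Finset.range E).filter fun f => owner f ≠ 0
  have hO : O.card ≤ E := by simpa using Finset.card_filter_le (Finset.range E) _
  -- Ownership follows edges, so owners of objects in `B` lie outside `A`, and distinct objects have
  -- distinct owners.
  have h1 : (B ∩ O).card ≤ E - A.card := by
    have : (Finset.range E \ A).card = E - A.card := by
      rw [Finset.card_sdiff_of_subset hA, Finset.card_range]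
    rw [← this]
    refine Finset.card_le_card_of_injOn (fun f => owner f - 1) ?_ ?_
    · intro f hf
      simp only [Finset.coe_inter, Set.mem_inter_iff, Finset.mem_coe, O, Finset.mem_filter,
        Finset.mem_range] at hf
      have := h.owner_le f hf.2.1
      simp only [Finset.coe_sdiff, Set.mem_sdiff, Finset.mem_coe, Finset.mem_range]
      refine ⟨by omega, fun hfA => hAB _ hfA f hf.1 (h.rel_owner f hf.2.1 _ (by omega))⟩
    · intro f hf f' hf' hff'
      simp only [Finset.coe_inter, Set.mem_inter_iff, Finset.mem_coe, O, Finset.mem_filter,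
        Finset.mem_range] at hf hf'
      simp only at hff'
      exact h.owner_inj f hf.2.1 f' hf'.2.1 (by omega) hf.2.2
  have h2 : (B \ O).card ≤ E - O.card := by
    have : (Finset.range E \ O).card = E - O.card := by
      rw [Finset.card_sdiff_of_subset (Finset.filter_subset _ _), Finset.card_range]
    rw [← this]
    exact Finset.card_le_card (Finset.sdiff_subset_sdiff hB le_rfl)
  -- A bidder outside `X` has a neighbour priced at most `g`, hence below `g` by the gap. Such a
  -- bidder has not given up, so it owns an object; slack prices that object at most `g`, and again
  -- the gap makes it less than `g`.
  have h3 : E - X.card ≤ (L ∩ O).card := by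
    have : (Finset.range E \ X).card = E - X.card := by
      rw [Finset.card_sdiff_of_subset (Finset.filter_subset _ _), Finset.card_range]
    rw [← this]
    refine (Finset.card_le_card (t := (L ∩ O).image fun f => owner f - 1) ?_).trans
      Finset.card_image_le
    intro e he
    simp only [X, Finset.mem_sdiff, Finset.mem_filter, Finset.mem_range, not_and, not_forall,
      not_lt] at he
    obtain ⟨heE, he⟩ := he
    obtain ⟨f, hf, hr, hfg⟩ := he heE
    have hst : status (e + 1) = 1 := by
      have h4 := hdone e heE
      have h5 := h.status_le e heE
      have h6 : status (e + 1) ≠ 2 := fun h6 => by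
        have := h.price_dead e heE h6 f hf hr
        omega
      omega
    obtain ⟨f', hf', hown⟩ := h.exists_owner e heE hst
    have h7 := h.slack f' hf' e hown f hf hr
    have h8 := hgap f hf
    have h9 := hgap f' hf'
    refine Finset.mem_image.2 ⟨f', ?_, by omega⟩
    simp only [Finset.mem_inter, L, O, Finset.mem_filter, Finset.mem_range]
    exact ⟨⟨hf', by omega⟩, hf', by omega⟩
  -- Free objects have price `0 < g`. Summing up, every independent set has size at most `2E - #O`,
  -- and the pair `X`, `L` attains it.
  have h4 : E - O.card ≤ (L \ O).card := by
    have : (Finset.range E \ O).card = E - O.card := by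
      rw [Finset.card_sdiff_of_subset (Finset.filter_subset _ _), Finset.card_range]
    rw [← this]
    refine Finset.card_le_card fun f hf => ?_
    simp only [O, L, Finset.mem_sdiff, Finset.mem_filter, Finset.mem_range, not_and,
      not_not] at hf ⊢
    refine ⟨⟨hf.1, ?_⟩, hf.2⟩
    rw [h.price_free f hf.1 (hf.2 hf.1)]
    omega
  have hAc : A.card ≤ E := by simpa using Finset.card_le_card hA
  have hXc : X.card ≤ E := by simpa using Finset.card_filter_le (Finset.range E) _
  have h5 := Finset.card_inter_add_card_sdiff B O
  have h6 := Finset.card_inter_add_card_sdiff L O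
  omega

end IsAuction

-- Bidders and objects are indices rather than events, so counts over indices must be matched with
-- counts along the list.
open Classical in
theorem List.card_filter_getElem {α : Type*} (P : α → Prop) [DecidablePred P] (l : List α) :
    ((Finset.range l.length).filter fun i => ∃ h : i < l.length, P l[i]).card =
      l.countP fun a => P a := by
  induction l using List.reverseRecOn with
  | nil => simp
  | append_singleton l a ih =>
    have h1 : ((Finset.range l.length).filter fun i => ∃ h : i < (l ++ [a]).length, P (l ++ [a])[i]) =
        (Finset.range l.length).filter fun i => ∃ h : i < l.length, P l[i] := by
      refine Finset.filter_congr fun i hi => ?_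
      rw [Finset.mem_range] at hi
      have hi' : i < (l ++ [a]).length := by simp; omega
      rw [exists_prop_of_true hi', exists_prop_of_true hi, List.getElem_append_left hi]
    have h2 : Finset.range (l ++ [a]).length = insert l.length (Finset.range l.length) := by
      rw [List.length_append, List.length_singleton, Finset.range_add_one]
    rw [h2, Finset.filter_insert, h1, List.countP_append, ← ih, List.countP_singleton]
    by_cases hP : P a
    · rw [if_pos ⟨by simp, by simpa using hP⟩, Finset.card_insert_of_notMem (by simp)]
      simp [hP]
    · rw [if_neg (by rintro ⟨_, h⟩; exact hP (by simpa using h))]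
      simp [hP]

/-! ### The conflict graph of lower and upper bounds -/

namespace SiblingInstance

variable {X : SiblingInstance}

/-- No stable matching lies above the lower bound of event `e` and below the upper bound of event
`f` of the list. -/
def Conflict (l : List X.Event) (e f : ℕ) : Prop :=
  ∃ (he : e < l.length) (hf : f < l.length), ∀ p, X.inst.IsStablePos p → l[e].floor ≤ p →
    l[f].worsePos < p l[f].worse

open Classical in
theorem countP_together_add_length {l : List X.Event} (hl : ∀ e ∈ l, e.Feasible)
    {q : Fin X.n → ℕ} (hq : X.inst.IsStablePos q) :
    l.countP (fun e => e.Together q) + l.length =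
      l.countP (fun e => e.floor ≤ q) + l.countP fun e => q e.worse ≤ e.worsePos := by
  induction l with
  | nil => simp
  | cons e l ih =>
    have h1 := ih fun e he => hl e (List.mem_cons_of_mem _ he)
    have h2 := (hl e List.mem_cons_self).together_add_one hq
    simp only [List.countP_cons, List.length_cons, decide_eq_true_eq]
    omega

open Classical in
/-- The stable matchings given by an auction without waiting bidders are optimal. -/
theorem countP_together_le {l : List X.Event} (hl : ∀ e ∈ l, e.Feasible)
    {price owner status : ℕ → ℕ} (h : IsAuction l.length (Conflict l) price owner status)
    (hdone : ∀ e < l.length, status (e + 1) ≠ 0) {g : ℕ} (hg1 : 1 ≤ g) (hg2 : g < l.length + 2)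
    (hgap : ∀ f < l.length, price f ≠ g) {q q' : Fin X.n → ℕ} (hq : X.inst.IsStablePos q)
    (hq' : X.inst.IsStablePos q')
    (h1 : ∀ e (he : e < l.length), (∀ f < l.length, Conflict l e f → g < price f) →
      l[e].floor ≤ q)
    (h2 : ∀ f (hf : f < l.length), price f < g → q l[f].worse ≤ l[f].worsePos) :
    l.countP (fun e => e.Together q') ≤ l.countP fun e => e.Together q := by
  have e1 := countP_together_add_length hl hq
  have e2 := countP_together_add_length hl hq'
  rw [← List.card_filter_getElem (fun e : X.Event => e.floor ≤ q),
    ← List.card_filter_getElem (fun e : X.Event => q e.worse ≤ e.worsePos)] at e1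
  rw [← List.card_filter_getElem (fun e : X.Event => e.floor ≤ q'),
    ← List.card_filter_getElem (fun e : X.Event => q' e.worse ≤ e.worsePos)] at e2
  -- The lower and upper bounds satisfied by any stable `q'` form an independent set, as `q'` itself
  -- refutes every conflict between them.
  have key := h.card_add_card_le hdone hg1 hg2 hgap
    (Finset.filter_subset (fun i => ∃ h : i < l.length, l[i].floor ≤ q') _)
    (Finset.filter_subset (fun i => ∃ h : i < l.length, q' l[i].worse ≤ l[i].worsePos) _) (by
      intro e he f hf
      simp only [Finset.mem_filter] at he hf
      rintro ⟨he', hf', hc⟩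
      obtain ⟨_, _, he⟩ := he
      obtain ⟨_, _, hf⟩ := hf
      exact absurd (hc q' hq' he) hf.not_gt)
  have k1 : ((Finset.range l.length).filter fun e =>
      ∀ f < l.length, Conflict l e f → g < price f).card ≤
      ((Finset.range l.length).filter fun i => ∃ h : i < l.length, l[i].floor ≤ q).card := by
    refine Finset.card_le_card fun e he => ?_
    simp only [Finset.mem_filter, Finset.mem_range] at he ⊢
    exact ⟨he.1, he.1, h1 e he.1 he.2⟩
  have k2 : ((Finset.range l.length).filter fun f => price f < g).card ≤
      ((Finset.range l.length).filter fun i =>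
        ∃ h : i < l.length, q l[i].worse ≤ l[i].worsePos).card := by
    refine Finset.card_le_card fun e he => ?_
    simp only [Finset.mem_filter, Finset.mem_range] at he ⊢
    exact ⟨he.1, he.1, h2 e he.1 he.2⟩
  omega

end SiblingInstance

/-! ### The entries of the encoding of an instance -/

theorem List.getD_flatten {w : ℕ} (L : List (List ℕ)) (hL : ∀ l ∈ L, l.length = w) (a i : ℕ)
    (ha : a < L.length) (hi : i < w) : L.flatten.getD (a * w + i) 0 = L[a].getD i 0 := by
  induction L generalizing a with
  | nil => simp at ha
  | cons l L ih =>
    have hl : l.length = w := hL l List.mem_cons_self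
    rw [List.flatten_cons]
    cases a with
    | zero => rw [Nat.zero_mul, Nat.zero_add, List.getD_append _ _ _ _ (by omega)]; rfl
    | succ a =>
      rw [List.getD_append_right _ _ _ _ (by rw [hl, Nat.succ_mul]; omega),
        show (a + 1) * w + i - l.length = a * w + i by rw [hl, Nat.succ_mul]; omega,
        ih (fun l hl => hL l (List.mem_cons_of_mem _ hl)) a (by simpa using ha)]
      rfl

theorem List.getD_append_add (l l' : List ℕ) (k i : ℕ) (h : l.length = k) :
    (l ++ l').getD (k + i) 0 = l'.getD i 0 := by
  rw [List.getD_append_right _ _ _ _ (by omega)]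
  congr 1
  omega

theorem List.getD_ofFn {n : ℕ} (f : Fin n → ℕ) (i : Fin n) : (List.ofFn f).getD i 0 = f i := by
  rw [List.getD_eq_getElem _ _ (by simp)]
  simp

namespace SiblingInstance

theorem code_injective {k : ℕ} : Function.Injective (code (k := k)) := by
  rintro (_ | i) (_ | j) h
  · rfl
  · simp [code] at h
  · simp [code] at h
  · simp only [code, Nat.add_right_cancel_iff] at h
    rw [Fin.ext h]

theorem code_lt {k : ℕ} (x : Option (Fin k)) : code x < k + 1 := by
  cases x with
  | none => simp [code]
  | some i => simp [code]

variable (X : SiblingInstance)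

theorem encode_quota (b : Fin X.m) : X.encode.getD (3 + b) 0 = X.inst.quota b := by
  rw [encode, List.append_assoc, List.append_assoc, List.append_assoc,
    List.getD_append_add _ _ 3 _ (by simp), List.getD_append _ _ _ _ (by simp), List.getD_ofFn]

theorem encode_studentPref (a : Fin X.n) (i : Fin (X.m + 1)) :
    X.encode.getD (3 + X.m + a * (X.m + 1) + i) 0 = code (X.inst.studentPref a i) := by
  have hlt : a * (X.m + 1) + (i : ℕ) < X.n * (X.m + 1) := by
    have := Nat.mul_le_mul_right (X.m + 1) (Nat.succ_le_of_lt a.isLt)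
    rw [Nat.succ_mul] at this
    omega
  rw [encode, List.append_assoc, List.append_assoc, Nat.add_assoc,
    List.getD_append_add _ _ (3 + X.m) _ (by simp; omega), List.getD_append _ _ _ _ (by
      simpa [List.length_flatten, List.map_ofFn, Function.comp_def] using hlt),
    List.getD_flatten (w := X.m + 1) _ (by simp [List.mem_ofFn]) _ _ (by simp) i.isLt,
    List.getElem_ofFn, List.getD_ofFn]

theorem encode_schoolPref (b : Fin X.m) (i : Fin (X.n + 1)) :
    X.encode.getD (3 + X.m + X.n * (X.m + 1) + b * (X.n + 1) + i) 0 =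
      code (X.inst.schoolPref b i) := by
  have hlt : b * (X.n + 1) + (i : ℕ) < X.m * (X.n + 1) := by
    have := Nat.mul_le_mul_right (X.n + 1) (Nat.succ_le_of_lt b.isLt)
    rw [Nat.succ_mul] at this
    omega
  rw [encode, List.append_assoc, Nat.add_assoc,
    List.getD_append_add _ _ (3 + X.m + X.n * (X.m + 1)) _ (by
      simp [List.length_flatten, List.map_ofFn, Function.comp_def]; omega),
    List.getD_append _ _ _ _ (by
      simpa [List.length_flatten, List.map_ofFn, Function.comp_def] using hlt),
    List.getD_flatten (w := X.n + 1) _ (by simp [List.mem_ofFn]) _ _ (by simp) i.isLt,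
    List.getElem_ofFn, List.getD_ofFn]

theorem encode_siblings (k : ℕ) (hk : k < X.siblings.length) (j : ℕ) (hj : j < 2) :
    X.encode.getD (3 + X.m + X.n * (X.m + 1) + X.m * (X.n + 1) + (k * 2 + j)) 0 =
      [code (some X.siblings[k].1), code (some X.siblings[k].2)].getD j 0 := by
  rw [encode, List.getD_append_add _ _ (3 + X.m + X.n * (X.m + 1) + X.m * (X.n + 1)) _ (by
      simp [List.length_flatten, List.map_ofFn, Function.comp_def]; omega),
    List.getD_flatten (w := 2) _ (by simp; rintro _ _ _ _ rfl; rfl) _ _ (by simpa using hk) hj, List.getElem_map]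

end SiblingInstance

/-! ### Structured programs whose loops are all bounded by variables -/

namespace RAM

theorem State.setVar_var (s : State) (x v y : ℕ) :
    (s.setVar x v).var y = if y = x then v else s.var y := by
  simp [State.setVar, Function.update_apply]

theorem State.setVar_arr (s : State) (x v : ℕ) : (s.setVar x v).arr = s.arr := rfl

theorem State.setArr_var (s : State) (k i v : ℕ) : (s.setArr k i v).var = s.var := rfl

theorem State.setArr_arr (s : State) (k i v k' : ℕ) :
    (s.setArr k i v).arr k' = if k' = k then Function.update (s.arr k) i v else s.arr k' := by
  by_cases h : k' = k
  · subst h; simp [State.setArr]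
  · simp [State.setArr, h]

namespace Expr

/-- `e₁ < e₂`, as a truth value. -/
def lt (e₁ e₂ : Expr) : Expr := sub e₂ e₁

/-- `e₁ ≤ e₂`, as a truth value. -/
def le (e₁ e₂ : Expr) : Expr := sub (add e₂ (const 1)) e₁

/-- Negation of a truth value. -/
def not (e : Expr) : Expr := sub (const 1) e

/-- Disjunction of truth values. -/
def or (e₁ e₂ : Expr) : Expr := add e₁ e₂

/-- Conjunction of truth values. -/
def and (e₁ e₂ : Expr) : Expr := not (or (not e₁) (not e₂))

/-- The maximum of two values. -/
def max (e₁ e₂ : Expr) : Expr := add e₁ (sub e₂ e₁)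

/-- `e` has a nonzero value. -/
def Holds (e : Expr) (s : State) : Prop := e.eval s ≠ 0

instance (e : Expr) (s : State) : Decidable (e.Holds s) :=
  inferInstanceAs (Decidable (e.eval s ≠ 0))

variable {s : State} {e₁ e₂ : Expr}

theorem holds_lt : (lt e₁ e₂).Holds s ↔ e₁.eval s < e₂.eval s := by
  simp only [Holds, lt, eval]; omega

theorem holds_le : (le e₁ e₂).Holds s ↔ e₁.eval s ≤ e₂.eval s := by
  simp [Holds, le, eval]; omega

theorem holds_not : (not e₁).Holds s ↔ ¬ e₁.Holds s := by
  simp [Holds, not, eval]; omega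

theorem holds_or : (or e₁ e₂).Holds s ↔ e₁.Holds s ∨ e₂.Holds s := by
  simp [Holds, or, eval]; omega

theorem holds_and : (and e₁ e₂).Holds s ↔ e₁.Holds s ∧ e₂.Holds s := by
  simp [and, holds_not, holds_or]

theorem eval_max : (max e₁ e₂).eval s = Max.max (e₁.eval s) (e₂.eval s) := by
  simp [max, eval]; omega

end Expr

/-- Programs in which every loop runs a counter variable from `0` up to the value of another
variable. -/
inductive Cmd where
  | skip
  | assign (x : ℕ) (e : Expr)
  | write (k : ℕ) (i e : Expr)
  | seq (c₁ c₂ : Cmd)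
  | ite (e : Expr) (c₁ c₂ : Cmd)
  | upTo (x b : ℕ) (c : Cmd)

namespace Cmd

/-- The underlying program of the random access machine. -/
def toProg : Cmd → Prog
  | skip => .skip
  | assign x e => .assign x e
  | write k i e => .write k i e
  | seq c₁ c₂ => .seq c₁.toProg c₂.toProg
  | ite e c₁ c₂ => .ite e c₁.toProg c₂.toProg
  | .upTo x b c => .seq (.assign x (.const 0)) (.loop (.sub (.var b) (.var x))
      (.seq c.toProg (.assign x (.add (.var x) (.const 1)))))

/-- The final memory. -/
def run : Cmd → State → State
  | skip, s => s
  | assign x e, s => s.setVar x (e.eval s)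
  | write k i e, s => s.setArr k (i.eval s) (e.eval s)
  | seq c₁ c₂, s => c₂.run (c₁.run s)
  | ite e c₁ c₂, s => if e.Holds s then c₁.run s else c₂.run s
  | .upTo x b c, s => (fun s => (c.run s).setVar x ((c.run s).var x + 1))^[s.var b] (s.setVar x 0)

theorem run_seq (c₁ c₂ : Cmd) (s : State) : (seq c₁ c₂).run s = c₂.run (c₁.run s) := rfl

theorem run_assign (x : ℕ) (e : Expr) (s : State) : (assign x e).run s = s.setVar x (e.eval s) :=
  rfl

theorem run_write (k : ℕ) (i e : Expr) (s : State) :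
    (write k i e).run s = s.setArr k (i.eval s) (e.eval s) := rfl

theorem run_ite_of {e : Expr} {s : State} (h : e.Holds s) (c₁ c₂ : Cmd) :
    (ite e c₁ c₂).run s = c₁.run s := by rw [run, if_pos h]

theorem run_ite_of_not {e : Expr} {s : State} (h : ¬ e.Holds s) (c₁ c₂ : Cmd) :
    (ite e c₁ c₂).run s = c₂.run s := by rw [run, if_neg h]

/-- The variables to which a program assigns values. -/
def vars : Cmd → List ℕ
  | skip => []
  | assign x _ => [x]
  | write _ _ _ => []
  | seq c₁ c₂ => c₁.vars ++ c₂.vars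
  | ite _ c₁ c₂ => c₁.vars ++ c₂.vars
  | .upTo x _ c => x :: c.vars

/-- The arrays to which a program writes. -/
def arrs : Cmd → List ℕ
  | skip => []
  | assign _ _ => []
  | write k _ _ => [k]
  | seq c₁ c₂ => c₁.arrs ++ c₂.arrs
  | ite _ c₁ c₂ => c₁.arrs ++ c₂.arrs
  | .upTo _ _ c => c.arrs

/-- The variables that bound the loops of a program. -/
def bounds : Cmd → List ℕ
  | skip => []
  | assign _ _ => []
  | write _ _ _ => []
  | seq c₁ c₂ => c₁.bounds ++ c₂.bounds
  | ite _ c₁ c₂ => c₁.bounds ++ c₂.bounds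
  | .upTo _ b c => b :: c.bounds

/-- No body of a loop assigns a value to the counter of the loop. -/
def Proper : Cmd → Bool
  | skip => true
  | assign _ _ => true
  | write _ _ _ => true
  | seq c₁ c₂ => c₁.Proper && c₂.Proper
  | ite _ c₁ c₂ => c₁.Proper && c₂.Proper
  | .upTo x _ c => !c.vars.contains x && c.Proper

open Polynomial in
/-- A bound for the running time in terms of a bound for the numbers of iterations of all loops. -/
noncomputable def time : Cmd → Polynomial ℕ
  | skip => 1
  | assign _ e => C (e.cost + 1)
  | write _ i e => C (i.cost + e.cost + 1)
  | seq c₁ c₂ => c₁.time + c₂.time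
  | ite e c₁ c₂ => C (e.cost + 1) + c₁.time + c₂.time
  | .upTo _ _ c => X * (c.time + 8) + 6

/-- Frame rule for variables; for a concrete program the hypothesis is decidable, so preservation
facts reduce to `decide`. -/
theorem run_var {c : Cmd} {y : ℕ} (h : y ∉ c.vars) (s : State) : (c.run s).var y = s.var y := by
  induction c generalizing s with
  | skip => rfl
  | assign x e =>
    have : y ≠ x := by simpa [vars] using h
    simp [run, State.setVar_var, this]
  | write k i e => rfl
  | seq c₁ c₂ ih₁ ih₂ =>
    simp only [vars, List.mem_append, not_or] at h
    rw [run, ih₂ h.2, ih₁ h.1]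
  | ite e c₁ c₂ ih₁ ih₂ =>
    simp only [vars, List.mem_append, not_or] at h
    rw [run]
    split_ifs
    · exact ih₁ h.1 s
    · exact ih₂ h.2 s
  | upTo x b c ih =>
    simp only [vars, List.mem_cons, not_or] at h
    have : ∀ k (s : State), ((fun s => (c.run s).setVar x ((c.run s).var x + 1))^[k] s).var y =
        s.var y := by
      intro k
      induction k with
      | zero => intro s; rfl
      | succ k ihk =>
        intro s
        rw [Function.iterate_succ_apply, ihk, State.setVar_var, if_neg h.1, ih h.2]
    rw [run, this, State.setVar_var, if_neg h.1]

theorem run_arr {c : Cmd} {k : ℕ} (h : k ∉ c.arrs) (s : State) : (c.run s).arr k = s.arr k := by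
  induction c generalizing s with
  | skip => rfl
  | assign x e => rfl
  | write k' i e =>
    have : k ≠ k' := by simpa [arrs] using h
    rw [run, State.setArr_arr, if_neg this]
  | seq c₁ c₂ ih₁ ih₂ =>
    simp only [arrs, List.mem_append, not_or] at h
    rw [run, ih₂ h.2, ih₁ h.1]
  | ite e c₁ c₂ ih₁ ih₂ =>
    simp only [arrs, List.mem_append, not_or] at h
    rw [run]
    split_ifs
    · exact ih₁ h.1 s
    · exact ih₂ h.2 s
  | upTo x b c ih =>
    simp only [arrs] at h
    have : ∀ j (s : State), ((fun s => (c.run s).setVar x ((c.run s).var x + 1))^[j] s).arr k =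
        s.arr k := by
      intro j
      induction j with
      | zero => intro s; rfl
      | succ j ihj =>
        intro s
        rw [Function.iterate_succ_apply, ihj, State.setVar_arr, ih h]
    rw [run, this, State.setVar_arr]

/-- Induction over the iterations of a loop. -/
theorem run_upTo {x b : ℕ} {c : Cmd} (s : State) (I : ℕ → State → Prop) (hx : x ∉ c.vars)
    (h0 : I 0 (s.setVar x 0))
    (hstep : ∀ i s', i < s.var b → s'.var x = i → (∀ y, y ∉ x :: c.vars → s'.var y = s.var y) →
      (∀ k, k ∉ c.arrs → s'.arr k = s.arr k) → I i s' → I (i + 1) ((c.run s').setVar x (i + 1))) :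
    I (s.var b) ((Cmd.upTo x b c).run s) := by
  have key : ∀ i, i ≤ s.var b →
      let s' := (fun s => (c.run s).setVar x ((c.run s).var x + 1))^[i] (s.setVar x 0)
      I i s' ∧ s'.var x = i ∧ (∀ y, y ∉ x :: c.vars → s'.var y = s.var y) ∧
        (∀ k, k ∉ c.arrs → s'.arr k = s.arr k) := by
    intro i
    induction i with
    | zero =>
      intro _
      refine ⟨h0, by simp [State.setVar_var], fun y hy => ?_, fun k _ => rfl⟩
      simp only [List.mem_cons, not_or] at hy
      simp [State.setVar_var, hy.1]
    | succ i ih =>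
      intro hi
      obtain ⟨h1, h2, h3, h4⟩ := ih (by omega)
      simp only [Function.iterate_succ_apply']
      set s' := (fun s => (c.run s).setVar x ((c.run s).var x + 1))^[i] (s.setVar x 0)
      rw [run_var hx, h2]
      refine ⟨hstep i s' (by omega) h2 h3 h4 h1, by simp [State.setVar_var], fun y hy => ?_,
        fun k hk => ?_⟩
      · have hy' := hy
        simp only [List.mem_cons, not_or] at hy
        rw [State.setVar_var, if_neg hy.1, run_var hy.2, h3 y hy']
      · rw [State.setVar_arr, run_arr hk, h4 k hk]
  exact (key _ le_rfl).1

/-- No bounding variable is modified anywhere in the program, so each loop makes at most `N`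
iterations regardless of nesting, and the polynomials compose by structural induction. -/
theorem exists_exec (c : Cmd) (hc : c.Proper) (N : ℕ) (s : State)
    (hs : ∀ b ∈ c.bounds, s.var b ≤ N ∧ b ∉ c.vars) :
    ∃ t, t ≤ c.time.eval N ∧ Exec c.toProg s (c.run s) t := by
  induction c generalizing s with
  | skip => exact ⟨1, by simp [time], .skip s⟩
  | assign x e => exact ⟨_, by simp [time], .assign s x e⟩
  | write k i e => exact ⟨_, by simp [time], .write s k i e⟩
  | seq c₁ c₂ ih₁ ih₂ =>
    simp only [Proper, Bool.and_eq_true] at hc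
    simp only [bounds, vars, List.mem_append, not_or] at hs
    obtain ⟨t₁, ht₁, h₁⟩ := ih₁ hc.1 s fun b hb => ⟨(hs b (.inl hb)).1, (hs b (.inl hb)).2.1⟩
    obtain ⟨t₂, ht₂, h₂⟩ := ih₂ hc.2 (c₁.run s) fun b hb => by
      rw [run_var (hs b (.inr hb)).2.1]
      exact ⟨(hs b (.inr hb)).1, (hs b (.inr hb)).2.2⟩
    exact ⟨t₁ + t₂, by simp only [time, Polynomial.eval_add]; omega, .seq h₁ h₂⟩
  | ite e c₁ c₂ ih₁ ih₂ =>
    simp only [Proper, Bool.and_eq_true] at hc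
    simp only [bounds, vars, List.mem_append, not_or] at hs
    by_cases he : e.Holds s
    · obtain ⟨t₁, ht₁, h₁⟩ := ih₁ hc.1 s fun b hb => ⟨(hs b (.inl hb)).1, (hs b (.inl hb)).2.1⟩
      refine ⟨e.cost + 1 + t₁, ?_, ?_⟩
      · simp only [time, Polynomial.eval_add, Polynomial.eval_C]; omega
      · rw [run, if_pos he]; exact .ite_true he h₁
    · obtain ⟨t₁, ht₁, h₁⟩ := ih₂ hc.2 s fun b hb => ⟨(hs b (.inr hb)).1, (hs b (.inr hb)).2.2⟩
      refine ⟨e.cost + 1 + t₁, ?_, ?_⟩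
      · simp only [time, Polynomial.eval_add, Polynomial.eval_C]; omega
      · rw [run, if_neg he]; exact .ite_false (not_not.1 he) h₁
  | upTo x b c ih =>
    simp only [Proper, Bool.and_eq_true, Bool.not_eq_true', List.contains_eq_mem,
      decide_eq_false_iff_not] at hc
    simp only [bounds, vars, List.mem_cons, forall_eq_or_imp, not_or] at hs
    obtain ⟨⟨hbN, hbx, hbc⟩, hs⟩ := hs
    -- Here `k` is the number of iterations left. Each costs `4` for the test and `4` for the
    -- increment besides the body; the final failing test costs `4`, and setting the counter to zero
    -- costs `2`.
    have key : ∀ k (s : State), k + s.var x = s.var b → (∀ b ∈ c.bounds, s.var b ≤ N) →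
        ∃ t, t ≤ k * (c.time.eval N + 8) + 4 ∧
          Exec (.loop (.sub (.var b) (.var x))
            (.seq c.toProg (.assign x (.add (.var x) (.const 1))))) s
            ((fun s => (c.run s).setVar x ((c.run s).var x + 1))^[k] s) t := by
      intro k
      induction k with
      | zero =>
        intro s hk _
        exact ⟨4, by omega, .loop_false (by simp [Expr.eval]; omega)⟩
      | succ k ihk =>
        intro s hk hN
        obtain ⟨t₁, ht₁, h₁⟩ := ih hc.2 s fun b' hb' => ⟨hN b' hb', (hs b' hb').2.2⟩
        have h₂ : Exec (.assign x (.add (.var x) (.const 1))) (c.run s)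
          ((c.run s).setVar x ((c.run s).var x + 1)) 4 := .assign _ _ _
        obtain ⟨t₃, ht₃, h₃⟩ := ihk ((c.run s).setVar x ((c.run s).var x + 1))
          (by
            rw [State.setVar_var, State.setVar_var, if_pos rfl, if_neg hbx, run_var hc.1,
              run_var hbc]
            omega)
          (fun b' hb' => by
            rw [State.setVar_var, if_neg (hs b' hb').2.1, run_var (hs b' hb').2.2]
            exact hN b' hb')
        refine ⟨_, ?_, .loop_true (by simp [Expr.eval]; omega) (.seq h₁ h₂) h₃⟩
        simp only [Expr.cost]
        rw [add_mul]
        omega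
    obtain ⟨t, ht, h⟩ := key (s.var b) (s.setVar x 0)
      (by rw [State.setVar_var, State.setVar_var, if_pos rfl, if_neg hbx]; omega)
      (fun b' hb' => by rw [State.setVar_var, if_neg (hs b' hb').2.1]; exact (hs b' hb').1)
    refine ⟨2 + t, ?_, .seq (.assign s x (.const 0)) h⟩
    have := Nat.mul_le_mul_right (c.time.eval N + 8) hbN
    simp only [time, Polynomial.eval_add, Polynomial.eval_mul, Polynomial.eval_X,
      Polynomial.eval_ofNat]
    omega

end Cmd

end RAM

/-! ### The program: rejections and least stable position vectors -/

namespace SchoolInstance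

variable {n m : ℕ} (I : SchoolInstance n m)

/-- The alternative at position `r` of student `a` is a school that rejects `a`. -/
def RejectsAt (q : Fin n → ℕ) (a : Fin n) (r : ℕ) : Prop :=
  r < I.pos a none ∧ ∃ b, I.pos a (some b) = r ∧ I.Rejects q b a

variable {I}

theorem exists_pos_eq {a : Fin n} {r : ℕ} (h : r < I.pos a none) :
    ∃ b, I.pos a (some b) = r := by
  have hlt : r < m + 1 := by have := I.pos_le a none; omega
  rcases hx : I.studentPref a ⟨r, hlt⟩ with _ | b
  · exact absurd ((I.studentPref_eq_iff a _ _).1 hx) h.ne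
  · exact ⟨b, ((I.studentPref_eq_iff a _ _).1 hx).symm⟩

theorem isSettled_iff {q : Fin n → ℕ} : I.IsSettled q ↔ ∀ a, ¬ I.RejectsAt q a (q a) := by
  constructor
  · rintro h a ⟨h1, b, h2, h3⟩; exact h a b h2 h1 h3
  · intro h a b h1 h2 h3; exact h a ⟨h2, b, h1, h3⟩

theorem isJustified_iff {q : Fin n → ℕ} :
    I.IsJustified q ↔ ∀ a, ∀ r < q a, I.RejectsAt q a r := by
  constructor
  · intro h a r hr
    have hn := hr.trans_le (h a).1
    obtain ⟨b, hb⟩ := exists_pos_eq hn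
    exact ⟨hn, b, hb, (h a).2 b (hb.trans_lt hr)⟩
  · intro h a
    refine ⟨not_lt.1 fun hlt => lt_irrefl _ (h a _ hlt).1, fun b hb => ?_⟩
    obtain ⟨_, b', h1, h2⟩ := h a _ hb
    exact Option.some_injective _ (I.pos_injective a h1) ▸ h2

/-- The rejection persists in `p`, where a stable vector must have moved on. Hence moving a rejected
student one position down never overshoots a stable vector above. -/
theorem RejectsAt.lt {q p : Fin n → ℕ} {a : Fin n} (h : I.RejectsAt q a (q a))
    (hp : I.IsStablePos p) (hqp : q ≤ p) : q a < p a := by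
  obtain ⟨_, b, h1, h2⟩ := h
  exact h1 ▸ (h2.mono hqp).pos_lt hp (h1.trans_le (hqp a))

end SchoolInstance

/-- The inductive step of a counting loop over `Fin n`. -/
theorem Fin.card_filter_lt_succ {n : ℕ} (P : Fin n → Prop) [DecidablePred P] (i : Fin n) :
    (Finset.univ.filter fun a : Fin n => a.val < i.val + 1 ∧ P a).card =
      (Finset.univ.filter fun a : Fin n => a.val < i.val ∧ P a).card + if P i then 1 else 0 := by
  split_ifs with h
  · rw [← Finset.card_insert_of_notMem (a := i) (by simp)]
    congr 1
    ext a
    simp only [Finset.mem_filter, Finset.mem_univ, true_and, Finset.mem_insert, Fin.ext_iff]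
    constructor
    · rintro ⟨h1, h2⟩
      by_cases h3 : a.val = i.val
      · exact .inl h3
      · exact .inr ⟨by omega, h2⟩
    · rintro (h1 | ⟨h1, h2⟩)
      · obtain rfl := Fin.ext h1
        exact ⟨by omega, h⟩
      · exact ⟨by omega, h2⟩
  · rw [add_zero]
    congr 1
    ext a
    simp only [Finset.mem_filter, Finset.mem_univ, true_and]
    constructor
    · rintro ⟨h1, h2⟩
      refine ⟨?_, h2⟩
      by_contra h3
      obtain rfl : a = i := Fin.ext (by omega)
      exact h h2
    · rintro ⟨h1, h2⟩
      exact ⟨by omega, h2⟩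

namespace RAM

open SiblingInstance Cmd RAM.Expr

/-! Scalar variables and arrays of the program. -/

local notation "vLen" => (0 : ℕ)
local notation "vOut" => (1 : ℕ)
local notation "vStudents" => (2 : ℕ)
local notation "vSchools" => (3 : ℕ)
local notation "vPairs" => (4 : ℕ)
local notation "vSchoolsSucc" => (5 : ℕ)
local notation "vStudentsSucc" => (6 : ℕ)
local notation "vBase" => (7 : ℕ)
local notation "vA" => (10 : ℕ)
local notation "vR" => (11 : ℕ)
local notation "vB" => (12 : ℕ)
local notation "vCount" => (13 : ℕ)
local notation "vRej" => (14 : ℕ)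
local notation "vI" => (15 : ℕ)
local notation "vSweep" => (16 : ℕ)
local notation "vBad" => (17 : ℕ)
local notation "kInput" => (0 : ℕ)
local notation "kOut" => (1 : ℕ)
local notation "kPos" => (2 : ℕ)
local notation "kPosRow" => (3 : ℕ)
local notation "kRank" => (4 : ℕ)
local notation "kRankRow" => (5 : ℕ)
local notation "kVec" => (6 : ℕ)
local notation "vEvents" => (21 : ℕ)
local notation "vThreshold" => (22 : ℕ)
local notation "vRounds" => (23 : ℕ)
local notation "vEvent" => (24 : ℕ)
local notation "vBest" => (25 : ℕ)
local notation "vArg" => (26 : ℕ)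
local notation "vF" => (27 : ℕ)
local notation "vPair" => (28 : ℕ)
local notation "vSchool" => (29 : ℕ)
local notation "vBetter" => (30 : ℕ)
local notation "vWorse" => (31 : ℕ)
local notation "vGap" => (32 : ℕ)
local notation "vLevel" => (33 : ℕ)
local notation "vOk" => (34 : ℕ)
local notation "vCopy" => (35 : ℕ)
local notation "vRound" => (36 : ℕ)
local notation "vPtr" => (8 : ℕ)
local notation "kWorse" => (7 : ℕ)
local notation "kBetter" => (8 : ℕ)
local notation "kWorsePos" => (9 : ℕ)
local notation "kBetterPos" => (10 : ℕ)
local notation "kPrice" => (11 : ℕ)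
local notation "kOwner" => (12 : ℕ)
local notation "kStatus" => (13 : ℕ)
local notation "kMark" => (14 : ℕ)
local notation "kFloor" => (15 : ℕ)

/-- The position of the alternative with code `c` in the list of student `a`. -/
def posE (a c : Expr) : Expr := .read kPos (.add (.read kPosRow a) c)

/-- The position of the alternative with code `c` in the list of school `b`. -/
def rankE (b c : Expr) : Expr := .read kRank (.add (.read kRankRow b) c)

/-- The code of the alternative at position `i` in the list of student `a`. -/
def prefE (a i : Expr) : Expr := .read kInput (.add (.read kPosRow a) i)

/-- The quota of school `b`. -/
def quotaE (b : Expr) : Expr := .read kInput (.add (.const 3) b)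

/-- The code of the agent with index `e`. -/
def codeE (e : Expr) : Expr := .add e (.const 1)

/-! ### The memory invariant for the instance -/

/-- The memory holds the instance and the tables of positions and ranks. -/
structure Loaded (X : SiblingInstance) (s : State) : Prop where
  len : s.var vLen = X.encode.length
  students : s.var vStudents = X.n
  schools : s.var vSchools = X.m
  pairs : s.var vPairs = X.siblings.length
  schoolsSucc : s.var vSchoolsSucc = X.m + 1
  studentsSucc : s.var vStudentsSucc = X.n + 1
  pos : ∀ a x, s.arr kPos (s.arr kPosRow (a : Fin X.n) + code x) = X.inst.pos a x
  rank : ∀ b x, s.arr kRank (s.arr kRankRow (b : Fin X.m) + code x) = X.inst.rank b x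
  quota : ∀ b : Fin X.m, s.arr kInput (3 + b) = X.inst.quota b
  pref : ∀ a (i : Fin (X.m + 1)), s.arr kInput (s.arr kPosRow (a : Fin X.n) + i) =
    code (X.inst.studentPref a i)
  pair : ∀ k (h : k < X.siblings.length),
    s.arr kInput (s.var vBase + (k + k)) = X.siblings[k].1 + 1 ∧
    s.arr kInput (s.var vBase + (k + k) + 1) = X.siblings[k].2 + 1

/-- The lists of variables and of arrays do not contain variables and arrays used by `Loaded`. -/
def isDynamic (V A : List ℕ) : Bool :=
  V.all (fun y => y == 1 || 8 ≤ y) && A.all (fun k => k == 1 || 6 ≤ k)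

variable {X : SiblingInstance} {s : State}

/-- The instance occupies variables below `8` and arrays below `6`, apart from number `1` in both
cases, which is reserved for the output. -/
theorem Loaded.frame (h : Loaded X s) {s' : State} {V A : List ℕ} (hVA : isDynamic V A)
    (hV : ∀ y, y ∉ V → s'.var y = s.var y) (hA : ∀ k, k ∉ A → s'.arr k = s.arr k) :
    Loaded X s' := by
  simp only [isDynamic, Bool.and_eq_true, List.all_eq_true, Bool.or_eq_true, beq_iff_eq,
    decide_eq_true_eq] at hVA
  have hv : ∀ y, y ≠ 1 → y < 8 → s'.var y = s.var y := fun y h1 h2 => hV y fun hy => by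
    have := hVA.1 y hy; omega
  have ha : ∀ k, k ≠ 1 → k < 6 → s'.arr k = s.arr k := fun k h1 h2 => hA k fun hk => by
    have := hVA.2 k hk; omega
  have a0 := ha 0 (by decide) (by decide)
  have a2 := ha 2 (by decide) (by decide)
  have a3 := ha 3 (by decide) (by decide)
  have a4 := ha 4 (by decide) (by decide)
  have a5 := ha 5 (by decide) (by decide)
  have v7 := hv 7 (by decide) (by decide)
  exact ⟨(hv _ (by decide) (by decide)).trans h.len, (hv _ (by decide) (by decide)).trans h.students,
    (hv _ (by decide) (by decide)).trans h.schools, (hv _ (by decide) (by decide)).trans h.pairs,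
    (hv _ (by decide) (by decide)).trans h.schoolsSucc,
    (hv _ (by decide) (by decide)).trans h.studentsSucc,
    by rw [a2, a3]; exact h.pos, by rw [a4, a5]; exact h.rank, by rw [a0]; exact h.quota,
    by rw [a0, a3]; exact h.pref, by rw [a0, v7]; exact h.pair⟩

theorem Loaded.run (h : Loaded X s) (c : Cmd) (hc : isDynamic c.vars c.arrs) :
    Loaded X (c.run s) :=
  h.frame hc (fun _ hy => run_var hy s) fun _ hk => run_arr hk s

theorem Loaded.setVar (h : Loaded X s) (x v : ℕ) (hx : isDynamic [x] []) :
    Loaded X (s.setVar x v) :=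
  h.run (.assign x (.const v)) hx

theorem Loaded.eval_posE (h : Loaded X s) {ea ec : Expr} {a : Fin X.n} (x : Option (Fin X.m))
    (ha : ea.eval s = a) (hc : ec.eval s = code x) :
    (posE ea ec).eval s = X.inst.pos a x := by
  simp only [posE, Expr.eval, ha, hc, h.pos]

theorem Loaded.eval_rankE (h : Loaded X s) {eb ec : Expr} {b : Fin X.m} (x : Option (Fin X.n))
    (hb : eb.eval s = b) (hc : ec.eval s = code x) :
    (rankE eb ec).eval s = X.inst.rank b x := by
  simp only [rankE, Expr.eval, hb, hc, h.rank]

theorem Loaded.eval_quotaE (h : Loaded X s) {eb : Expr} {b : Fin X.m} (hb : eb.eval s = b) :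
    (quotaE eb).eval s = X.inst.quota b := by
  simp only [quotaE, Expr.eval, hb, h.quota]

theorem eval_codeE {k : ℕ} {e : Expr} {i : Fin k} (h : e.eval s = i) :
    (codeE e).eval s = code (some i) := by
  rw [codeE, Expr.eval, h]; rfl

/-- The position vector stored in the memory. -/
def vec (X : SiblingInstance) (s : State) : Fin X.n → ℕ := fun a => s.arr kVec a

theorem vec_congr {s' : State} (h : s'.arr kVec = s.arr kVec) : vec X s' = vec X s :=
  funext fun a => congrFun h a

/-- Counts the rivals of student `vA` at school `vB`. -/
def countRivals : Cmd :=
  .seq (.assign vCount (.const 0))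
    (.upTo vI vStudents (.ite
      (.and (.le (posE (.var vI) (codeE (.var vB))) (.read kVec (.var vI)))
        (.lt (rankE (.var vB) (codeE (.var vI))) (rankE (.var vB) (codeE (.var vA)))))
      (.assign vCount (.add (.var vCount) (.const 1))) .skip))

theorem countRivals_spec (h : Loaded X s) {a : Fin X.n} {b : Fin X.m} (ha : s.var vA = a)
    (hb : s.var vB = b) :
    (countRivals.run s).var vCount = (X.inst.rivals (vec X s) b a).card := by
  rw [countRivals, run]
  set s₀ := (Cmd.assign vCount (.const 0)).run s with hs₀
  have h₀ : Loaded X s₀ := h.run _ (by decide)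
  refine Eq.trans (run_upTo (x := vI) (b := vStudents) s₀ (fun i s' => s'.var vCount =
    (Finset.univ.filter fun a' : Fin X.n => a'.val < i ∧ (X.inst.pos a' (some b) ≤ vec X s a' ∧
      X.inst.rank b (some a') < X.inst.rank b (some a))).card) (by decide) ?_ ?_) ?_
  · simp [hs₀, run, State.setVar_var, Expr.eval]
  · intro i s' hi hI hV hA hc
    have hL : Loaded X s' := h₀.frame (by decide) hV hA
    rw [h₀.students] at hi
    have hva : s'.var vA = a := by rw [hV _ (by decide), hs₀, run_var (by decide), ha]
    have hvb : s'.var vB = b := by rw [hV _ (by decide), hs₀, run_var (by decide), hb]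
    have hvec : s'.arr kVec i = vec X s ⟨i, hi⟩ := by
      rw [hA _ (by decide), hs₀, run_arr (by decide)]; rfl
    have e1 := hL.eval_posE (ea := .var vI) (ec := codeE (.var vB)) (a := ⟨i, hi⟩) (some b) hI
      (eval_codeE hvb)
    have e2 := hL.eval_rankE (eb := .var vB) (ec := codeE (.var vI)) (b := b) (some ⟨i, hi⟩) hvb
      (eval_codeE hI)
    have e3 := hL.eval_rankE (eb := .var vB) (ec := codeE (.var vA)) (b := b) (some a) hvb
      (eval_codeE hva)
    have e4 : (Expr.read kVec (.var vI)).eval s' = vec X s ⟨i, hi⟩ := by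
      simp only [Expr.eval, hI, hvec]
    rw [Fin.card_filter_lt_succ _ ⟨i, hi⟩, ← hc, run]
    simp only [holds_and, holds_le, holds_lt, e1, e2, e3, e4]
    split_ifs <;> simp [run, State.setVar_var, Expr.eval]
  · rw [h₀.students]
    simp [SchoolInstance.rivals]

/-- Tests whether the alternative at position `vR` of student `vA` is a school that rejects `vA`. -/
def testRejected : Cmd :=
  .ite (.lt (.var vR) (posE (.var vA) (.const 0)))
    (.seq (.assign vB (.sub (prefE (.var vA) (.var vR)) (.const 1)))
      (.seq countRivals
        (.assign vRej (.or (.lt (rankE (.var vB) (.const 0)) (rankE (.var vB) (codeE (.var vA))))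
          (.le (quotaE (.var vB)) (.var vCount))))))
    (.assign vRej (.const 0))

theorem testRejected_spec (h : Loaded X s) {a : Fin X.n} (ha : s.var vA = a) :
    (Expr.var vRej).Holds (testRejected.run s) ↔ X.inst.RejectsAt (vec X s) a (s.var vR) := by
  have e0 := h.eval_posE (ea := .var vA) (ec := .const 0) (a := a) none ha rfl
  rw [testRejected, run]
  simp only [holds_lt, e0]
  split_ifs with hlt
  · simp only [Expr.eval] at hlt
    obtain ⟨b, hb⟩ := SchoolInstance.exists_pos_eq hlt
    simp only [run]
    set s₁ := s.setVar vB ((Expr.sub (prefE (.var vA) (.var vR)) (.const 1)).eval s) with hs₁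
    have h₁ : Loaded X s₁ := h.setVar _ _ (by decide)
    have hb₁ : s₁.var vB = b := by
      -- The preference entry at this position is the code of `b`, one more than its index, which
      -- explains the subtraction of `1`.
      have hr : s.var vR < X.m + 1 := hb ▸ Nat.lt_succ_of_le (X.inst.pos_le a _)
      have := h.pref a ⟨s.var vR, hr⟩
      rw [(X.inst.studentPref_eq_iff a ⟨s.var vR, hr⟩ (some b)).2 hb.symm] at this
      simp only at this
      simp [hs₁, State.setVar_var, prefE, Expr.eval, ha, this, code]
    have ha₁ : s₁.var vA = a := by simp [hs₁, State.setVar_var, ha]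
    have hc := countRivals_spec h₁ ha₁ hb₁
    set s₂ := countRivals.run s₁ with hs₂
    have h₂ : Loaded X s₂ := h₁.run _ (by decide)
    have hb₂ : s₂.var vB = b := by rw [hs₂, run_var (by decide), hb₁]
    have ha₂ : s₂.var vA = a := by rw [hs₂, run_var (by decide), ha₁]
    have e1 := h₂.eval_rankE (eb := .var vB) (ec := .const 0) (b := b) none hb₂ rfl
    have e2 := h₂.eval_rankE (eb := .var vB) (ec := codeE (.var vA)) (b := b) (some a) hb₂
      (eval_codeE ha₂)
    have e3 := h₂.eval_quotaE (eb := .var vB) (b := b) hb₂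
    rw [Expr.Holds, Expr.eval, State.setVar_var, if_pos rfl, ← Expr.Holds, holds_or, holds_lt,
      holds_le, e1, e2, e3]
    simp only [Expr.eval, hc]
    rw [show vec X s₁ = vec X s from rfl, ← SchoolInstance.Rejects]
    constructor
    · intro hr; exact ⟨hlt, b, hb, hr⟩
    · rintro ⟨_, b', hb', hr⟩
      obtain rfl := Option.some_injective _ (X.inst.pos_injective a (hb'.trans hb.symm))
      exact hr
  · simp only [Expr.eval] at hlt
    simp only [run, State.setVar_var, Expr.eval, Expr.Holds]
    simp only [if_true, ne_eq, not_true_eq_false, false_iff]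
    exact fun h' => hlt h'.1

/-- Moves every student that is rejected by the current school one position down. -/
def sweep : Cmd :=
  .upTo vA vStudents
    (.seq (.assign vR (.read kVec (.var vA)))
      (.seq testRejected
        (.ite (.var vRej)
          (.write kVec (.var vA) (.add (.read kVec (.var vA)) (.const 1))) .skip)))

/-- The vector is updated in place, so later tests see earlier moves. This is harmless: rejected
students may move at any time without overshooting, and as long as nothing has moved the tests
concern the original vector. -/
theorem sweep_spec (h : Loaded X s) (hm : ∀ a, vec X s a ≤ X.m) :
    vec X s ≤ vec X (sweep.run s) ∧ (∀ a, vec X (sweep.run s) a ≤ X.m) ∧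
      (∀ p, X.inst.IsStablePos p → vec X s ≤ p → vec X (sweep.run s) ≤ p) ∧
      (vec X (sweep.run s) = vec X s ∧ X.inst.IsSettled (vec X s) ∨
        vec X (sweep.run s) ≠ vec X s ∧ ¬ X.inst.IsSettled (vec X s)) := by
  have key := run_upTo (x := vA) (b := vStudents) (c := (.seq (.assign vR (.read kVec (.var vA)))
      (.seq testRejected
        (.ite (.var vRej)
          (.write kVec (.var vA) (.add (.read kVec (.var vA)) (.const 1))) .skip)))) s
    (fun i s' => vec X s ≤ vec X s' ∧ (∀ a, vec X s' a ≤ X.m) ∧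
      (∀ p, X.inst.IsStablePos p → vec X s ≤ p → vec X s' ≤ p) ∧
      (vec X s' = vec X s ∧ (∀ a : Fin X.n, a.val < i → ¬ X.inst.RejectsAt (vec X s) a (vec X s a)) ∨
        vec X s' ≠ vec X s ∧ ¬ X.inst.IsSettled (vec X s))) (by decide) ?_ ?_
  · obtain ⟨h1, h2, h3, h4⟩ := key
    refine ⟨h1, h2, h3, h4.imp (fun h4 => ⟨h4.1, ?_⟩) id⟩
    rw [SchoolInstance.isSettled_iff]
    intro a
    exact h4.2 a (by rw [h.students]; exact a.isLt)
  · exact ⟨le_rfl, hm, fun p _ hp => hp, .inl ⟨rfl, fun a ha => absurd ha (by omega)⟩⟩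
  · rintro i s' hi hI hV hA ⟨h1, h2, h3, h4⟩
    rw [h.students] at hi
    have hL : Loaded X s' := h.frame (by decide) hV hA
    rw [run_seq, run_seq]
    set s₁ := (Cmd.assign vR (.read kVec (.var vA))).run s' with hs₁
    have hL₁ : Loaded X s₁ := hL.run _ (by decide)
    have hv₁ : vec X s₁ = vec X s' := rfl
    have hA₁ : s₁.var vA = (⟨i, hi⟩ : Fin X.n) := by simp [hs₁, run, State.setVar_var, hI]
    have hR₁ : s₁.var vR = vec X s' ⟨i, hi⟩ := by
      simp [hs₁, run, State.setVar_var, Expr.eval, hI, vec]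
    have ht := testRejected_spec hL₁ hA₁
    rw [hv₁, hR₁] at ht
    set s₂ := testRejected.run s₁ with hs₂
    have hv₂ : vec X s₂ = vec X s' := vec_congr (by rw [hs₂, run_arr (by decide)]; rfl)
    have hA₂ : s₂.var vA = i := by rw [hs₂, run_var (by decide)]; exact hA₁
    by_cases hr : X.inst.RejectsAt (vec X s') ⟨i, hi⟩ (vec X s' ⟨i, hi⟩)
    · rw [run_ite_of (ht.2 hr), run_write]
      simp only [Expr.eval, hA₂]
      have hv₃ : vec X ((s₂.setArr kVec i (s₂.arr kVec i + 1)).setVar vA (i + 1)) =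
          Function.update (vec X s') ⟨i, hi⟩ (vec X s' ⟨i, hi⟩ + 1) := by
        funext a
        rw [← hv₂]
        simp only [vec, State.setVar_arr, State.setArr_arr, if_true, Function.update_apply,
          Fin.ext_iff]
      rw [hv₃]
      have hle : vec X s' ≤ Function.update (vec X s') ⟨i, hi⟩ (vec X s' ⟨i, hi⟩ + 1) := by
        intro a
        by_cases ha : a = ⟨i, hi⟩
        · subst ha; simp
        · simp [ha]
      refine ⟨h1.trans hle, fun a => ?_, fun p hp hsp a => ?_, .inr ⟨fun heq => ?_, ?_⟩⟩
      · by_cases ha : a = ⟨i, hi⟩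
        · subst ha
          have := hr.1
          have := X.inst.pos_le ⟨i, hi⟩ none
          simp only [Function.update_self]; omega
        · simpa [ha] using h2 a
      · by_cases ha : a = ⟨i, hi⟩
        · subst ha
          simp only [Function.update_self]
          exact hr.lt hp (h3 p hp hsp)
        · simpa [ha] using h3 p hp hsp a
      · have := h1 ⟨i, hi⟩
        rw [← heq] at this
        simp at this
      · rcases h4 with h4 | h4
        · rw [SchoolInstance.isSettled_iff]
          intro h5
          rw [h4.1] at hr
          exact h5 _ hr
        · exact h4.2
    · rw [run_ite_of_not (fun h' => hr (ht.1 h')), run]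
      have hv₃ : vec X (s₂.setVar vA (i + 1)) = vec X s' := hv₂
      rw [hv₃]
      refine ⟨h1, h2, h3, h4.imp (fun h4 => ⟨h4.1, fun a ha => ?_⟩) id⟩
      rcases (Nat.lt_succ_iff.1 ha).lt_or_eq with h5 | h5
      · exact h4.2 a h5
      · obtain rfl : a = ⟨i, hi⟩ := Fin.ext h5
        rwa [h4.1] at hr

theorem length_encode (X : SiblingInstance) :
    X.encode.length = 3 + X.m + X.n * (X.m + 1) + X.m * (X.n + 1) + 2 * X.siblings.length := by
  simp [encode, List.length_flatten, List.map_ofFn, Function.comp_def, List.map_map]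
  ring

/-- Raises the position vector to the least settled one above it. -/
def raise : Cmd := .upTo vSweep vLen sweep

/-- Every sweep of an unsettled vector increases the sum of positions, which is at most `n * m`. The
input length exceeds `n * m`, so that many sweeps suffice. -/
theorem raise_spec (h : Loaded X s) (hm : ∀ a, vec X s a ≤ X.m) :
    X.inst.IsRaised (vec X s) (vec X (raise.run s)) ∧ ∀ a, vec X (raise.run s) a ≤ X.m := by
  have key := run_upTo (x := vSweep) (b := vLen) (c := sweep) s
    (fun i s' => vec X s ≤ vec X s' ∧ (∀ a, vec X s' a ≤ X.m) ∧
      (∀ p, X.inst.IsStablePos p → vec X s ≤ p → vec X s' ≤ p) ∧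
      (X.inst.IsSettled (vec X s') ∨ i ≤ ∑ a, vec X s' a)) (by decide) ?_ ?_
  · obtain ⟨h1, h2, h3, h4⟩ := key
    refine ⟨⟨h4.resolve_right fun h5 => ?_, h1, h3⟩, h2⟩
    have h6 : ∑ a, vec X (raise.run s) a ≤ ∑ _a : Fin X.n, X.m := Finset.sum_le_sum fun a _ => h2 a
    rw [h.len, length_encode] at h5
    simp only [Finset.sum_const, Finset.card_univ, Fintype.card_fin, smul_eq_mul] at h6
    have := h5.trans h6
    rw [mul_add] at this
    omega
  · exact ⟨le_rfl, hm, fun p _ hp => hp, .inr (Nat.zero_le _)⟩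
  · rintro i s' hi hI hV hA ⟨h1, h2, h3, h4⟩
    have hL : Loaded X s' := h.frame (by decide) hV hA
    obtain ⟨g1, g2, g3, g4⟩ := sweep_spec hL h2
    rw [show vec X ((sweep.run s').setVar vSweep (i + 1)) = vec X (sweep.run s') from rfl]
    refine ⟨h1.trans g1, g2, fun p hp hsp => g3 p hp (h3 p hp hsp), ?_⟩
    rcases g4 with ⟨g4, g5⟩ | ⟨g4, g5⟩
    · rw [g4]; exact .inl g5
    · refine .inr (lt_of_le_of_lt (h4.resolve_left g5) ?_)
      obtain ⟨a, ha⟩ := Function.ne_iff.1 g4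
      exact Finset.sum_lt_sum (fun a _ => g1 a)
        ⟨a, Finset.mem_univ a, lt_of_le_of_ne (g1 a) (Ne.symm ha)⟩

/-- Tests whether the position vector is justified. -/
def testJustified : Cmd :=
  .seq (.assign vBad (.const 0))
    (.upTo vA vStudents (.upTo vR vSchoolsSucc
      (.ite (.lt (.var vR) (.read kVec (.var vA)))
        (.seq testRejected (.ite (.var vRej) .skip (.assign vBad (.const 1)))) .skip)))

theorem testJustified_spec (h : Loaded X s) (hm : ∀ a, vec X s a ≤ X.m) :
    (testJustified.run s).var vBad = 0 ↔ X.inst.IsJustified (vec X s) := by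
  rw [testJustified, run]
  set s₀ := (Cmd.assign vBad (.const 0)).run s with hs₀
  have h₀ : Loaded X s₀ := h.run _ (by decide)
  have hv₀ : vec X s₀ = vec X s := rfl
  have key := run_upTo (x := vA) (b := vStudents) (c := .upTo vR vSchoolsSucc
      (.ite (.lt (.var vR) (.read kVec (.var vA)))
        (.seq testRejected (.ite (.var vRej) .skip (.assign vBad (.const 1)))) .skip)) s₀
    (fun i s' => s'.var vBad = 0 ↔ ∀ a : Fin X.n, a.val < i → ∀ r < vec X s a,
      X.inst.RejectsAt (vec X s) a r) (by decide) ?_ ?_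
  · rw [key, SchoolInstance.isJustified_iff, h₀.students]
    exact ⟨fun h a => h a a.isLt, fun h a _ => h a⟩
  · simp [hs₀, run, State.setVar_var, Expr.eval]
  · intro i s' hi hI hV hA hc
    rw [h₀.students] at hi
    have hL : Loaded X s' := h₀.frame (by decide) hV hA
    have hv : vec X s' = vec X s := vec_congr (by rw [hA _ (by decide)]; rfl)
    have key2 := run_upTo (x := vR) (b := vSchoolsSucc)
      (c := .ite (.lt (.var vR) (.read kVec (.var vA)))
        (.seq testRejected (.ite (.var vRej) .skip (.assign vBad (.const 1)))) .skip) s'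
      (fun j s'' => s''.var vBad = 0 ↔ (∀ a : Fin X.n, a.val < i → ∀ r < vec X s a,
        X.inst.RejectsAt (vec X s) a r) ∧ ∀ r < j, r < vec X s ⟨i, hi⟩ →
          X.inst.RejectsAt (vec X s) ⟨i, hi⟩ r) (by decide) ?_ ?_
    · rw [State.setVar_var, if_neg (by decide), key2, hL.schoolsSucc]
      constructor
      · rintro ⟨g1, g2⟩ a ha r hr
        rcases (Nat.lt_succ_iff.1 ha).lt_or_eq with h5 | h5
        · exact g1 a h5 r hr
        · obtain rfl : a = ⟨i, hi⟩ := Fin.ext h5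
          -- The inner loop tests positions `0, …, m`; since the vector is bounded by `m`, this
          -- covers all passed positions.
          exact g2 r (by have := hm ⟨i, hi⟩; omega) hr
      · intro g
        exact ⟨fun a ha => g a (by omega), fun r _ hr => g ⟨i, hi⟩ (Nat.lt_succ_self i) r hr⟩
    · rw [State.setVar_var, if_neg (by decide), hc]
      simp
    · intro j s'' hj hJ hV' hA' hc'
      have hL' : Loaded X s'' := hL.frame (by decide) hV' hA'
      have hv' : vec X s'' = vec X s := (vec_congr (by rw [hA' _ (by decide)])).trans hv
      have hA'' : s''.var vA = (⟨i, hi⟩ : Fin X.n) := by rw [hV' _ (by decide), hI]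
      have hstep : (∀ r < j + 1, r < vec X s ⟨i, hi⟩ → X.inst.RejectsAt (vec X s) ⟨i, hi⟩ r) ↔
          (∀ r < j, r < vec X s ⟨i, hi⟩ → X.inst.RejectsAt (vec X s) ⟨i, hi⟩ r) ∧
            (j < vec X s ⟨i, hi⟩ → X.inst.RejectsAt (vec X s) ⟨i, hi⟩ j) := by
        constructor
        · intro g; exact ⟨fun r hr => g r (by omega), g j (by omega)⟩
        · rintro ⟨g1, g2⟩ r hr
          rcases (Nat.lt_succ_iff.1 hr).lt_or_eq with h5 | rfl
          · exact g1 r h5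
          · exact g2
      rw [hstep, State.setVar_var, if_neg (by decide), run]
      have e1 : (Expr.read kVec (.var vA)).eval s'' = vec X s ⟨i, hi⟩ := by
        rw [← hv']; simp only [Expr.eval, hA'', vec]
      simp only [holds_lt, e1]
      simp only [Expr.eval, hJ]
      have ht := testRejected_spec hL' hA''
      rw [hJ, hv'] at ht
      split_ifs with hlt
      · simp only [run]
        split_ifs with hr
        · rw [run_var (by decide), hc']
          have := ht.1 hr
          tauto
        · have := fun h => hr (ht.2 h)
          simp only [State.setVar_var, Expr.eval]
          simp only [if_true, one_ne_zero, false_iff]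
          tauto
      · simp only [run, hc']
        tauto

/-! ### The program: the list of feasible events -/

/-- The data of the event `e` are stored at index `i`. -/
structure EventAt (s : State) (i : ℕ) (e : X.Event) : Prop where
  worse : s.arr kWorse i = e.worse
  better : s.arr kBetter i = e.better
  worsePos : s.arr kWorsePos i = e.worsePos
  betterPos : s.arr kBetterPos i = e.betterPos

/-- The memory holds the list `l` of events. -/
structure HasEvents (s : State) (l : List X.Event) : Prop where
  length : s.var vEvents = l.length
  get : ∀ i (h : i < l.length), EventAt s i l[i]

theorem EventAt.congr {i : ℕ} {e : X.Event} (h : EventAt s i e) {s' : State}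
    (h1 : s'.arr kWorse = s.arr kWorse) (h2 : s'.arr kBetter = s.arr kBetter)
    (h3 : s'.arr kWorsePos = s.arr kWorsePos) (h4 : s'.arr kBetterPos = s.arr kBetterPos) :
    EventAt s' i e :=
  ⟨by rw [h1, h.worse], by rw [h2, h.better], by rw [h3, h.worsePos], by rw [h4, h.betterPos]⟩

/-- The lists of variables and of arrays do not contain those used by `HasEvents`. -/
def keepsEvents (V A : List ℕ) : Bool :=
  V.all (fun y => y != vEvents) && A.all (fun k => k < 7 || 10 < k)

theorem EventAt.frame {i : ℕ} {e : X.Event} (h : EventAt s i e) {s' : State} {A : List ℕ}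
    (hA' : keepsEvents [] A) (hA : ∀ k, k ∉ A → s'.arr k = s.arr k) : EventAt s' i e := by
  simp only [keepsEvents, Bool.and_eq_true, List.all_eq_true, Bool.or_eq_true,
    decide_eq_true_eq] at hA'
  have : ∀ k, 7 ≤ k → k ≤ 10 → s'.arr k = s.arr k := fun k h1 h2 => hA k fun hk => by
    have := hA'.2 k hk; omega
  exact h.congr (this _ (by decide) (by decide)) (this _ (by decide) (by decide))
    (this _ (by decide) (by decide)) (this _ (by decide) (by decide))

theorem HasEvents.frame {l : List X.Event} (h : HasEvents s l) {s' : State} {V A : List ℕ}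
    (hVA : keepsEvents V A) (hV : ∀ y, y ∉ V → s'.var y = s.var y)
    (hA : ∀ k, k ∉ A → s'.arr k = s.arr k) : HasEvents s' l := by
  have hVA' := hVA
  simp only [keepsEvents, Bool.and_eq_true, List.all_eq_true, bne_iff_ne] at hVA'
  refine ⟨(hV _ fun hy => hVA'.1 _ hy rfl).trans h.length, fun i hi =>
    (h.get i hi).frame (A := A) ?_ hA⟩
  simp only [keepsEvents, Bool.and_eq_true] at hVA ⊢
  exact ⟨by simp, hVA.2⟩

theorem HasEvents.run {l : List X.Event} (h : HasEvents s l) (c : Cmd)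
    (hc : keepsEvents c.vars c.arrs) : HasEvents (c.run s) l :=
  h.frame hc (fun _ hy => run_var hy s) fun _ hk => run_arr hk s

theorem EventAt.run {i : ℕ} {e : X.Event} (h : EventAt s i e) (c : Cmd)
    (hc : keepsEvents [] c.arrs) : EventAt (c.run s) i e :=
  h.frame hc fun _ hk => run_arr hk s

theorem HasEvents.setVar {l : List X.Event} (h : HasEvents s l) (x v : ℕ) (hx : x ≠ vEvents) :
    HasEvents (s.setVar x v) l :=
  ⟨by rw [State.setVar_var, if_neg hx.symm, h.length], fun i hi =>
    (h.get i hi).congr rfl rfl rfl rfl⟩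

/-- Stores the least position vector of the event `vEvent`. -/
def loadFloor : Cmd :=
  .seq (.upTo vCopy vStudents (.write kVec (.var vCopy) (.const 0)))
    (.seq (.write kVec (.read kWorse (.var vEvent)) (.read kWorsePos (.var vEvent)))
      (.write kVec (.read kBetter (.var vEvent)) (.read kBetterPos (.var vEvent))))

theorem loadFloor_spec (h : Loaded X s) {e : X.Event} (he : EventAt s (s.var vEvent) e) :
    vec X (loadFloor.run s) = e.floor := by
  rw [loadFloor, run_seq]
  set s₁ := (Cmd.upTo vCopy vStudents (.write kVec (.var vCopy) (.const 0))).run s with hs₁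
  have key : ∀ a : Fin X.n, a.val < s.var vStudents → s₁.arr kVec a = 0 := by
    refine run_upTo (x := vCopy) (b := vStudents) s (fun i s' => ∀ a : Fin X.n, a.val < i →
      s'.arr kVec a = 0) (by decide) ?_ ?_
    · intro a ha; omega
    · intro i s' hi hI hV hA hc a ha
      simp only [run, State.setVar_arr, State.setArr_arr, if_true, Expr.eval, hI,
        Function.update_apply]
      split_ifs with h1
      · rfl
      · exact hc a (by omega)
  have he₁ : EventAt s₁ (s₁.var vEvent) e := by
    rw [hs₁, run_var (by decide)]; exact he.run _ (by decide)
  funext a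
  have := key a (by rw [h.students]; exact a.isLt)
  simp only [run, vec, State.setArr_arr, Expr.eval, if_true, State.setArr_var,
    SiblingInstance.Event.floor, Function.update_apply, he₁.worse, he₁.worsePos, Fin.ext_iff, this,
    Pi.zero_apply]
  simp [he₁.better, he₁.betterPos]

/-- Computes the least settled position vector of the event `vEvent`. -/
def loadLow : Cmd := .seq loadFloor raise

theorem loadLow_spec (h : Loaded X s) {e : X.Event} (he : EventAt s (s.var vEvent) e) :
    X.inst.IsRaised e.floor (vec X (loadLow.run s)) ∧ ∀ a, vec X (loadLow.run s) a ≤ X.m := by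
  have h1 := loadFloor_spec h he
  have h2 := raise_spec (h.run loadFloor (by decide)) (fun a => by
    rw [h1]; exact SiblingInstance.Event.floor_le_m a)
  rw [h1] at h2
  exact h2

/-- The first student of the pair `vPair`. -/
def fstE : Expr :=
  .sub (.read kInput (.add (.var vBase) (.add (.var vPair) (.var vPair)))) (.const 1)

/-- The second student of the pair `vPair`. -/
def sndE : Expr :=
  .sub (.read kInput (.add (.add (.var vBase) (.add (.var vPair) (.var vPair))) (.const 1)))
    (.const 1)

theorem Loaded.eval_fstE (h : Loaded X s) {k : ℕ} (hk : k < X.siblings.length)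
    (hk' : s.var vPair = k) : fstE.eval s = X.siblings[k].1 := by
  have := (h.pair k hk).1
  simp only [fstE, Expr.eval, hk', this]; omega

theorem Loaded.eval_sndE (h : Loaded X s) {k : ℕ} (hk : k < X.siblings.length)
    (hk' : s.var vPair = k) : sndE.eval s = X.siblings[k].2 := by
  have := (h.pair k hk).2
  simp only [sndE, Expr.eval, hk', this]; omega

/-- Stores the event of the pair `vPair` and the school `vSchool` behind the list of events. -/
def storeEvent : Cmd :=
  .seq (.ite (.lt (rankE (.var vSchool) (codeE fstE)) (rankE (.var vSchool) (codeE sndE)))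
      (.seq (.assign vBetter fstE) (.assign vWorse sndE))
      (.seq (.assign vBetter sndE) (.assign vWorse fstE)))
    (.seq (.write kWorse (.var vEvents) (.var vWorse))
      (.seq (.write kBetter (.var vEvents) (.var vBetter))
        (.seq (.write kWorsePos (.var vEvents) (posE (.var vWorse) (codeE (.var vSchool))))
          (.seq (.write kBetterPos (.var vEvents) (posE (.var vBetter) (codeE (.var vSchool))))
            (.assign vEvent (.var vEvents))))))

/-- The candidate is written just past the end of the list without increasing the recorded length,
so rejecting it later needs no undoing. -/
theorem storeEvent_spec (h : Loaded X s) {l : List X.Event} (hl : HasEvents s l) {k : ℕ}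
    (hk : k < X.siblings.length) (hk' : s.var vPair = k) {b : Fin X.m} (hb : s.var vSchool = b) :
    HasEvents (storeEvent.run s) l ∧
      EventAt (storeEvent.run s) l.length (X.eventOf X.siblings[k] b) ∧
      (storeEvent.run s).var vEvent = l.length ∧
      (storeEvent.run s).var vWorse = (X.eventOf X.siblings[k] b).worse := by
  set e := X.eventOf X.siblings[k] b with he
  rw [storeEvent, run_seq]
  set c₀ : Cmd := .ite (.lt (rankE (.var vSchool) (codeE fstE)) (rankE (.var vSchool) (codeE sndE)))
      (.seq (.assign vBetter fstE) (.assign vWorse sndE))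
      (.seq (.assign vBetter sndE) (.assign vWorse fstE)) with hc₀
  set s₁ := c₀.run s with hs₁
  have f1 := h.eval_fstE hk hk'
  have f2 := h.eval_sndE hk hk'
  have hsch : e.school = b := by rw [he, SiblingInstance.eventOf]; split_ifs <;> rfl
  have hbw : s₁.var vBetter = e.better ∧ s₁.var vWorse = e.worse := by
    have f1' : ∀ v, fstE.eval (s.setVar vBetter v) = fstE.eval s := fun v => by
      simp [fstE, Expr.eval, State.setVar_var, State.setVar_arr]
    have f2' : ∀ v, sndE.eval (s.setVar vBetter v) = sndE.eval s := fun v => by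
      simp [sndE, Expr.eval, State.setVar_var, State.setVar_arr]
    have r1 := h.eval_rankE (eb := .var vSchool) (some X.siblings[k].1) hb (eval_codeE f1)
    have r2 := h.eval_rankE (eb := .var vSchool) (some X.siblings[k].2) hb (eval_codeE f2)
    by_cases hlt : X.inst.rank b (some X.siblings[k].1) < X.inst.rank b (some X.siblings[k].2)
    · rw [hs₁, hc₀, run_ite_of (by rw [holds_lt, r1, r2]; exact hlt), run_seq, run_assign,
        run_assign, f2', f1, f2, he, SiblingInstance.eventOf, if_pos hlt]
      simp [State.setVar_var]
    · rw [hs₁, hc₀, run_ite_of_not (by rw [holds_lt, r1, r2]; exact hlt), run_seq, run_assign,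
        run_assign, f1', f1, f2, he, SiblingInstance.eventOf, if_neg hlt]
      simp [State.setVar_var]
  have hE₁ : s₁.var vEvents = l.length := by rw [hs₁, run_var (by decide), hl.length]
  have hb₁ : s₁.var vSchool = b := by rw [hs₁, run_var (by decide), hb]
  have h₁ : Loaded X s₁ := h.run _ (by decide)
  have hl₁ : HasEvents s₁ l := hl.run _ (by decide)
  set s₂ := (Cmd.write kWorse (.var vEvents) (.var vWorse)).run s₁ with hs₂
  set s₃ := (Cmd.write kBetter (.var vEvents) (.var vBetter)).run s₂ with hs₃
  have h₃ : Loaded X s₃ := (h₁.run (Cmd.write kWorse _ _) (by decide)).run _ (by decide)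
  have v₃ : s₃.var = s₁.var := rfl
  have p1 := h₃.eval_posE (ea := .var vWorse) (ec := codeE (.var vSchool)) (a := e.worse)
    (some b) hbw.2 (eval_codeE (by simp only [Expr.eval, v₃, hb₁]))
  set s₄ := (Cmd.write kWorsePos (.var vEvents)
    (posE (.var vWorse) (codeE (.var vSchool)))).run s₃ with hs₄
  have h₄ : Loaded X s₄ := h₃.run _ (by decide)
  have p2 := h₄.eval_posE (ea := .var vBetter) (ec := codeE (.var vSchool)) (a := e.better)
    (some b) hbw.1 (eval_codeE (by simp only [Expr.eval]; exact hb₁))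
  set s₅ := (Cmd.write kBetterPos (.var vEvents)
    (posE (.var vBetter) (codeE (.var vSchool)))).run s₄ with hs₅
  have a1 : s₅.arr kWorse = Function.update (s₁.arr kWorse) l.length e.worse := by
    rw [← hE₁, ← hbw.2]; rfl
  have a2 : s₅.arr kBetter = Function.update (s₁.arr kBetter) l.length e.better := by
    rw [← hE₁, ← hbw.1]; rfl
  have a3 : s₅.arr kWorsePos = Function.update (s₁.arr kWorsePos) l.length e.worsePos := by
    rw [← hE₁, SiblingInstance.Event.worsePos, hsch, ← p1]; rfl
  have a4 : s₅.arr kBetterPos = Function.update (s₁.arr kBetterPos) l.length e.betterPos := by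
    rw [← hE₁, SiblingInstance.Event.betterPos, hsch, ← p2]; rfl
  set s₆ := (Cmd.assign vEvent (.var vEvents)).run s₅ with hs₆
  have v₅ : s₅.var = s₁.var := rfl
  have a₆ : s₆.arr = s₅.arr := rfl
  change HasEvents s₆ l ∧ EventAt s₆ l.length e ∧ s₆.var vEvent = l.length ∧ s₆.var vWorse = e.worse
  refine ⟨⟨?_, fun i hi => ?_⟩, ⟨?_, ?_, ?_, ?_⟩, ?_, ?_⟩
  · simp [hs₆, run, State.setVar_var, v₅, hE₁]
  · have g := hl₁.get i hi
    exact ⟨by rw [a₆, a1, Function.update_of_ne hi.ne, g.worse],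
      by rw [a₆, a2, Function.update_of_ne hi.ne, g.better],
      by rw [a₆, a3, Function.update_of_ne hi.ne, g.worsePos],
      by rw [a₆, a4, Function.update_of_ne hi.ne, g.betterPos]⟩
  · rw [a₆, a1, Function.update_self]
  · rw [a₆, a2, Function.update_self]
  · rw [a₆, a3, Function.update_self]
  · rw [a₆, a4, Function.update_self]
  · simp [hs₆, run, State.setVar_var, Expr.eval, v₅, hE₁]
  · simp [hs₆, run, State.setVar_var, v₅, hbw.2]

/-- Appends the event of the pair `vPair` and the school `vSchool` if it is feasible. -/
def addEvent : Cmd :=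
  .seq storeEvent (.seq loadLow (.seq testJustified
    (.ite (.and (.not (.var vBad))
        (.le (.read kVec (.var vWorse)) (.read kWorsePos (.var vEvent))))
      (.assign vEvents (.add (.var vEvents) (.const 1))) .skip)))

theorem addEvent_spec (h : Loaded X s) {l : List X.Event} (hl : HasEvents s l) {k : ℕ}
    (hk : k < X.siblings.length) (hk' : s.var vPair = k) {b : Fin X.m} (hb : s.var vSchool = b) :
    ((X.eventOf X.siblings[k] b).Feasible ∧
      HasEvents (addEvent.run s) (l ++ [X.eventOf X.siblings[k] b])) ∨
    (¬ (X.eventOf X.siblings[k] b).Feasible ∧ HasEvents (addEvent.run s) l) := by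
  obtain ⟨g1, g2, g3, g4⟩ := storeEvent_spec h hl hk hk' hb
  have hrank := SiblingInstance.rank_eventOf_lt (X.siblings_ne _ (List.getElem_mem hk)) b
  set e := X.eventOf X.siblings[k] b with he
  rw [addEvent, run_seq, run_seq, run_seq]
  set s₁ := storeEvent.run s with hs₁
  have h₁ : Loaded X s₁ := h.run _ (by decide)
  have g2' := g2
  rw [← g3] at g2'
  obtain ⟨hr, hm⟩ := loadLow_spec h₁ g2'
  set s₂ := loadLow.run s₁ with hs₂
  have h₂ : Loaded X s₂ := h₁.run _ (by decide)
  have hl₂ : HasEvents s₂ l := g1.run _ (by decide)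
  have e₂ : EventAt s₂ l.length e := g2.run _ (by decide)
  have ht := testJustified_spec h₂ hm
  set s₃ := testJustified.run s₂ with hs₃
  have hl₃ : HasEvents s₃ l := hl₂.run _ (by decide)
  have e₃ : EventAt s₃ l.length e := e₂.run _ (by decide)
  have w₃ : s₃.var vWorse = e.worse := by
    rw [hs₃, run_var (by decide), hs₂, run_var (by decide), g4]
  have i₃ : s₃.var vEvent = l.length := by
    rw [hs₃, run_var (by decide), hs₂, run_var (by decide), g3]
  have q₃ : s₃.arr kVec e.worse = vec X s₂ e.worse := by rw [hs₃, run_arr (by decide)]; rfl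
  have hcond : (Expr.and (.not (.var vBad))
        (.le (.read kVec (.var vWorse)) (.read kWorsePos (.var vEvent)))).Holds s₃ ↔
        X.inst.IsJustified (vec X s₂) ∧ vec X s₂ e.worse ≤ e.worsePos := by
    rw [holds_and, holds_not, holds_le, Expr.Holds, not_not]
    simp only [Expr.eval]
    rw [ht, w₃, i₃, q₃, e₃.worsePos]
  -- If any stable vector realizes the event, the raised floor is stable and below it, so the worse
  -- student has not passed the school. Conversely, a raised floor passing both tests realizes the
  -- event.
  have hfeas : X.inst.IsJustified (vec X s₂) ∧ vec X s₂ e.worse ≤ e.worsePos ↔ e.Feasible := by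
    constructor
    · rintro ⟨h1, h2⟩
      have hst : X.inst.IsStablePos (vec X s₂) := ⟨hr.isSettled, h1⟩
      exact ⟨hrank, _, hst, SiblingInstance.Event.together_of_floor_le hrank hst hr.le h2⟩
    · rintro ⟨_, q, hq, hqt⟩
      have hle := hqt.floor_le (SiblingInstance.Event.ne_of_rank_lt hrank)
      exact ⟨(hr.isStablePos hq hle).isJustified, (hr.le_of_le q hq hle _).trans hqt.2.le⟩
  rw [hfeas] at hcond
  by_cases hf : e.Feasible
  · refine .inl ⟨hf, ?_⟩
    rw [run_ite_of (hcond.2 hf), run_assign]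
    refine ⟨?_, fun i hi => ?_⟩
    · simp [State.setVar_var, Expr.eval, hl₃.length]
    · rw [List.length_append, List.length_singleton] at hi
      rcases (Nat.lt_succ_iff.1 hi).lt_or_eq with h5 | rfl
      · rw [List.getElem_append_left h5]
        exact (hl₃.get i h5).congr rfl rfl rfl rfl
      · rw [List.getElem_append_right le_rfl]
        have : EventAt (s₃.setVar vEvents ((Expr.add (.var vEvents) (.const 1)).eval s₃)) l.length e :=
          e₃.congr rfl rfl rfl rfl
        simpa using this
  · refine .inr ⟨hf, ?_⟩
    rw [run_ite_of_not (fun h' => hf (hcond.1 h'))]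
    exact hl₃

theorem ite_add_ite_of_not_and {P Q : Prop} [Decidable P] [Decidable Q] [Decidable (P ∨ Q)]
    (h : ¬ (P ∧ Q)) :
    (if P then 1 else 0) + (if Q then 1 else 0) = if P ∨ Q then 1 else 0 := by
  by_cases hP : P <;> by_cases hQ : Q <;> simp_all

/-- Computes the list of the feasible events. -/
def findEvents : Cmd := .upTo vPair vPairs (.upTo vSchool vSchools addEvent)

-- A stable matching puts a pair together at no more than one school, so the realized events count
-- the pairs together; infeasible events never occur and may be omitted.
open Classical in
theorem findEvents_spec (h : Loaded X s) (h0 : s.var vEvents = 0) :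
    ∃ l : List X.Event, HasEvents (findEvents.run s) l ∧ (∀ e ∈ l, e.Feasible) ∧
      l.length ≤ X.siblings.length * X.m ∧
      ∀ q, X.inst.IsStablePos q →
        l.countP (fun e => e.Together q) = X.numTogether (X.inst.matchingOf q) := by
  have key := run_upTo (x := vPair) (b := vPairs) (c := .upTo vSchool vSchools addEvent) s
    (fun k s' => ∃ l : List X.Event, HasEvents s' l ∧ (∀ e ∈ l, e.Feasible) ∧
      l.length ≤ k * X.m ∧ ∀ q, X.inst.IsStablePos q →
        l.countP (fun e => e.Together q) =
          (X.siblings.take k).countP fun p => X.SameSchool (X.inst.matchingOf q) p)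
    (by decide) ?_ ?_
  · rw [h.pairs] at key
    obtain ⟨l, h1, h2, h3, h4⟩ := key
    refine ⟨l, h1, h2, h3, fun q hq => ?_⟩
    rw [h4 q hq, List.take_length, SiblingInstance.numTogether, List.countP_eq_length_filter]
  · refine ⟨[], ⟨by simp [State.setVar_var, h0], by simp⟩, by simp, by simp, by simp⟩
  · rintro k s' hk hK hV hA ⟨l₀, h1, h2, h3, h4⟩
    rw [h.pairs] at hk
    have hL : Loaded X s' := h.frame (by decide) hV hA
    have key2 := run_upTo (x := vSchool) (b := vSchools) (c := addEvent) s'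
      (fun j s'' => ∃ l : List X.Event, HasEvents s'' l ∧ (∀ e ∈ l, e.Feasible) ∧
        l.length ≤ k * X.m + j ∧ ∀ q, X.inst.IsStablePos q →
          l.countP (fun e => e.Together q) =
            (X.siblings.take k).countP (fun p => X.SameSchool (X.inst.matchingOf q) p) +
            if ∃ b : Fin X.m, b.val < j ∧ (X.eventOf X.siblings[k] b).Together q then 1 else 0)
      (by decide) ?_ ?_
    · obtain ⟨l, g1, g2, g3, g4⟩ := key2
      refine ⟨l, g1.setVar _ _ (by decide), g2, ?_, fun q hq => ?_⟩
      · rw [hL.schools] at g3; rw [Nat.succ_mul]; exact g3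
      · rw [g4 q hq, List.take_add_one, List.getElem?_eq_getElem hk, List.countP_append]
        congr 1
        simp only [Option.toList_some, List.countP_singleton, decide_eq_true_eq,
          SiblingInstance.SameSchool, hq.matchingOf_eq_some_iff_eq,
          SiblingInstance.together_eventOf_iff]
        refine if_congr ?_ rfl rfl
        rw [hL.schools]
        exact ⟨fun ⟨b, hb⟩ => ⟨b, hb.2⟩, fun ⟨b, hb⟩ => ⟨b, b.isLt, hb⟩⟩
    · exact ⟨l₀, h1.setVar _ _ (by decide), h2, h3,
        fun q hq => by simp [h4 q hq]⟩
    · rintro j s'' hj hJ hV' hA' ⟨l, g1, g2, g3, g4⟩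
      rw [hL.schools] at hj
      have hL' : Loaded X s'' := hL.frame (by decide) hV' hA'
      have hK' : s''.var vPair = k := by rw [hV' _ (by decide), hK]
      -- Different schools have different positions in the list of the first student.
      have hun : ∀ q, (X.eventOf X.siblings[k] ⟨j, hj⟩).Together q →
          ¬ ∃ b : Fin X.m, b.val < j ∧ (X.eventOf X.siblings[k] b).Together q := by
        rintro q ht ⟨b, hb, ht'⟩
        rw [SiblingInstance.together_eventOf_iff] at ht ht'
        have := X.inst.pos_injective _ (ht.1.symm.trans ht'.1)
        rw [Option.some_injective _ this.symm] at hb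
        exact lt_irrefl _ hb
      have hsplit : ∀ q, (∃ b : Fin X.m, b.val < j + 1 ∧ (X.eventOf X.siblings[k] b).Together q) ↔
          (∃ b : Fin X.m, b.val < j ∧ (X.eventOf X.siblings[k] b).Together q) ∨
            (X.eventOf X.siblings[k] ⟨j, hj⟩).Together q := by
        intro q
        constructor
        · rintro ⟨b, hb, hq⟩
          rcases (Nat.lt_succ_iff.1 hb).lt_or_eq with h5 | h5
          · exact .inl ⟨b, h5, hq⟩
          · obtain rfl : b = ⟨j, hj⟩ := Fin.ext h5
            exact .inr hq
        · rintro (⟨b, hb, hq⟩ | hq)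
          · exact ⟨b, by omega, hq⟩
          · exact ⟨⟨j, hj⟩, Nat.lt_succ_self j, hq⟩
      rcases addEvent_spec hL' g1 hk hK' (b := ⟨j, hj⟩) hJ with ⟨f1, f2⟩ | ⟨f1, f2⟩
      · refine ⟨l ++ [_], f2.setVar _ _ (by decide), ?_, ?_, ?_⟩
        · intro e he
          rcases List.mem_append.1 he with he | he
          · exact g2 e he
          · rw [List.mem_singleton.1 he]; exact f1
        · simp; omega
        · intro q hq
          rw [List.countP_append, g4 q hq, add_assoc]
          congr 1
          rw [List.countP_singleton, if_congr (hsplit q) rfl rfl,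
            ← ite_add_ite_of_not_and fun hpq => hun q hpq.2 hpq.1]
          simp only [decide_eq_true_eq]
      · refine ⟨l, f2.setVar _ _ (by decide), g2, by omega, ?_⟩
        intro q hq
        rw [g4 q hq]
        congr 1
        refine if_congr ?_ rfl rfl
        rw [hsplit, or_iff_left]
        intro ht
        exact f1 ⟨SiblingInstance.rank_eventOf_lt (X.siblings_ne _ (List.getElem_mem hk)) _,
          q, hq, ht⟩

/-! ### The program: the auction -/

/-- Computes the least price `vBest` of an event `vArg` in conflict with the event `vEvent`, or
`vThreshold` if there is no smaller price. -/
def minPrice : Cmd :=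
  .seq loadLow (.seq (.assign vBest (.var vThreshold))
    (.upTo vF vEvents
      (.ite (.and (.lt (.read kWorsePos (.var vF)) (.read kVec (.read kWorse (.var vF))))
          (.lt (.read kPrice (.var vF)) (.var vBest)))
        (.seq (.assign vBest (.read kPrice (.var vF))) (.assign vArg (.var vF))) .skip)))

theorem minPrice_spec (h : Loaded X s) {l : List X.Event} (hl : HasEvents s l)
    (hfe : ∀ e ∈ l, e.Feasible) {e : ℕ} (he : e < l.length) (he' : s.var vEvent = e) :
    (minPrice.run s).var vBest ≤ s.var vThreshold ∧
      (∀ f < l.length, Conflict l e f → (minPrice.run s).var vBest ≤ s.arr kPrice f) ∧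
      ((minPrice.run s).var vBest < s.var vThreshold →
        (minPrice.run s).var vArg < l.length ∧ Conflict l e ((minPrice.run s).var vArg) ∧
        s.arr kPrice ((minPrice.run s).var vArg) = (minPrice.run s).var vBest) := by
  have hev : EventAt s (s.var vEvent) l[e] := by rw [he']; exact hl.get e he
  obtain ⟨hr, -⟩ := loadLow_spec h hev
  rw [minPrice, run_seq, run_seq]
  set s₁ := loadLow.run s with hs₁
  have h₁ : Loaded X s₁ := h.run _ (by decide)
  have hl₁ : HasEvents s₁ l := hl.run _ (by decide)
  obtain ⟨hrk, p, hp, hpt⟩ := hfe _ (List.getElem_mem he)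
  have hple := hpt.floor_le (SiblingInstance.Event.ne_of_rank_lt hrk)
  have hq := hr.isStablePos hp hple
  -- The raised floor of `e` is the least stable vector above the floor, so a conflict can be read
  -- off from this single vector.
  have hconf : ∀ f (hf : f < l.length), Conflict l e f ↔
      l[f].worsePos < vec X s₁ l[f].worse := by
    intro f hf
    constructor
    · rintro ⟨_, _, hc⟩; exact hc _ hq hr.le
    · intro hlt
      exact ⟨he, hf, fun p hp hle => hlt.trans_le (hr.le_of_le p hp hle _)⟩
  set s₂ := (Cmd.assign vBest (.var vThreshold)).run s₁ with hs₂
  have hl₂ : HasEvents s₂ l := hl₁.run _ (by decide)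
  have ht₂ : s₂.var vBest = s.var vThreshold := by
    rw [hs₂, run_assign, State.setVar_var, if_pos rfl, Expr.eval, hs₁, run_var (by decide)]
  have hpr₂ : s₂.arr kPrice = s.arr kPrice := by
    rw [hs₂, run_arr (by decide), hs₁, run_arr (by decide)]
  have hv₂ : s₂.arr kVec = s₁.arr kVec := rfl
  have key := run_upTo (x := vF) (b := vEvents)
    (c := .ite (.and (.lt (.read kWorsePos (.var vF)) (.read kVec (.read kWorse (.var vF))))
          (.lt (.read kPrice (.var vF)) (.var vBest)))
        (.seq (.assign vBest (.read kPrice (.var vF))) (.assign vArg (.var vF))) .skip) s₂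
    (fun i s' => s'.var vBest ≤ s.var vThreshold ∧
      (∀ f < l.length, f < i → Conflict l e f → s'.var vBest ≤ s.arr kPrice f) ∧
      (s'.var vBest < s.var vThreshold →
        s'.var vArg < l.length ∧ Conflict l e (s'.var vArg) ∧
        s.arr kPrice (s'.var vArg) = s'.var vBest)) (by decide) ?_ ?_
  · obtain ⟨k1, k2, k3⟩ := key
    exact ⟨k1, fun f hf => k2 f hf (by rw [hl₂.length]; exact hf), k3⟩
  · simp only [State.setVar_var, ht₂]
    exact ⟨le_rfl, fun f _ hf => absurd hf (by omega), fun hlt => absurd hlt (lt_irrefl _)⟩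
  · rintro i s' hi hI hV hA ⟨k1, k2, k3⟩
    rw [hl₂.length] at hi
    have hl' : HasEvents s' l := hl₂.frame (by decide) hV hA
    have hev' := hl'.get i hi
    have hcond : (Expr.and (.lt (.read kWorsePos (.var vF)) (.read kVec (.read kWorse (.var vF))))
          (.lt (.read kPrice (.var vF)) (.var vBest))).Holds s' ↔
        Conflict l e i ∧ s.arr kPrice i < s'.var vBest := by
      rw [holds_and, holds_lt, holds_lt, hconf i hi]
      simp only [Expr.eval, hI, hev'.worsePos, hev'.worse]
      rw [hA kVec (by decide), hv₂, hA kPrice (by decide), hpr₂]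
      rfl
    by_cases hc : Conflict l e i ∧ s.arr kPrice i < s'.var vBest
    · rw [run_ite_of (hcond.2 hc), run_seq, run_assign, run_assign]
      have hp' : (Expr.read kPrice (.var vF)).eval s' = s.arr kPrice i := by
        rw [Expr.eval, Expr.eval, hI, hA kPrice (by decide), hpr₂]
      rw [hp']
      simp only [State.setVar_var, Expr.eval, hI]
      simp only [Nat.reduceEqDiff, if_true, if_false]
      refine ⟨by omega, fun f hf hfi hcf => ?_, fun _ => ⟨hi, hc.1, trivial⟩⟩
      rcases (Nat.lt_succ_iff.1 hfi).lt_or_eq with h5 | rfl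
      · exact hc.2.le.trans (k2 f hf h5 hcf)
      · exact le_rfl
    · rw [run_ite_of_not fun h' => hc (hcond.1 h')]
      simp only [run, State.setVar_var, Nat.reduceEqDiff, if_false]
      refine ⟨k1, fun f hf hfi hcf => ?_, k3⟩
      rcases (Nat.lt_succ_iff.1 hfi).lt_or_eq with h5 | rfl
      · exact k2 f hf h5 hcf
      · by_contra hlt
        exact hc ⟨hcf, not_le.1 hlt⟩

/-- The memory holds an auction on the conflicts of the events in the list `l`. -/
def HasAuction (s : State) (l : List X.Event) : Prop :=
  IsAuction l.length (Conflict l) (s.arr kPrice) (s.arr kOwner) (s.arr kStatus)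

/-- If the event `vEvent` is waiting, lets it bid for the cheapest event in conflict with it or
give up. -/
def placeBid : Cmd :=
  .ite (.read kStatus (codeE (.var vEvent))) .skip
    (.seq minPrice
      (.ite (.lt (.var vBest) (.var vThreshold))
        (.seq (.write kStatus (.read kOwner (.var vArg)) (.const 0))
          (.seq (.write kOwner (.var vArg) (codeE (.var vEvent)))
            (.seq (.write kStatus (codeE (.var vEvent)) (.const 1))
              (.write kPrice (.var vArg) (.add (.read kPrice (.var vArg)) (.const 1))))))
        (.write kStatus (codeE (.var vEvent)) (.const 2))))

theorem placeBid_spec (h : Loaded X s) {l : List X.Event} (hl : HasEvents s l)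
    (hfe : ∀ e ∈ l, e.Feasible) (ht : s.var vThreshold = l.length + 2) (ha : HasAuction s l)
    {e : ℕ} (he : e < l.length) (he' : s.var vEvent = e) :
    HasAuction (placeBid.run s) l ∧
      (s.arr kStatus (e + 1) = 0 ∧ IsAuction.potential l.length (s.arr kPrice) (s.arr kStatus) <
        IsAuction.potential l.length ((placeBid.run s).arr kPrice) ((placeBid.run s).arr kStatus) ∨
      s.arr kStatus (e + 1) ≠ 0 ∧ placeBid.run s = s) := by
  rw [placeBid]
  by_cases hst : s.arr kStatus (e + 1) = 0
  · rw [run_ite_of_not (by simp [Expr.Holds, Expr.eval, codeE, he', hst]), run_seq]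
    obtain ⟨k1, k2, k3⟩ := minPrice_spec h hl hfe he he'
    set s₁ := minPrice.run s with hs₁
    have t₁ : s₁.var vThreshold = s.var vThreshold := by rw [hs₁, run_var (by decide)]
    have e₁ : s₁.var vEvent = e := by rw [hs₁, run_var (by decide), he']
    have p₁ : s₁.arr kPrice = s.arr kPrice := by rw [hs₁, run_arr (by decide)]
    have o₁ : s₁.arr kOwner = s.arr kOwner := by rw [hs₁, run_arr (by decide)]
    have st₁ : s₁.arr kStatus = s.arr kStatus := by rw [hs₁, run_arr (by decide)]
    by_cases hlt : s₁.var vBest < s.var vThreshold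
    · obtain ⟨j1, j2, j3⟩ := k3 hlt
      rw [run_ite_of (by rw [holds_lt]; simp only [Expr.eval]; rw [t₁]; exact hlt)]
      -- `vBest` is the price of the chosen object, which turns the loop result into the minimality
      -- and price-cap hypotheses of `IsAuction.bid`.
      rw [← j3] at k2 hlt
      rw [ht] at hlt
      set f := s₁.var vArg with hf
      set s₂ := Cmd.run _ s₁ with hs₂
      have a1 : s₂.arr kPrice = Function.update (s.arr kPrice) f (s.arr kPrice f + 1) := by
        simp [hs₂, run, State.setArr_arr, State.setArr_var, Expr.eval, p₁, ← hf]
      have a2 : s₂.arr kOwner = Function.update (s.arr kOwner) f (e + 1) := by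
        simp [hs₂, run, State.setArr_arr, State.setArr_var, Expr.eval, o₁, ← hf, codeE, e₁]
      have a3 : s₂.arr kStatus =
          Function.update (Function.update (s.arr kStatus) (s.arr kOwner f) 0) (e + 1) 1 := by
        simp [hs₂, run, State.setArr_arr, State.setArr_var, Expr.eval, o₁, ← hf, codeE, e₁, st₁]
      rw [HasAuction, a1, a2, a3]
      exact ⟨ha.bid he hst j1 j2 hlt k2, .inl ⟨hst, ha.potential_lt_bid hst j1⟩⟩
    · rw [run_ite_of_not (by rw [holds_lt]; simp only [Expr.eval]; rw [t₁]; exact hlt)]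
      have hb : s₁.var vBest = l.length + 2 := by omega
      rw [hb] at k2
      have a3 : (s₁.setArr kStatus (e + 1) 2).arr kStatus =
          Function.update (s.arr kStatus) (e + 1) 2 := by
        simp [State.setArr_arr, st₁]
      have a1 : (s₁.setArr kStatus (e + 1) 2).arr kPrice = s.arr kPrice := by
        simp [State.setArr_arr, p₁]
      have a2 : (s₁.setArr kStatus (e + 1) 2).arr kOwner = s.arr kOwner := by
        simp [State.setArr_arr, o₁]
      rw [run_write]
      simp only [codeE, Expr.eval, e₁]
      rw [HasAuction, a1, a2, a3]
      exact ⟨ha.giveUp hst k2, .inl ⟨hst, IsAuction.potential_lt_giveUp he hst⟩⟩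
  · rw [run_ite_of (by simpa [Expr.Holds, Expr.eval, codeE, he'] using hst), run]
    exact ⟨ha, .inr ⟨hst, rfl⟩⟩

/-- Lets all waiting events bid. -/
def auctionRound : Cmd := .upTo vEvent vEvents placeBid

/-- A bidder displaced during the round may end it waiting, so completion is claimed only for a
round in which nobody bids or gives up; otherwise the potential has grown. -/
theorem auctionRound_spec (h : Loaded X s) {l : List X.Event} (hl : HasEvents s l)
    (hfe : ∀ e ∈ l, e.Feasible) (ht : s.var vThreshold = l.length + 2) (ha : HasAuction s l) :
    HasAuction (auctionRound.run s) l ∧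
      ((∀ e < l.length, (auctionRound.run s).arr kStatus (e + 1) ≠ 0) ∧
        (auctionRound.run s).arr kPrice = s.arr kPrice ∧
        (auctionRound.run s).arr kStatus = s.arr kStatus ∨
      (∃ e < l.length, s.arr kStatus (e + 1) = 0) ∧
        IsAuction.potential l.length (s.arr kPrice) (s.arr kStatus) <
        IsAuction.potential l.length ((auctionRound.run s).arr kPrice)
          ((auctionRound.run s).arr kStatus)) := by
  have key := run_upTo (x := vEvent) (b := vEvents) (c := placeBid) s
    (fun i s' => HasAuction s' l ∧
      ((∀ e < l.length, e < i → s'.arr kStatus (e + 1) ≠ 0) ∧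
        s'.arr kPrice = s.arr kPrice ∧ s'.arr kStatus = s.arr kStatus ∨
      (∃ e < l.length, s.arr kStatus (e + 1) = 0) ∧
        IsAuction.potential l.length (s.arr kPrice) (s.arr kStatus) <
        IsAuction.potential l.length (s'.arr kPrice) (s'.arr kStatus))) (by decide) ?_ ?_
  · obtain ⟨k1, k2⟩ := key
    rw [hl.length] at k2
    exact ⟨k1, k2.imp (fun k => ⟨fun e he => k.1 e he he, k.2⟩) id⟩
  · exact ⟨ha, .inl ⟨fun e _ he => absurd he (by omega), rfl, rfl⟩⟩
  · rintro i s' hi hI hV hA ⟨k1, k2⟩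
    rw [hl.length] at hi
    have h' : Loaded X s' := h.frame (by decide) hV hA
    have hl' : HasEvents s' l := hl.frame (by decide) hV hA
    have ht' : s'.var vThreshold = l.length + 2 := by rw [hV _ (by decide), ht]
    obtain ⟨g1, g2⟩ := placeBid_spec h' hl' hfe ht' k1 hi hI
    simp only [State.setVar_arr]
    refine ⟨g1, ?_⟩
    rcases g2 with ⟨g2, g3⟩ | ⟨g2, g3⟩
    · right
      rcases k2 with ⟨k2, k3, k4⟩ | ⟨k2, k3⟩
      · rw [k3, k4] at g3
        exact ⟨⟨i, hi, by rw [← k4]; exact g2⟩, g3⟩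
      · exact ⟨k2, k3.trans g3⟩
    · rw [g3]
      refine k2.imp (fun k2 => ⟨fun e he hei => ?_, k2.2⟩) id
      rcases (Nat.lt_succ_iff.1 hei).lt_or_eq with h5 | rfl
      · exact k2.1 e he h5
      · exact g2

/-- Runs the auction until no event is waiting. -/
def runAuction : Cmd := .upTo vRound vRounds auctionRound

theorem runAuction_spec (h : Loaded X s) {l : List X.Event} (hl : HasEvents s l)
    (hfe : ∀ e ∈ l, e.Feasible) (ht : s.var vThreshold = l.length + 2)
    (hr : s.var vRounds = l.length * (l.length + 3) + 1) (ha : HasAuction s l) :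
    HasAuction (runAuction.run s) l ∧
      ∀ e < l.length, (runAuction.run s).arr kStatus (e + 1) ≠ 0 := by
  have key := run_upTo (x := vRound) (b := vRounds) (c := auctionRound) s
    (fun i s' => HasAuction s' l ∧ ((∀ e < l.length, s'.arr kStatus (e + 1) ≠ 0) ∨
      i ≤ IsAuction.potential l.length (s'.arr kPrice) (s'.arr kStatus))) (by decide) ?_ ?_
  · obtain ⟨k1, k2⟩ := key
    refine ⟨k1, k2.resolve_right fun k3 => ?_⟩
    -- The number of rounds exceeds the largest possible potential by one.
    have := IsAuction.potential_le k1
    have h1 : l.length * (l.length + 3) = l.length * (l.length + 2) + l.length := by ring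
    rw [hr] at k3
    have := k3.trans this
    omega
  · exact ⟨ha, .inr (Nat.zero_le _)⟩
  · rintro i s' hi hI hV hA ⟨k1, k2⟩
    have h' : Loaded X s' := h.frame (by decide) hV hA
    have hl' : HasEvents s' l := hl.frame (by decide) hV hA
    have ht' : s'.var vThreshold = l.length + 2 := by rw [hV _ (by decide), ht]
    obtain ⟨g1, g2⟩ := auctionRound_spec h' hl' hfe ht' k1
    simp only [State.setVar_arr]
    refine ⟨g1, ?_⟩
    rcases g2 with ⟨g2, _⟩ | ⟨⟨e, he, hst⟩, g3⟩
    · exact .inl g2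
    · right
      rcases k2 with k2 | k2
      · exact absurd hst (k2 e he)
      · omega

/-- Computes the bounds for prices and for the number of rounds of the auction. -/
def initAuction : Cmd :=
  .seq (.assign vThreshold (.add (.var vEvents) (.const 2)))
    (.seq (.assign vRounds (.const 1))
      (.upTo vF vEvents (.assign vRounds (.add (.var vRounds) (.add (.var vThreshold) (.const 1))))))

/-- The product `E * (E + 3)` is accumulated by repeated addition, as the machine does not multiply.
-/
theorem initAuction_spec {E : ℕ} (hE : s.var vEvents = E) :
    (initAuction.run s).var vThreshold = E + 2 ∧
      (initAuction.run s).var vRounds = E * (E + 3) + 1 := by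
  rw [initAuction, run_seq, run_seq]
  set s₁ := (Cmd.assign vRounds (.const 1)).run
    ((Cmd.assign vThreshold (.add (.var vEvents) (.const 2))).run s) with hs₁
  have t₁ : s₁.var vThreshold = E + 2 := by simp [hs₁, run, State.setVar_var, Expr.eval, hE]
  have E₁ : s₁.var vEvents = E := by simp [hs₁, run, State.setVar_var, hE]
  have key := run_upTo (x := vF) (b := vEvents)
    (c := .assign vRounds (.add (.var vRounds) (.add (.var vThreshold) (.const 1)))) s₁
    (fun i s' => s'.var vThreshold = E + 2 ∧ s'.var vRounds = i * (E + 3) + 1) (by decide) ?_ ?_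
  · rw [E₁] at key; exact key
  · simp [hs₁, run, State.setVar_var, Expr.eval, hE]
  · rintro i s' hi hI hV hA ⟨k1, k2⟩
    simp [run, State.setVar_var, Expr.eval, k1, k2]
    ring

/-! ### Reading an optimal matching off the finished auction -/

/-- Finds a positive number `vGap` below `vThreshold` that is not a price. -/
def findGap : Cmd :=
  .seq (.upTo vF vEvents (.write kMark (.read kPrice (.var vF)) (.const 1)))
    (.seq (.assign vGap (.const 0))
      (.upTo vLevel vThreshold
        (.ite (.and (.lt (.const 0) (.var vLevel)) (.not (.read kMark (.var vLevel))))
          (.assign vGap (.var vLevel)) .skip)))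

theorem findGap_spec {E : ℕ} (hE : s.var vEvents = E) (ht : s.var vThreshold = E + 2)
    (h0 : s.arr kMark = 0) :
    1 ≤ (findGap.run s).var vGap ∧ (findGap.run s).var vGap < E + 2 ∧
      ∀ f < E, s.arr kPrice f ≠ (findGap.run s).var vGap := by
  rw [findGap, run_seq, run_seq]
  have key := run_upTo (x := vF) (b := vEvents)
    (c := .write kMark (.read kPrice (.var vF)) (.const 1)) s
    (fun i s' => ∀ g, s'.arr kMark g ≠ 0 ↔ ∃ f < i, s.arr kPrice f = g) (by decide) ?_ ?_
  · rw [hE] at key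
    set s₁ := (Cmd.upTo vF vEvents (.write kMark (.read kPrice (.var vF)) (.const 1))).run s with hs₁
    have t₁ : s₁.var vThreshold = E + 2 := by rw [hs₁, run_var (by decide), ht]
    set s₂ := (Cmd.assign vGap (.const 0)).run s₁ with hs₂
    have key2 := run_upTo (x := vLevel) (b := vThreshold)
      (c := .ite (.and (.lt (.const 0) (.var vLevel)) (.not (.read kMark (.var vLevel))))
          (.assign vGap (.var vLevel)) .skip) s₂
      (fun i s' => s'.var vGap = 0 ∧ (∀ g < i, 1 ≤ g → s₁.arr kMark g ≠ 0) ∨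
        1 ≤ s'.var vGap ∧ s'.var vGap < E + 2 ∧ s₁.arr kMark (s'.var vGap) = 0) (by decide) ?_ ?_
    · rw [show s₂.var vThreshold = E + 2 by rw [hs₂, run_var (by decide), t₁]] at key2
      rcases key2 with ⟨_, k2⟩ | ⟨k1, k2, k3⟩
      -- If the scan found nothing, every candidate would be a price, which the pigeonhole principle
      -- excludes.
      · obtain ⟨g, hg1, hg2, hg3⟩ := IsAuction.exists_gap E (s.arr kPrice)
        obtain ⟨f, hf, hfg⟩ := (key g).1 (k2 g hg2 hg1)
        exact absurd hfg (hg3 f hf)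
      · refine ⟨k1, k2, fun f hf hfg => ?_⟩
        exact (key _).2 ⟨f, hf, hfg⟩ k3
    · left
      exact ⟨by simp [hs₂, run, State.setVar_var, Expr.eval], fun g hg => absurd hg (by omega)⟩
    · rintro i s' hi hI hV hA hk
      rw [show s₂.var vThreshold = E + 2 by rw [hs₂, run_var (by decide), t₁]] at hi
      have hm : s'.arr kMark = s₁.arr kMark := by rw [hA _ (by decide)]; rfl
      have hcond : (Expr.and (.lt (.const 0) (.var vLevel))
          (.not (.read kMark (.var vLevel)))).Holds s' ↔ 0 < i ∧ s₁.arr kMark i = 0 := by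
        rw [holds_and, holds_lt, holds_not, Expr.Holds, not_not]
        simp only [Expr.eval, hI, hm]
      by_cases hc : 0 < i ∧ s₁.arr kMark i = 0
      · rw [run_ite_of (hcond.2 hc), run_assign]
        right
        simp only [State.setVar_var, Expr.eval, hI, Nat.reduceEqDiff, if_true, if_false]
        exact ⟨hc.1, hi, hc.2⟩
      · rw [run_ite_of_not fun h' => hc (hcond.1 h'), run]
        simp only [State.setVar_var, Nat.reduceEqDiff, if_false]
        refine hk.imp (fun k => ⟨k.1, fun g hg h1 => ?_⟩) id
        rcases (Nat.lt_succ_iff.1 hg).lt_or_eq with h5 | rfl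
        · exact k.2 g h5 h1
        · exact fun h2 => hc ⟨h1, h2⟩
  · intro g; simp [State.setVar_arr, h0]
  · intro i s' hi hI hV hA hk g
    have hp : s'.arr kPrice i = s.arr kPrice i := by rw [hA _ (by decide)]
    simp only [run, State.setVar_arr, State.setArr_arr, if_true, Expr.eval, hI, hp,
      Function.update_apply]
    by_cases hg : g = s.arr kPrice i
    · rw [if_pos hg]
      simp only [ne_eq, one_ne_zero, not_false_eq_true, true_iff]
      exact ⟨i, Nat.lt_succ_self i, hg.symm⟩
    · rw [if_neg hg, hk g]
      constructor
      · rintro ⟨f, hf, h1⟩; exact ⟨f, by omega, h1⟩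
      · rintro ⟨f, hf, h1⟩
        rcases (Nat.lt_succ_iff.1 hf).lt_or_eq with h5 | rfl
        · exact ⟨f, h5, h1⟩
        · exact absurd h1.symm hg

/-- The lower bound for positions that is stored in the memory. -/
def floorVec (X : SiblingInstance) (s : State) : Fin X.n → ℕ := fun a => s.arr kFloor a

/-- Collects the lower bounds of the events all of whose conflicts have prices above `vGap`. -/
def collectFloors : Cmd :=
  .upTo vEvent vEvents (.seq minPrice (.ite (.lt (.var vGap) (.var vBest))
    (.seq (.write kFloor (.read kWorse (.var vEvent))
        (.max (.read kFloor (.read kWorse (.var vEvent))) (.read kWorsePos (.var vEvent))))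
      (.write kFloor (.read kBetter (.var vEvent))
        (.max (.read kFloor (.read kBetter (.var vEvent))) (.read kBetterPos (.var vEvent)))))
    .skip))

/-- Quantifying over all upper bounds `q` says that the collected vector is the supremum of the
selected floors; starting from zero handles the empty selection. -/
theorem collectFloors_spec (h : Loaded X s) {l : List X.Event} (hl : HasEvents s l)
    (hfe : ∀ e ∈ l, e.Feasible) (hg : s.var vGap < s.var vThreshold) (h0 : s.arr kFloor = 0)
    (q : Fin X.n → ℕ) :
    floorVec X (collectFloors.run s) ≤ q ↔ ∀ e (he : e < l.length),
      (∀ f < l.length, Conflict l e f → s.var vGap < s.arr kPrice f) → l[e].floor ≤ q := by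
  have key := run_upTo (x := vEvent) (b := vEvents)
    (c := (.seq minPrice (.ite (.lt (.var vGap) (.var vBest))
    (.seq (.write kFloor (.read kWorse (.var vEvent))
        (.max (.read kFloor (.read kWorse (.var vEvent))) (.read kWorsePos (.var vEvent))))
      (.write kFloor (.read kBetter (.var vEvent))
        (.max (.read kFloor (.read kBetter (.var vEvent))) (.read kBetterPos (.var vEvent)))))
    .skip))) s
    (fun i s' => floorVec X s' ≤ q ↔ ∀ e (he : e < l.length), e < i →
      (∀ f < l.length, Conflict l e f → s.var vGap < s.arr kPrice f) → l[e].floor ≤ q)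
    (by decide) ?_ ?_
  · rw [hl.length] at key
    exact key.trans ⟨fun k e he => k e he he, fun k e he _ => k e he⟩
  · refine ⟨fun _ e _ he => absurd he (by omega), fun _ a => ?_⟩
    simp [floorVec, State.setVar_arr, h0]
  · intro i s' hi hI hV hA hk
    rw [hl.length] at hi
    have h' : Loaded X s' := h.frame (by decide) hV hA
    have hl' : HasEvents s' l := hl.frame (by decide) hV hA
    have t' : s'.var vThreshold = s.var vThreshold := hV _ (by decide)
    have p' : s'.arr kPrice = s.arr kPrice := hA _ (by decide)
    obtain ⟨k1, k2, k3⟩ := minPrice_spec h' hl' hfe hi hI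
    rw [run_seq]
    rw [t', p'] at k3
    rw [t'] at k1
    rw [p'] at k2
    set s₁ := minPrice.run s' with hs₁
    have hl₁ := (hl'.run minPrice (by decide)).get i hi
    rw [← hs₁] at hl₁
    have g₁ : s₁.var vGap = s.var vGap := by rw [hs₁, run_var (by decide), hV _ (by decide)]
    have i₁ : s₁.var vEvent = i := by rw [hs₁, run_var (by decide), hI]
    have f₁ : s₁.arr kFloor = s'.arr kFloor := by rw [hs₁, run_arr (by decide)]
    have hcond : (Expr.lt (.var vGap) (.var vBest)).Holds s₁ ↔
        ∀ f < l.length, Conflict l i f → s.var vGap < s.arr kPrice f := by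
      rw [holds_lt]
      simp only [Expr.eval]
      rw [g₁]
      constructor
      · intro h1 f hf hc; exact h1.trans_le (k2 f hf hc)
      · intro h1
        -- Either `vBest` is the price of an actual conflict, or it equals the threshold, which lies
        -- above the gap.
        by_cases h2 : s₁.var vBest < s.var vThreshold
        · obtain ⟨j1, j2, j3⟩ := k3 h2
          rw [← j3]; exact h1 _ j1 j2
        · omega
    have hgoal : (∀ e (he : e < l.length), e < i + 1 →
        (∀ f < l.length, Conflict l e f → s.var vGap < s.arr kPrice f) → l[e].floor ≤ q) ↔
        floorVec X s' ≤ q ∧ ((∀ f < l.length, Conflict l i f → s.var vGap < s.arr kPrice f) →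
          l[i].floor ≤ q) := by
      rw [hk]
      constructor
      · intro k; exact ⟨fun e he hei => k e he (by omega), k i hi (by omega)⟩
      · rintro ⟨j1, j2⟩ e he hei
        rcases (Nat.lt_succ_iff.1 hei).lt_or_eq with h5 | rfl
        · exact j1 e he h5
        · exact j2
    rw [hgoal]
    have hne := SiblingInstance.Event.ne_of_rank_lt (hfe _ (List.getElem_mem hi)).rank_lt
    by_cases hc : ∀ f < l.length, Conflict l i f → s.var vGap < s.arr kPrice f
    · rw [run_ite_of (hcond.2 hc), run_seq]
      set s₂ := (Cmd.write kFloor (.read kWorse (.var vEvent))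
        (.max (.read kFloor (.read kWorse (.var vEvent))) (.read kWorsePos (.var vEvent)))).run s₁
        with hs₂
      have a₂ : s₂.arr kFloor = Function.update (s'.arr kFloor) l[i].worse
          (max (s'.arr kFloor l[i].worse) l[i].worsePos) := by
        rw [hs₂, run_write, State.setArr_arr, if_pos rfl, eval_max, f₁]
        simp only [Expr.eval, i₁, hl₁.worse, hl₁.worsePos, f₁]
      have hl₂ : EventAt s₂ i l[i] := hl₁.run _ (by decide)
      have i₂ : s₂.var vEvent = i := i₁
      set s₃ := (Cmd.write kFloor (.read kBetter (.var vEvent))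
        (.max (.read kFloor (.read kBetter (.var vEvent))) (.read kBetterPos (.var vEvent)))).run s₂
        with hs₃
      have hne' : (l[i].better : ℕ) ≠ l[i].worse := fun h1 => hne (Fin.ext h1.symm)
      have a₃ : s₃.arr kFloor = Function.update (Function.update (s'.arr kFloor) l[i].worse
          (max (s'.arr kFloor l[i].worse) l[i].worsePos)) l[i].better
          (max (s'.arr kFloor l[i].better) l[i].betterPos) := by
        rw [hs₃, run_write, State.setArr_arr, if_pos rfl, eval_max, a₂]
        simp only [Expr.eval, i₂, hl₂.better, hl₂.betterPos, a₂, Function.update_of_ne hne']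
      -- The two writes touch distinct students, so they do not interfere, and every other
      -- coordinate of the floor is zero.
      have hsup : floorVec X (s₃.setVar vEvent (i + 1)) = floorVec X s' ⊔ l[i].floor := by
        funext a
        simp only [floorVec, State.setVar_arr, a₃, Pi.sup_apply, SiblingInstance.Event.floor]
        by_cases h1 : a = l[i].better
        · subst h1; simp
        · have h1' : (a : ℕ) ≠ l[i].better := fun h2 => h1 (Fin.ext h2)
          rw [Function.update_of_ne h1', Function.update_of_ne h1]
          by_cases h2 : a = l[i].worse
          · subst h2; simp
          · have h2' : (a : ℕ) ≠ l[i].worse := fun h3 => h2 (Fin.ext h3)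
            rw [Function.update_of_ne h2', Function.update_of_ne h2]
            simp
      rw [hsup, sup_le_iff]
      exact ⟨fun k => ⟨k.1, fun _ => k.2⟩, fun k => ⟨k.1, k.2 hc⟩⟩
    · rw [run_ite_of_not fun h' => hc (hcond.1 h'), run]
      have : floorVec X (s₁.setVar vEvent (i + 1)) = floorVec X s' :=
        funext fun a => congrFun f₁ a
      rw [this]
      exact ⟨fun k => ⟨k, fun h' => absurd h' hc⟩, fun k => k.1⟩

/-- Computes the least settled position vector above the collected lower bounds. -/
def raiseFloors : Cmd :=
  .seq (.upTo vCopy vStudents (.write kVec (.var vCopy) (.read kFloor (.var vCopy)))) raise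

theorem raiseFloors_spec (h : Loaded X s) (hm : ∀ a, floorVec X s a ≤ X.m) :
    X.inst.IsRaised (floorVec X s) (vec X (raiseFloors.run s)) := by
  rw [raiseFloors, run_seq]
  set c₀ : Cmd := .upTo vCopy vStudents (.write kVec (.var vCopy) (.read kFloor (.var vCopy)))
    with hc₀
  set s₁ := c₀.run s with hs₁
  have key := run_upTo (x := vCopy) (b := vStudents)
    (c := .write kVec (.var vCopy) (.read kFloor (.var vCopy))) s
    (fun i s' => ∀ a : Fin X.n, a.val < i → s'.arr kVec a = s.arr kFloor a) (by decide) ?_ ?_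
  · have hv : vec X s₁ = floorVec X s := funext fun a => key a (by rw [h.students]; exact a.isLt)
    have := raise_spec (h.run c₀ (by decide)) (by rw [← hs₁, hv]; exact hm)
    rw [← hs₁, hv] at this
    exact this.1
  · intro a ha; omega
  · intro i s' hi hI hV hA hk a ha
    simp only [run, State.setVar_arr, State.setArr_arr, if_true, Expr.eval, hI,
      Function.update_apply]
    split_ifs with h1
    · rw [hA _ (by decide), h1]
    · exact hk a (by omega)

/-- Computes the positions of an optimal stable matching. -/
def optimize : Cmd :=
  .seq initAuction (.seq runAuction (.seq findGap (.seq collectFloors raiseFloors)))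

/-- The gap selects an independent set of lower and upper bounds. The least stable vector above the
selected lower bounds also respects the selected upper bounds, so optimality of the independent set
transfers to it. -/
theorem optimize_spec (h : Loaded X s) {l : List X.Event} (hl : HasEvents s l)
    (hfe : ∀ e ∈ l, e.Feasible) (h0 : ∀ k, 11 ≤ k → s.arr k = 0) :
    X.inst.IsStablePos (vec X (optimize.run s)) ∧ ∀ q, X.inst.IsStablePos q →
      l.countP (fun e => e.Together q) ≤ l.countP fun e => e.Together (vec X (optimize.run s)) := by
  rw [optimize, run_seq, run_seq, run_seq, run_seq]
  obtain ⟨t₁, r₁⟩ := initAuction_spec hl.length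
  set s₁ := initAuction.run s with hs₁
  have h₁ : Loaded X s₁ := h.run _ (by decide)
  have hl₁ : HasEvents s₁ l := hl.frame (V := initAuction.vars.filter (· ≠ vEvents))
    (A := initAuction.arrs) (by decide) (fun y hy => by
      by_cases hy' : y = vEvents
      · subst hy'; rw [hs₁, run_var (by decide)]
      · rw [hs₁, run_var (fun h' => hy (List.mem_filter.2 ⟨h', by simpa using hy'⟩))])
      fun k hk => run_arr hk s
  have z₁ : ∀ k, 11 ≤ k → s₁.arr k = 0 := fun k hk => by
    rw [hs₁, run_arr (by simp [initAuction, arrs]), h0 k hk]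
  have ha₁ : HasAuction s₁ l := IsAuction.init _ _ (z₁ _ (by decide)) (z₁ _ (by decide))
    (z₁ _ (by decide))
  obtain ⟨ha₂, hd₂⟩ := runAuction_spec h₁ hl₁ hfe t₁ r₁ ha₁
  set s₂ := runAuction.run s₁ with hs₂
  have h₂ : Loaded X s₂ := h₁.run _ (by decide)
  have hl₂ : HasEvents s₂ l := hl₁.run _ (by decide)
  have t₂ : s₂.var vThreshold = l.length + 2 := by rw [hs₂, run_var (by decide), t₁]
  obtain ⟨g1, g2, g3⟩ := findGap_spec hl₂.length t₂ (by
    rw [hs₂, run_arr (by decide), z₁ _ (by decide)])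
  set s₃ := findGap.run s₂ with hs₃
  have h₃ : Loaded X s₃ := h₂.run _ (by decide)
  have hl₃ : HasEvents s₃ l := hl₂.run _ (by decide)
  have t₃ : s₃.var vThreshold = l.length + 2 := by rw [hs₃, run_var (by decide), t₂]
  have p₃ : s₃.arr kPrice = s₂.arr kPrice := by rw [hs₃, run_arr (by decide)]
  have hc := collectFloors_spec h₃ hl₃ hfe (by rw [t₃]; exact g2) (by
    rw [hs₃, run_arr (by decide), hs₂, run_arr (by decide), z₁ _ (by decide)])
  rw [p₃] at hc
  set g := s₃.var vGap
  set s₄ := collectFloors.run s₃ with hs₄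
  have h₄ : Loaded X s₄ := h₃.run _ (by decide)
  -- All floors lie below the constant vector `m`, hence so does their supremum.
  have hr := raiseFloors_spec h₄ fun a => (hc fun _ => X.m).2
    (fun e he _ b => SiblingInstance.Event.floor_le_m b) a
  set q := vec X (raiseFloors.run s₄)
  have hfloor : ∀ e (he : e < l.length), ∃ p, X.inst.IsStablePos p ∧ l[e].Together p ∧
      l[e].floor ≤ p := by
    intro e he
    obtain ⟨hrk, p, hp, hpt⟩ := hfe _ (List.getElem_mem he)
    exact ⟨p, hp, hpt, hpt.floor_le (SiblingInstance.Event.ne_of_rank_lt hrk)⟩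
  classical
  -- Used twice: with all stable vectors, to see that `q` is stable, and with those respecting one
  -- selected upper bound, to see that `q` respects it.
  have hle : ∀ S : Set (Fin X.n → ℕ), SupClosed S → S.Nonempty → (∀ p ∈ S, X.inst.IsStablePos p) →
      (∀ e (he : e < l.length), (∀ f < l.length, Conflict l e f → g < s₂.arr kPrice f) →
        ∃ p ∈ S, l[e].floor ≤ p) → ∃ p ∈ S, floorVec X s₄ ≤ p ∧ q ≤ p := by
    intro S hS hne hst hex
    obtain ⟨p, hp, hpl⟩ := hS.exists_forall_le hne
      (Finset.univ.filter fun e : Fin l.length =>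
        ∀ f < l.length, Conflict l e f → g < s₂.arr kPrice f) (fun e => l[e].floor)
      (fun e he => hex e e.isLt (Finset.mem_filter.1 he).2)
    have h1 : floorVec X s₄ ≤ p := (hc p).2 fun e he hcf => hpl ⟨e, he⟩ (by simpa using hcf)
    exact ⟨p, hp, h1, hr.le_of_le p (hst p hp) h1⟩
  obtain ⟨p, hp, hfp, -⟩ := hle _ (SchoolInstance.IsStablePos.supClosed X.inst)
    X.inst.exists_isStablePos (fun p hp => hp) fun e he _ => by
      obtain ⟨p, hp, _, hpf⟩ := hfloor e he; exact ⟨p, hp, hpf⟩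
  have hq : X.inst.IsStablePos q := hr.isStablePos hp hfp
  refine ⟨hq, fun q' hq' => countP_together_le hfe ha₂ hd₂ g1 g2 g3 hq hq' ((hc q).1 hr.le) ?_⟩
  intro f hf hpf
  obtain ⟨r, hr1, hr2, hr3⟩ := hfloor f hf
  obtain ⟨p', hp', _, hqp⟩ := hle {p | X.inst.IsStablePos p ∧ p l[f].worse ≤ l[f].worsePos}
    (fun p hp p' hp' => ⟨hp.1.sup hp'.1, sup_le hp.2 hp'.2⟩) ⟨r, hr1, hr2.2.le⟩
    (fun p hp => hp.1) fun e he hcf => by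
      -- All conflicts of `e` are priced above the gap while `f` is priced below it, so some stable
      -- vector satisfies both bounds.
      have : ¬ Conflict l e f := fun h' => absurd (hcf f hf h') hpf.not_gt
      simp only [Conflict, not_exists, not_forall, not_lt] at this
      obtain ⟨p, hp1, hp2, hp3⟩ := this he hf
      exact ⟨p, ⟨hp1, hp3⟩, hp2⟩
  exact (hqp _).trans hp'.2

/-! ### The program: reading the input -/

/-- Inverts `vPtr`-based permutations: the table `k` stores the positions of the entries of the
next `c` blocks of length `w` of the input, the table `r` the beginnings of these blocks. -/
def invertBlocks (k r w c : ℕ) : Cmd :=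
  .upTo vA c (.seq (.write r (.var vA) (.var vPtr))
    (.seq (.upTo vI w (.write k (.add (.var vPtr) (.read kInput (.add (.var vPtr) (.var vI))))
        (.var vI)))
      (.assign vPtr (.add (.var vPtr) (.var w)))))

/-- Each block is a permutation of `0, …, W - 1`: injectivity prevents entries of one block from
overwriting each other, and the range condition keeps blocks disjoint. -/
theorem invertBlocks_spec {k r w c p W C : ℕ} (hk : k ≠ 0) (hr : r ≠ 0) (hkr : k ≠ r)
    (hw : w ∉ [vA, vI, vPtr]) (hsw : s.var w = W) (hsc : s.var c = C)
    (hp : s.var vPtr = p)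
    (hlt : ∀ a < C, ∀ i < W, s.arr kInput (p + a * W + i) < W)
    (hinj : ∀ a < C, ∀ i < W, ∀ j < W, s.arr kInput (p + a * W + i) = s.arr kInput (p + a * W + j) →
      i = j) :
    ((invertBlocks k r w c).run s).var vPtr = p + C * W ∧
      (∀ a < C, ((invertBlocks k r w c).run s).arr r a = p + a * W) ∧
      ∀ a < C, ∀ i < W, ((invertBlocks k r w c).run s).arr k
        (p + a * W + s.arr kInput (p + a * W + i)) = i := by
  have key := run_upTo (x := vA) (b := c) (c := .seq (.write r (.var vA) (.var vPtr))
    (.seq (.upTo vI w (.write k (.add (.var vPtr) (.read kInput (.add (.var vPtr) (.var vI))))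
        (.var vI)))
      (.assign vPtr (.add (.var vPtr) (.var w))))) s
    (fun a s' => s'.var vPtr = p + a * W ∧ (∀ a' < a, s'.arr r a' = p + a' * W) ∧
      ∀ a' < a, ∀ i < W, s'.arr k (p + a' * W + s.arr kInput (p + a' * W + i)) = i)
    (by simp [vars]) ?_ ?_
  · rw [hsc] at key; exact key
  · simp [State.setVar_var, hp]
  · rintro a s' ha hA hV hR ⟨k1, k2, k3⟩
    rw [hsc] at ha
    have hin : s'.arr kInput = s.arr kInput := hR _ (by simp [arrs, hk.symm, hr.symm])
    have hw' : s'.var w = W := by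
      rw [hV _ (by simpa [vars] using hw), hsw]
    rw [run_seq, run_seq]
    set s₁ := (Cmd.write r (.var vA) (.var vPtr)).run s' with hs₁
    have v₁ : s₁.var = s'.var := rfl
    have r₁ : s₁.arr r = Function.update (s'.arr r) a (p + a * W) := by
      rw [hs₁, run_write, State.setArr_arr, if_pos rfl]
      simp only [Expr.eval, hA, k1]
    have k₁ : s₁.arr k = s'.arr k := run_arr (by simpa [arrs] using hkr) s'
    have in₁ : s₁.arr kInput = s.arr kInput := by
      rw [hs₁, run_arr (by simpa [arrs] using hr.symm), hin]
    -- The first half of the invariant protects the cells of earlier blocks, which all lie below `p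
    -- + a * W`.
    have key2 := run_upTo (x := vI) (b := w)
      (c := .write k (.add (.var vPtr) (.read kInput (.add (.var vPtr) (.var vI)))) (.var vI)) s₁
      (fun j s'' => (∀ x < p + a * W, s''.arr k x = s'.arr k x) ∧
        ∀ i < j, s''.arr k (p + a * W + s.arr kInput (p + a * W + i)) = i)
      (by simp [vars]) ?_ ?_
    · rw [v₁, hw'] at key2
      set s₂ := (Cmd.upTo vI w (.write k (.add (.var vPtr)
        (.read kInput (.add (.var vPtr) (.var vI)))) (.var vI))).run s₁ with hs₂
      obtain ⟨g1, g2⟩ := key2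
      have p₂ : s₂.var vPtr = p + a * W := by rw [hs₂, run_var (by simp [vars]), v₁, k1]
      have w₂ : s₂.var w = W := by
        simp only [List.mem_cons, not_or] at hw
        rw [hs₂, run_var (by simpa [vars] using hw.2.1), v₁, hw']
      have r₂ : s₂.arr r = s₁.arr r := run_arr (by simpa [arrs] using hkr.symm) s₁
      simp only [run_assign, State.setVar_arr]
      refine ⟨?_, fun a' ha' => ?_, fun a' ha' i hi => ?_⟩
      · rw [State.setVar_var, if_neg (by decide), State.setVar_var, if_pos rfl]
        simp only [Expr.eval, p₂, w₂]
        ring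
      · rw [r₂, r₁]
        rcases (Nat.lt_succ_iff.1 ha').lt_or_eq with h5 | rfl
        · rw [Function.update_of_ne h5.ne, k2 a' h5]
        · rw [Function.update_self]
      · rcases (Nat.lt_succ_iff.1 ha').lt_or_eq with h5 | rfl
        · rw [g1, k3 a' h5 i hi]
          have h6 := hlt a' (h5.trans ha) i hi
          have h7 := Nat.mul_le_mul_right W (Nat.succ_le_of_lt h5)
          rw [Nat.succ_mul] at h7
          omega
        · exact g2 i hi
    · simp only [State.setVar_arr, k₁]
      exact ⟨fun _ _ => trivial, fun i hi => absurd hi (by omega)⟩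
    · rintro j s'' hj hJ hV' hR' ⟨g1, g2⟩
      rw [v₁, hw'] at hj
      have p'' : s''.var vPtr = p + a * W := by rw [hV' _ (by simp [vars]), v₁, k1]
      have in'' : s''.arr kInput = s.arr kInput := by
        rw [hR' _ (by simpa [arrs] using hk.symm), in₁]
      have e : ∀ v, (((Cmd.write k (.add (.var vPtr) (.read kInput (.add (.var vPtr) (.var vI))))
          (.var vI)).run s'').setVar vI v).arr k =
          Function.update (s''.arr k) (p + a * W + s.arr kInput (p + a * W + j)) j := by
        intro v
        rw [State.setVar_arr, run_write, State.setArr_arr, if_pos rfl]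
        simp only [Expr.eval, p'', in'', hJ]
      rw [e]
      refine ⟨fun x hx => ?_, fun i hi => ?_⟩
      · rw [Function.update_of_ne (by omega), g1 x hx]
      · rcases (Nat.lt_succ_iff.1 hi).lt_or_eq with h5 | rfl
        · rw [Function.update_of_ne, g2 i h5]
          intro h6
          have := hinj a ha i (by omega) j hj (by omega)
          omega
        · rw [Function.update_self]

/-- Reads the sizes of the instance. -/
def readSizes : Cmd :=
  .seq (.assign vStudents (.read kInput (.const 0)))
    (.seq (.assign vSchools (.read kInput (.const 1)))
      (.seq (.assign vPairs (.read kInput (.const 2)))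
        (.seq (.assign vSchoolsSucc (.add (.var vSchools) (.const 1)))
          (.seq (.assign vStudentsSucc (.add (.var vStudents) (.const 1)))
            (.assign vPtr (.add (.const 3) (.var vSchools)))))))

/-- Computes the tables of positions and ranks. -/
def readTables : Cmd :=
  .seq (invertBlocks kPos kPosRow vSchoolsSucc vStudents)
    (.seq (invertBlocks kRank kRankRow vStudentsSucc vSchools)
      (.assign vBase (.var vPtr)))

theorem readSizes_spec (X : SiblingInstance) :
    let s := readSizes.run (init X.encode)
    s.var vLen = X.encode.length ∧ s.var vStudents = X.n ∧ s.var vSchools = X.m ∧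
      s.var vPairs = X.siblings.length ∧ s.var vSchoolsSucc = X.m + 1 ∧
      s.var vStudentsSucc = X.n + 1 ∧ s.var vPtr = 3 + X.m := by
  have h0 : X.encode.getD 0 0 = X.n := rfl
  have h1 : X.encode.getD 1 0 = X.m := rfl
  have h2 : X.encode.getD 2 0 = X.siblings.length := rfl
  simp [readSizes, run, State.setVar_var, State.setVar_arr, Expr.eval, init, -List.getD_eq_getElem?_getD, h0, h1, h2]

theorem readTables_spec (X : SiblingInstance) :
    Loaded X (readTables.run (readSizes.run (init X.encode))) := by
  obtain ⟨z1, z2, z3, z4, z5, z6, z7⟩ := readSizes_spec X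
  set s := readSizes.run (init X.encode) with hs
  have hin : ∀ i, s.arr kInput i = X.encode.getD i 0 := by
    intro i
    rw [hs, run_arr (by decide)]; rfl
  rw [readTables, run_seq, run_seq]
  have hst : ∀ (a : ℕ) (ha : a < X.n) (i : ℕ) (hi : i < X.m + 1),
      s.arr kInput (3 + X.m + a * (X.m + 1) + i) = code (X.inst.studentPref ⟨a, ha⟩ ⟨i, hi⟩) :=
    fun a ha i hi => (hin _).trans (X.encode_studentPref ⟨a, ha⟩ ⟨i, hi⟩)
  have hsc : ∀ (b : ℕ) (hb : b < X.m) (i : ℕ) (hi : i < X.n + 1),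
      s.arr kInput (3 + X.m + X.n * (X.m + 1) + b * (X.n + 1) + i) =
        code (X.inst.schoolPref ⟨b, hb⟩ ⟨i, hi⟩) :=
    fun b hb i hi => (hin _).trans (X.encode_schoolPref ⟨b, hb⟩ ⟨i, hi⟩)
  obtain ⟨g1, g2, g3⟩ := invertBlocks_spec (k := kPos) (r := kPosRow) (w := vSchoolsSucc)
    (c := vStudents) (by decide) (by decide) (by decide) (by decide) z5 z2 z7
    (fun a ha i hi => by rw [hst a ha i hi]; exact code_lt _)
    (fun a ha i hi j hj h => by
      rw [hst a ha i hi, hst a ha j hj] at h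
      exact Fin.ext_iff.1 ((X.inst.studentPref _).injective (code_injective h)))
  set s₁ := (invertBlocks kPos kPosRow vSchoolsSucc vStudents).run s with hs₁
  have in₁ : s₁.arr kInput = s.arr kInput := run_arr (by decide) s
  have v₁ : ∀ y, y ∉ [vA, vI, vPtr] → s₁.var y = s.var y := fun y hy => run_var (by
    simpa [invertBlocks, vars] using hy) s
  obtain ⟨j1, j2, j3⟩ := invertBlocks_spec (s := s₁) (k := kRank) (r := kRankRow)
    (w := vStudentsSucc) (c := vSchools) (by decide) (by decide) (by decide) (by decide)
    ((v₁ _ (by decide)).trans z6) ((v₁ _ (by decide)).trans z3) g1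
    (fun a ha i hi => by rw [in₁, hsc a ha i hi]; exact code_lt _)
    (fun a ha i hi j hj h => by
      rw [in₁, hsc a ha i hi, hsc a ha j hj] at h
      exact Fin.ext_iff.1 ((X.inst.schoolPref _).injective (code_injective h)))
  rw [in₁] at j3
  set s₂ := (invertBlocks kRank kRankRow vStudentsSucc vSchools).run s₁ with hs₂
  have in₂ : s₂.arr kInput = s.arr kInput := (run_arr (by decide) s₁).trans in₁
  have p₂ : s₂.arr kPos = s₁.arr kPos := run_arr (by decide) s₁
  have pr₂ : s₂.arr kPosRow = s₁.arr kPosRow := run_arr (by decide) s₁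
  have v₂ : ∀ y, y ∉ [vA, vI, vPtr] → s₂.var y = s.var y := fun y hy => (run_var (by
    simpa [invertBlocks, vars] using hy) s₁).trans (v₁ y hy)
  rw [run_assign]
  have v₃ : ∀ y, y ∉ [vA, vI, vPtr, vBase] →
      (s₂.setVar vBase ((Expr.var vPtr).eval s₂)).var y = s.var y := fun y hy => by
    simp only [List.mem_cons, not_or] at hy
    rw [State.setVar_var, if_neg hy.2.2.2.1]
    exact v₂ y (by simp only [List.mem_cons, not_or]; tauto)
  have b₃ : (s₂.setVar vBase ((Expr.var vPtr).eval s₂)).var vBase =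
      3 + X.m + X.n * (X.m + 1) + X.m * (X.n + 1) := by
    rw [State.setVar_var, if_pos rfl, Expr.eval, j1]
  refine ⟨(v₃ _ (by decide)).trans z1, (v₃ _ (by decide)).trans z2, (v₃ _ (by decide)).trans z3,
    (v₃ _ (by decide)).trans z4, (v₃ _ (by decide)).trans z5, (v₃ _ (by decide)).trans z6,
    fun a x => ?_, fun b x => ?_, fun b => ?_, fun a i => ?_, fun k hk => ?_⟩
  · rw [State.setVar_arr, p₂, pr₂, g2 a a.isLt]
    have h1 := g3 a a.isLt _ ((X.inst.studentPref a).symm x).isLt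
    rwa [hst a a.isLt _ ((X.inst.studentPref a).symm x).isLt, Fin.eta, Fin.eta,
      Equiv.apply_symm_apply] at h1
  · rw [State.setVar_arr, j2 b b.isLt]
    have h1 := j3 b b.isLt _ ((X.inst.schoolPref b).symm x).isLt
    rwa [hsc b b.isLt _ ((X.inst.schoolPref b).symm x).isLt, Fin.eta, Fin.eta,
      Equiv.apply_symm_apply] at h1
  · rw [State.setVar_arr, in₂, hin, X.encode_quota]
  · rw [State.setVar_arr, in₂, pr₂, g2 a a.isLt, hin, X.encode_studentPref]
  · rw [b₃, State.setVar_arr, in₂, hin, hin, ← mul_two, add_assoc _ (k * 2) 1]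
    have e1 := X.encode_siblings k hk 0 (by decide)
    have e2 := X.encode_siblings k hk 1 (by decide)
    exact ⟨e1, e2⟩

/-! ### The program: writing the output -/

theorem Loaded.eval_prefE (h : Loaded X s) {ea ei : Expr} {a : Fin X.n} {q : Fin X.n → ℕ}
    (ha : ea.eval s = a) (hi : ei.eval s = q a) (hq : q a ≤ X.m) :
    (prefE ea ei).eval s = code (X.inst.matchingOf q a) := by
  have hlt : q a < X.m + 1 := by omega
  have := h.pref a ⟨q a, hlt⟩
  rw [prefE, Expr.eval, Expr.eval, Expr.eval, ha, hi]
  rw [SchoolInstance.matchingOf, dif_pos hlt]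
  exact this

/-- Writes the matching to the output, beginning at index `d`. -/
def writeMatching (d : ℕ) : Cmd :=
  .upTo vCopy vStudents (.write kOut (.add (.var vCopy) (.const d))
    (prefE (.var vCopy) (.read kVec (.var vCopy))))

theorem writeMatching_spec (h : Loaded X s) (hq : ∀ a, vec X s a ≤ X.m) (d : ℕ) :
    (∀ a : Fin X.n, ((writeMatching d).run s).arr kOut (a + d) =
      code (X.inst.matchingOf (vec X s) a)) ∧
      ∀ i < d, ((writeMatching d).run s).arr kOut i = s.arr kOut i := by
  have key := run_upTo (x := vCopy) (b := vStudents)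
    (c := .write kOut (.add (.var vCopy) (.const d))
      (prefE (.var vCopy) (.read kVec (.var vCopy)))) s
    (fun i s' => (∀ a : Fin X.n, a.val < i → s'.arr kOut (a + d) =
      code (X.inst.matchingOf (vec X s) a)) ∧ ∀ i < d, s'.arr kOut i = s.arr kOut i)
    (by simp [vars]) ?_ ?_
  · exact ⟨fun a => key.1 a (by rw [h.students]; exact a.isLt), key.2⟩
  · exact ⟨fun a ha => absurd ha (by omega), fun _ _ => rfl⟩
  · rintro i s' hi hI hV hA ⟨k1, k2⟩
    rw [h.students] at hi
    have h' : Loaded X s' := h.frame (V := [vCopy]) (A := [kOut]) (by decide)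
      (fun y hy => hV y (by simpa [vars] using hy)) fun k hk => hA k (by simpa [arrs] using hk)
    have hv' : s'.arr kVec = s.arr kVec := hA _ (by simp [arrs])
    have e := h'.eval_prefE (ea := .var vCopy) (ei := .read kVec (.var vCopy)) (a := ⟨i, hi⟩)
      (q := vec X s) hI (by simp only [Expr.eval, hI, hv', vec]) (hq _)
    rw [State.setVar_arr, run_write, e, State.setArr_arr, if_pos rfl]
    simp only [Expr.eval, hI]
    refine ⟨fun a ha => ?_, fun j hj => ?_⟩
    · rcases (Nat.lt_succ_iff.1 ha).lt_or_eq with h5 | h5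
      · rw [Function.update_of_ne (by omega), k1 a h5]
      · obtain rfl : a = ⟨i, hi⟩ := Fin.ext h5
        rw [Function.update_self]
    · rw [Function.update_of_ne (by omega), k2 j hj]

/-- Outputs the matching. -/
def outputMatching : Cmd := .seq (writeMatching 0) (.assign vOut (.var vStudents))

theorem outputMatching_spec (h : Loaded X s) (hq : ∀ a, vec X s a ≤ X.m) :
    output (outputMatching.run s) = X.encodeMatching (X.inst.matchingOf (vec X s)) := by
  obtain ⟨k1, -⟩ := writeMatching_spec h hq 0
  rw [outputMatching, run_seq]
  set s₁ := (writeMatching 0).run s with hs₁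
  have n₁ : s₁.var vStudents = X.n := by rw [hs₁, run_var (by decide), h.students]
  have hv : ((Cmd.assign vOut (.var vStudents)).run s₁).var 1 = X.n := by
    rw [run_assign, State.setVar_var, if_pos rfl, Expr.eval, n₁]
  rw [output, hv, SiblingInstance.encodeMatching]
  refine List.ext_getElem (by simp) fun i h1 h2 => ?_
  have hi : i < X.n := by simpa using h1
  have := k1 ⟨i, hi⟩
  simp only [add_zero] at this
  simpa [run_assign, State.setVar_arr] using this

/-- Tests whether all sibling pairs are together. -/
def testTogether : Cmd :=
  .seq (.assign vOk (.const 1))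
    (.upTo vPair vPairs (.ite
      (.and (prefE fstE (.read kVec fstE))
        (.and (.le (prefE fstE (.read kVec fstE)) (prefE sndE (.read kVec sndE)))
          (.le (prefE sndE (.read kVec sndE)) (prefE fstE (.read kVec fstE)))))
      .skip (.assign vOk (.const 0))))

theorem testTogether_spec (h : Loaded X s) (hq : ∀ a, vec X s a ≤ X.m) :
    (testTogether.run s).var vOk ≠ 0 ↔
      ∀ p ∈ X.siblings, X.SameSchool (X.inst.matchingOf (vec X s)) p := by
  rw [testTogether, run_seq]
  set s₀ := (Cmd.assign vOk (.const 1)).run s with hs₀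
  have h₀ : Loaded X s₀ := h.run _ (by decide)
  have key := run_upTo (x := vPair) (b := vPairs) (c := .ite
      (.and (prefE fstE (.read kVec fstE))
        (.and (.le (prefE fstE (.read kVec fstE)) (prefE sndE (.read kVec sndE)))
          (.le (prefE sndE (.read kVec sndE)) (prefE fstE (.read kVec fstE)))))
      .skip (.assign vOk (.const 0))) s₀
    (fun i s' => s'.var vOk ≠ 0 ↔ ∀ k (hk : k < X.siblings.length), k < i →
      X.SameSchool (X.inst.matchingOf (vec X s)) X.siblings[k]) (by decide) ?_ ?_
  · rw [key, h₀.pairs]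
    constructor
    · intro g p hp
      obtain ⟨k, hk, rfl⟩ := List.mem_iff_getElem.1 hp
      exact g k hk hk
    · intro g k hk _
      exact g _ (List.getElem_mem hk)
  · simp [hs₀, run, State.setVar_var, Expr.eval]
  · intro k s' hk hK hV hA hc
    rw [h₀.pairs] at hk
    have h' : Loaded X s' := h₀.frame (by decide) hV hA
    have hv' : s'.arr kVec = s.arr kVec := by rw [hA _ (by decide)]; rfl
    have f1 := h'.eval_fstE hk hK
    have f2 := h'.eval_sndE hk hK
    have e1 := h'.eval_prefE (ei := .read kVec fstE) (q := vec X s) f1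
      (by rw [Expr.eval, f1, hv']; rfl) (hq _)
    have e2 := h'.eval_prefE (ei := .read kVec sndE) (q := vec X s) f2
      (by rw [Expr.eval, f2, hv']; rfl) (hq _)
    have hcond : (Expr.and (prefE fstE (.read kVec fstE))
        (.and (.le (prefE fstE (.read kVec fstE)) (prefE sndE (.read kVec sndE)))
          (.le (prefE sndE (.read kVec sndE)) (prefE fstE (.read kVec fstE))))).Holds s' ↔
        X.SameSchool (X.inst.matchingOf (vec X s)) X.siblings[k] := by
      rw [holds_and, holds_and, holds_le, holds_le, Expr.Holds, e1, e2,
        SiblingInstance.SameSchool, ← le_antisymm_iff, code_injective.eq_iff]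
      rcases X.inst.matchingOf (vec X s) X.siblings[k].1 with _ | b
      -- The outside option has code `0`; equal codes alone would wrongly accept a pair of
      -- unassigned students.
      · simp [code]
      · simp [code, eq_comm]
    have hsplit : (∀ j (hj : j < X.siblings.length), j < k + 1 →
        X.SameSchool (X.inst.matchingOf (vec X s)) X.siblings[j]) ↔
        s'.var vOk ≠ 0 ∧ X.SameSchool (X.inst.matchingOf (vec X s)) X.siblings[k] := by
      rw [hc]
      constructor
      · intro g; exact ⟨fun j hj hjk => g j hj (by omega), g k hk (by omega)⟩
      · rintro ⟨j1, j2⟩ j hj hjk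
        rcases (Nat.lt_succ_iff.1 hjk).lt_or_eq with h5 | rfl
        · exact j1 j hj h5
        · exact j2
    rw [hsplit, State.setVar_var, if_neg (by decide)]
    by_cases hg : X.SameSchool (X.inst.matchingOf (vec X s)) X.siblings[k]
    · rw [run_ite_of (hcond.2 hg), run]
      exact ⟨fun g => ⟨g, hg⟩, fun g => g.1⟩
    · rw [run_ite_of_not fun h' => hg (hcond.1 h'), run_assign, State.setVar_var, if_pos rfl]
      simp [Expr.eval, hg]

/-- Outputs the matching if all sibling pairs are together, and otherwise that there is none. -/
def outputAnswer : Cmd :=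
  .seq testTogether (.ite (.var vOk)
    (.seq (.write kOut (.const 0) (.const 1))
      (.seq (writeMatching 1) (.assign vOut (.var vStudentsSucc))))
    (.seq (.write kOut (.const 0) (.const 0)) (.assign vOut (.const 1))))

open Classical in
theorem outputAnswer_spec (h : Loaded X s) (hq : ∀ a, vec X s a ≤ X.m) :
    output (outputAnswer.run s) = X.encodeAnswer
      (if ∀ p ∈ X.siblings, X.SameSchool (X.inst.matchingOf (vec X s)) p then
        some (X.inst.matchingOf (vec X s)) else none) := by
  have ht : (Expr.var vOk).Holds (testTogether.run s) ↔ _ := testTogether_spec h hq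
  rw [outputAnswer, run_seq]
  set s₁ := testTogether.run s with hs₁
  have h₁ : Loaded X s₁ := h.run _ (by decide)
  have q₁ : vec X s₁ = vec X s := vec_congr (run_arr (by decide) s)
  by_cases hg : ∀ p ∈ X.siblings, X.SameSchool (X.inst.matchingOf (vec X s)) p
  · rw [if_pos hg, run_ite_of (ht.2 hg), run_seq, run_seq]
    set s₂ := (Cmd.write kOut (.const 0) (.const 1)).run s₁ with hs₂
    have h₂ : Loaded X s₂ := h₁.run _ (by decide)
    have q₂ : vec X s₂ = vec X s := q₁
    obtain ⟨k1, k2⟩ := writeMatching_spec h₂ (by rw [q₂]; exact hq) 1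
    rw [q₂] at k1
    set s₃ := (writeMatching 1).run s₂ with hs₃
    have n₃ : s₃.var vStudentsSucc = X.n + 1 := by rw [hs₃, run_var (by decide), h₂.studentsSucc]
    have hv : ((Cmd.assign vOut (.var vStudentsSucc)).run s₃).var 1 = X.n + 1 := by
      rw [run_assign, State.setVar_var, if_pos rfl, Expr.eval, n₃]
    have z₃ : s₃.arr kOut 0 = 1 := by
      rw [k2 0 (by decide), hs₂, run_write, State.setArr_arr, if_pos rfl]
      simp [Expr.eval]
    rw [output, hv, SiblingInstance.encodeAnswer, SiblingInstance.encodeMatching]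
    refine List.ext_getElem (by simp) fun i h1 h2 => ?_
    have hi : i < X.n + 1 := by simpa using h1
    cases i with
    | zero => simpa [run_assign, State.setVar_arr] using z₃
    | succ i => simpa [run_assign, State.setVar_arr] using k1 ⟨i, by omega⟩
  · rw [if_neg hg, run_ite_of_not (fun h' => hg (ht.1 h'))]
    simp [output, run, State.setVar_var, State.setVar_arr, State.setArr_arr, Expr.eval,
      SiblingInstance.encodeAnswer]

/-! ### Correctness and running time -/

/-- Computes the positions of an optimal stable matching from the input and then runs `c`. -/
def solve (c : Cmd) : Cmd :=
  .seq readSizes (.seq (.seq readTables findEvents) (.seq optimize c))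

/-- The memory after the computation of an optimal stable matching. -/
def optimum (X : SiblingInstance) : State :=
  optimize.run (findEvents.run (readTables.run (readSizes.run (init X.encode))))

theorem exists_events (X : SiblingInstance) :
    ∃ l : List X.Event,
      HasEvents (findEvents.run (readTables.run (readSizes.run (init X.encode)))) l ∧
      (∀ e ∈ l, e.Feasible) ∧ l.length ≤ X.siblings.length * X.m ∧
      ∀ q, X.inst.IsStablePos q →
        l.countP (fun e => e.Together q) = X.numTogether (X.inst.matchingOf q) := by
  refine findEvents_spec (readTables_spec X) ?_
  rw [run_var (by decide), run_var (by decide)]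
  rfl

theorem optimum_spec (X : SiblingInstance) :
    Loaded X (optimum X) ∧ X.inst.IsStablePos (vec X (optimum X)) ∧
      X.IsMaxTogether (X.inst.matchingOf (vec X (optimum X))) := by
  have h₁ := readTables_spec X
  obtain ⟨l, hl, hfe, -, hcount⟩ := exists_events X
  have h₂ := h₁.run findEvents (by decide)
  -- The arrays of the auction are untouched so far and still carry the zeros of the initial memory.
  have hz : ∀ k, 11 ≤ k →
      (findEvents.run (readTables.run (readSizes.run (init X.encode)))).arr k = 0 := by
    intro k hk
    have : ∀ c : Cmd, c.arrs.all (· < 11) → k ∉ c.arrs := fun c hc hkc => by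
      have := List.all_eq_true.1 hc k hkc
      simp only [decide_eq_true_eq] at this
      omega
    rw [run_arr (this _ (by decide)), run_arr (this _ (by decide)), run_arr (this _ (by decide))]
    funext i
    simp only [init, Pi.zero_apply]
    rw [if_neg (by omega)]
  obtain ⟨hq, hmax⟩ := optimize_spec h₂ hl hfe hz
  refine ⟨h₂.run _ (by decide), hq, hq.isStable, fun M hM => ?_⟩
  have hM' := hM.isStablePos
  -- Any competing stable matching is a stable vector, so counts of events compare counts of pairs.
  have := hmax _ hM'
  rw [hcount _ hM', SchoolInstance.matchingOf_posOf] at this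
  exact this.trans (hcount _ hq).le

theorem length_le_inputSize (l : List ℕ) : l.length ≤ inputSize l := by
  induction l with
  | nil => simp
  | cons a l ih =>
    simp only [inputSize, List.map_cons, List.sum_cons, List.length_cons] at ih ⊢
    omega

/-- A bound for the numbers of iterations of all loops. -/
noncomputable def loopBound : Polynomial ℕ :=
  Polynomial.X ^ 2 * (Polynomial.X ^ 2 + 3) + 3

theorem Loaded.bound_le (h : Loaded X s) {N : ℕ} (hN : X.encode.length ≤ N) :
    ∀ b ∈ [vLen, vStudents, vSchools, vPairs, vSchoolsSucc, vStudentsSucc], s.var b ≤ N := by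
  rw [length_encode] at hN
  have h1 : X.n ≤ X.n * (X.m + 1) := Nat.le_mul_of_pos_right _ (Nat.succ_pos _)
  simp only [List.mem_cons, List.not_mem_nil, or_false, forall_eq_or_imp, forall_eq, h.len,
    h.students, h.schools, h.pairs, h.schoolsSucc, h.studentsSucc, length_encode]
  omega

/-- A bound for the running time of `solve c`. -/
noncomputable def solveTime (c : Cmd) : Polynomial ℕ :=
  (readSizes.time + (readTables.seq findEvents).time + initAuction.time +
    (runAuction.seq (findGap.seq (collectFloors.seq raiseFloors))).time + c.time).comp loopBound

/-- The variables that hold the sizes of the input. -/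
abbrev sizeVars : List ℕ := [vLen, vStudents, vSchools, vPairs, vSchoolsSucc, vStudentsSucc]

theorem exists_exec_tables (h : Loaded X (readTables.run s)) {N : ℕ}
    (hN : X.encode.length ≤ N) :
    ∃ t, t ≤ (readTables.seq findEvents).time.eval N ∧
      Exec (readTables.seq findEvents).toProg s (findEvents.run (readTables.run s)) t := by
  have key : ∀ b ∈ (readTables.seq findEvents).bounds, b ∈ sizeVars := by decide
  have key₁ : ∀ b ∈ sizeVars, b ∉ (readTables.seq findEvents).vars := by decide
  have key₂ : ∀ b ∈ sizeVars, b ∉ readTables.vars := by decide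
  refine exists_exec (readTables.seq findEvents) (by decide) N s fun b hb =>
    ⟨?_, key₁ b (key b hb)⟩
  have h2 := h.bound_le hN b (key b hb)
  rwa [run_var (key₂ b (key b hb))] at h2

theorem exists_exec_initAuction {N : ℕ} (hN : s.var vEvents ≤ N) :
    ∃ t, t ≤ initAuction.time.eval N ∧ Exec initAuction.toProg s (initAuction.run s) t := by
  have key : ∀ b ∈ initAuction.bounds, b = vEvents ∧ b ∉ initAuction.vars := by decide
  exact exists_exec _ (by decide) N s fun b hb => ⟨(key b hb).1 ▸ hN, (key b hb).2⟩

theorem exists_exec_auction (h : Loaded X s) {N : ℕ} (hN : X.encode.length ≤ N)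
    (h₁ : s.var vEvents ≤ N) (h₂ : s.var vThreshold ≤ N) (h₃ : s.var vRounds ≤ N) :
    ∃ t, t ≤ (runAuction.seq (findGap.seq (collectFloors.seq raiseFloors))).time.eval N ∧
      Exec (runAuction.seq (findGap.seq (collectFloors.seq raiseFloors))).toProg s
        ((runAuction.seq (findGap.seq (collectFloors.seq raiseFloors))).run s) t := by
  have key : ∀ b ∈ (runAuction.seq (findGap.seq (collectFloors.seq raiseFloors))).bounds,
      b ∈ sizeVars ∨ b = vEvents ∨ b = vThreshold ∨ b = vRounds := by decide
  have key₁ : ∀ b ∈ vEvents :: vThreshold :: vRounds :: sizeVars,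
      b ∉ (runAuction.seq (findGap.seq (collectFloors.seq raiseFloors))).vars := by decide
  refine exists_exec _ (by decide) N s fun b hb => ⟨?_, key₁ b ?_⟩
  · rcases key b hb with h | rfl | rfl | rfl
    · exact Loaded.bound_le ‹_› hN b h
    · exact h₁
    · exact h₂
    · exact h₃
  · rcases key b hb with h | rfl | rfl | rfl
    · simp only [List.mem_cons] at h ⊢
      tauto
    · decide
    · decide
    · decide

/-- The program is timed in pieces because `exists_exec` forbids a piece to modify its own loop
bounds, whereas the number of events and the auction limits are computed on the way. -/
theorem exists_exec_solve (X : SiblingInstance) (c : Cmd) (hc : c.Proper)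
    (hb : ∀ b ∈ c.bounds, b ∈ sizeVars ∧ b ∉ c.vars) :
    ∃ t, t ≤ (solveTime c).eval (inputSize X.encode) ∧
      Exec (solve c).toProg (init X.encode) (c.run (optimum X)) t := by
  have hlen : X.encode.length ≤ inputSize X.encode := length_le_inputSize _
  rw [solveTime, Polynomial.eval_comp]
  have hNS : loopBound.eval (inputSize X.encode) =
      inputSize X.encode ^ 2 * (inputSize X.encode ^ 2 + 3) + 3 := by simp [loopBound]
  generalize loopBound.eval (inputSize X.encode) = N at hNS ⊢
  generalize inputSize X.encode = S at hlen hNS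
  have hS2 : S ≤ S ^ 2 := Nat.le_self_pow (by decide) S
  have hS4 : S ^ 2 * 3 ≤ S ^ 2 * (S ^ 2 + 3) := Nat.mul_le_mul_left _ (by omega)
  have hlenN : X.encode.length ≤ N := by omega
  obtain ⟨l, hl, -, hlm, -⟩ := exists_events X
  -- There are at most as many events as pairs times schools, each factor being at most the input
  -- size `S`; the number of rounds is then at most `S ^ 2 * (S ^ 2 + 3) + 1`.
  have hlS : l.length ≤ S ^ 2 := by
    rw [length_encode] at hlen
    rw [sq]
    exact hlm.trans (Nat.mul_le_mul (by omega) (by omega))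
  have hE := hl.length
  have hrounds := Nat.mul_le_mul hlS (Nat.add_le_add_right hlS 3)
  rw [← hE] at hrounds hlS
  have h₁ := readTables_spec X
  have h₂ := h₁.run findEvents (by decide)
  obtain ⟨o₁, -⟩ := optimum_spec X
  have hz : ∀ b ∈ readSizes.bounds, False := by decide
  obtain ⟨t₁, ht₁, e₁⟩ := exists_exec readSizes (by decide) N (init X.encode) fun b hb =>
    (hz b hb).elim
  obtain ⟨t₂, ht₂, e₂⟩ := exists_exec_tables h₁ hlenN
  obtain ⟨t₃, ht₃, e₃⟩ := exists_exec_initAuction (N := N) (hlS.trans (by omega))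
  obtain ⟨i₁, i₂⟩ := initAuction_spec
    (s := findEvents.run (readTables.run (readSizes.run (init X.encode)))) rfl
  have hE₃ := run_var (c := initAuction) (y := vEvents) (by decide)
    (findEvents.run (readTables.run (readSizes.run (init X.encode))))
  obtain ⟨t₄, ht₄, e₄⟩ := exists_exec_auction (h₂.run initAuction (by decide)) hlenN
    (by rw [hE₃]; exact hlS.trans (by omega)) (by rw [i₁]; omega) (by rw [i₂]; omega)
  obtain ⟨t₅, ht₅, e₅⟩ := exists_exec c hc N (optimum X) fun b hb' =>
    ⟨o₁.bound_le hlenN b (hb b hb').1, (hb b hb').2⟩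
  refine ⟨t₁ + (t₂ + (t₃ + t₄ + t₅)), ?_, ?_⟩
  · simp only [Polynomial.eval_add]
    omega
  · rw [optimum, optimize, run_seq] at e₅
    exact .seq e₁ (.seq e₂ (.seq (.seq e₃ e₄) e₅))

end RAM

/-- (MSSS) is solvable in polynomial time, and so is the problem of finding a stable matching that
assigns the maximum number of sibling pairs to the same school. -/
theorem mainTheorem4 :
    RAM.SolvableInPolyTime SiblingInstance.encode
      (fun X y => ∃ r, X.IsSameSchoolAnswer r ∧ y = X.encodeAnswer r) ∧
    RAM.SolvableInPolyTime SiblingInstance.encode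
      (fun X y => ∃ M, X.IsMaxTogether M ∧ y = X.encodeMatching M) := by
  classical
  refine ⟨⟨(RAM.solve RAM.outputAnswer).toProg, RAM.solveTime RAM.outputAnswer, fun X => ?_⟩,
    ⟨(RAM.solve RAM.outputMatching).toProg, RAM.solveTime RAM.outputMatching, fun X => ?_⟩⟩
  · obtain ⟨t, ht, he⟩ := RAM.exists_exec_solve X RAM.outputAnswer (by decide) (by decide)
    obtain ⟨h, hq, hst, hmax⟩ := RAM.optimum_spec X
    refine ⟨_, t, he, ht, _, ?_, RAM.outputAnswer_spec h hq.le⟩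
    split_ifs with hall
    · exact ⟨hst, hall⟩
    · rintro ⟨M, hM, hMs⟩
      have h1 := hmax M hM
      -- A solution of (MSSS) attains the full count, so the optimal matching attains it too and
      -- keeps every pair together.
      have h2 : X.numTogether M = X.siblings.length := by
        rw [SiblingInstance.numTogether, List.filter_eq_self.2 (by simpa using hMs)]
      rw [h2, SiblingInstance.numTogether] at h1
      refine hall fun p hp => ?_
      have h3 := List.length_filter_eq_length_iff.1 ((List.length_filter_le _ _).antisymm h1) p hp
      simpa using h3
  · obtain ⟨t, ht, he⟩ := RAM.exists_exec_solve X RAM.outputMatching (by decide) (by decide)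
    obtain ⟨h, hq, hmax⟩ := RAM.optimum_spec X
    exact ⟨_, t, he, ht, _, hmax, RAM.outputMatching_spec h hq.le⟩
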